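/- **Setting.** Let $M$ be a complete connected smooth orientable Riemannian manifold of dimension $n\ge 1$ that is locally Euclidean (every point has a neighbourhood isometric to an open subset of $\mathbb R^n$), with Riemannian distance $d$. Let $W\subseteq M$ be compact, $N\ge 2$, and let $S_1,\dots,S_N:W\to W$ be an IFS of contractive similitudes: $d(S_i(x),S_i(y))=\rho_i\,d(x,y)$ for all $x,y\in W$, with $\rho_i\in(0,1)$. Let $K\subseteq W$ be its attractor, i.e. the nonempty compact set with $K=\bigcup_i S_i(K)$. Let $\Sigma^*$ be the set of finite words over $\{1,\dots,N\}$, including the empty word $\varnothing$; $S_{\mathbf u}=S_{u_1}\circ\dots\circ S_{u_k}$, $\rho_{\mathbf u}=\rho_{u_1}\cdots\rho_{u_k}$, $S_\varnothing=\mathrm{id}_W$, $\rho_\varnothing=1$; and $\mathbf u\preceq\mathbf v$ means that $\mathbf u$ is an initial segment of $\mathbf v$ (or equal to it). **Nested index sets.** A sequence of nested index sets is a sequence $(\mathcal M_k)_{k\ge0}$ of finite nonempty subsets of $\Sigma^*$ with $\mathcal M_0=\{\varnothing\}$ such that, with $\underline m_k$ and $\overline m_k$ the minimal and maximal length of words in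 $\mathcal M_k$: (a) $\underline m_k,\overline m_k$ are nondecreasing in $k$ and tend to $\infty$; (b) distinct words of $\mathcal M_k$ are not comparable under $\preceq$; (c) every $\mathbf v$ with $|\mathbf v|>\overline m_k$ has an initial segment in $\mathcal M_k$; (d) every $\mathbf v$ with $|\mathbf v|<\underline m_k$ is an initial segment of a word in $\mathcal M_k$; (e) there is $L\geq 1$, independent of $k$, with $|\mathbf v|-|\mathbf u|\le L$ whenever $\mathbf u\in\mathcal M_k$, $\mathbf v\in\mathcal M_{k+1}$, $\mathbf u\preceq\mathbf v$; (f) every word of $\mathcal M_{k+1}$ has an initial segment in $\mathcal M_k$. **Vertices and types.** Let $\mathcal V_k=\{(S_{\mathbf u},k):\mathbf u\in\mathcal M_k\}$ and $\mathcal V=\bigcup_k\mathcal V_k$; for $\omega=(S_{\mathbf u},k)$ put $S_\omega=S_{\mathbf u}$. Let $\Omega\subseteq W$ be nonempty, open in $M$, with $S_i(\Omega)\subseteq\Omega$ for all $i$. For $\omega\in\mathcal V_k$ let $\Omega(\omega)=\{\sigma\in\mathcal V_k:S_\sigma(\Omega)\cap S_\omega(\Omega)\ne\emptyset\}$. Vertices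 $\omega\in\mathcal V_k$, $\omega'\in\mathcal V_{k'}$ are equivalent, $\omega\sim\omega'$, if $S_{\omega'}\circ S_\omega^{-1}$ (defined on $S_\omega(W)$) extends to a similitude $\tau:\bigcup_{\sigma\in\Omega(\omega)}S_\sigma(W)\to W$ such that $\{S_{\sigma'}:\sigma'\in\Omega(\omega')\}=\{\tau S_\sigma:\sigma\in\Omega(\omega)\}$ and, whenever $\sigma\in\Omega(\omega)$, $\sigma'\in\Omega(\omega')$, $S_{\sigma'}=\tau S_\sigma$, then for all $l\ge1$ and $\mathbf u\in\Sigma^*$: $(S_\sigma S_{\mathbf u},k+l)\in\mathcal V_{k+l}$ if and only if $(S_{\sigma'}S_{\mathbf u},k'+l)\in\mathcal V_{k'+l}$. The class $[\omega]$ is the neighbourhood type of $\omega$. The finite type condition (FTC) holds, with respect to $\Omega$ and $(\mathcal M_k)$, if there are only finitely many types $\mathcal T_1,\dots,\mathcal T_q$. **Reduced graph and matrix.** Let $\mathcal G$ be the graph on $\mathcal V$ with an edge $\omega\xrightarrow{\mathbf w}\sigma$ whenever $\omega\in\mathcal V_k$, $\sigma\in\mathcal V_{k+1}$, $\mathbf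 w\in\Sigma^*$ and $S_\sigma=S_\omega\circ S_{\mathbf w}$. Among all edges going to the same vertex keep only the one with lexicographically smallest label; then remove, repeatedly, all vertices without offspring, i.e. keep exactly the vertices from which an infinite path starts. The result is the reduced graph $\mathcal G_R$ with vertex set $\mathcal V_R$. For $\alpha\in\mathbb R$ the weighted incidence matrix $A_\alpha=(A_\alpha(i,j))_{i,j=1}^q$ is defined by choosing for each $i$ a vertex $\omega_i$ with $[\omega_i]=\mathcal T_i$, in $\mathcal V_R$ if there is one (otherwise the $i$-th row is zero), and setting $$A_\alpha(i,j)=\sum\{\rho_{\mathbf w}^{\alpha}:\ \omega_i\xrightarrow{\mathbf w}\sigma\text{ in }\mathcal G_R,\ [\sigma]=\mathcal T_j\}.$$ Let $\lambda_\alpha$ be the spectral radius of $A_\alpha$. **Theorem.** Suppose that $\{S_i\}_{i=1}^N$ satisfies (FTC) with respect to $\Omega$ and $(\mathcal M_k)$. Then, for every choice of the vertices $\omega_i$, there is exactly one $\alpha\in\mathbb R$ with $\lambda_\alpha=1$; it satisfies $\alpha\ge0$, and $\dim_{\rm H}(K)=\alpha$. -/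

import Mathlib

open Set Bundle Manifold
open scoped ENNReal ContDiff

namespace FiniteTypeIFS

/-! ### Manifolds -/

section Manifolds

variable (n : ℕ) (M : Type*) [TopologicalSpace M] [ChartedSpace (EuclideanSpace ℝ (Fin n)) M]

/-- A smooth `n`-manifold is orientable if it can be covered by a family of smooth charts all of
whose transition maps have positive Jacobian determinant. -/
def IsOrientable [IsManifold (𝓡 n) ∞ M] : Prop :=
  ∃ 𝒜 ⊆ IsManifold.maximalAtlas (𝓡 n) ∞ M,
    (∀ x : M, ∃ φ ∈ 𝒜, x ∈ φ.source) ∧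
    ∀ φ ∈ 𝒜, ∀ ψ ∈ 𝒜, ∀ y ∈ (φ.symm.trans ψ).source,
      0 < (fderiv ℝ (fun z => ψ (φ.symm z)) y).det

/-- A Riemannian `n`-manifold is locally Euclidean if every point has a neighbourhood (the source
of the chart `φ`) which is isometric, as a Riemannian manifold, to an open subset of Euclidean
space (the target of `φ`): the differential of `φ` preserves the norm of tangent vectors. -/
def IsLocallyEuclidean [IsManifold (𝓡 n) ∞ M]
    [RiemannianBundle (fun x : M => TangentSpace (𝓡 n) x)] : Prop :=
  ∀ x : M, ∃ φ ∈ IsManifold.maximalAtlas (𝓡 n) ∞ M, x ∈ φ.source ∧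
    ∀ y ∈ φ.source, ∀ v : TangentSpace (𝓡 n) y,
      ‖mfderiv (𝓡 n) (𝓡 n) φ y v‖ = ‖v‖

end Manifolds

/-! ### Iterated function systems on a metric space

In the theorem, the space `X` is a compact subset `W` of a manifold. Words over the alphabet
`Fin N` are lists; the empty word is allowed. -/

section IFS

variable {X : Type*} {N : ℕ}

/-- `S_u = S_{u₁} ∘ ⋯ ∘ S_{u_k}`, the identity for the empty word. -/
def wordMap (S : Fin N → X → X) : List (Fin N) → X → X
  | [] => id
  | i :: u => S i ∘ wordMap S u

/-- `ρ_u = ρ_{u₁} ⋯ ρ_{u_k}`. -/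
def wordRatio (ρ : Fin N → ℝ) (u : List (Fin N)) : ℝ := (u.map ρ).prod

/-- `S₁, …, S_N` are contractive similitudes with contraction ratios `ρ₁, …, ρ_N`. -/
def IsContractiveSimilitudes [MetricSpace X] (S : Fin N → X → X) (ρ : Fin N → ℝ) : Prop :=
  ∀ i, 0 < ρ i ∧ ρ i < 1 ∧ ∀ x y, dist (S i x) (S i y) = ρ i * dist x y

/-- `K` is the attractor: nonempty, compact and `K = ⋃ᵢ Sᵢ(K)`. -/
def IsAttractor [TopologicalSpace X] (S : Fin N → X → X) (K : Set X) : Prop :=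
  K.Nonempty ∧ IsCompact K ∧ K = ⋃ i, S i '' K

/-- `m` is the minimal length of the words in `A`. -/
def IsMinLength (A : Finset (List (Fin N))) (m : ℕ) : Prop :=
  (∃ u ∈ A, u.length = m) ∧ ∀ u ∈ A, m ≤ u.length

/-- `m` is the maximal length of the words in `A`. -/
def IsMaxLength (A : Finset (List (Fin N))) (m : ℕ) : Prop :=
  (∃ u ∈ A, u.length = m) ∧ ∀ u ∈ A, u.length ≤ m

/-- A sequence `ℳ₀, ℳ₁, …` of nested index sets, with minimal lengths `lo k` and maximal lengths
`hi k` of the words in `ℳ k`. The relation `u <+: v` says that `u` is an initial segment of `v`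
(possibly `u = v`). -/
structure IsNestedIndexSets (ℳ : ℕ → Finset (List (Fin N))) : Prop where
  root : ℳ 0 = {[]}
  lengths : ∃ lo hi : ℕ → ℕ,
    (∀ k, IsMinLength (ℳ k) (lo k)) ∧ (∀ k, IsMaxLength (ℳ k) (hi k)) ∧
    Monotone lo ∧ Monotone hi ∧
    Filter.Tendsto lo Filter.atTop Filter.atTop ∧ Filter.Tendsto hi Filter.atTop Filter.atTop ∧
    (∀ k, ∀ v : List (Fin N), hi k < v.length → ∃ u ∈ ℳ k, u <+: v) ∧
    (∀ k, ∀ v : List (Fin N), v.length < lo k → ∃ u ∈ ℳ k, v <+: u)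
  antichain : ∀ k, ∀ u ∈ ℳ k, ∀ v ∈ ℳ k, u <+: v → u = v
  nested : ∀ k, ∀ v ∈ ℳ (k + 1), ∃ u ∈ ℳ k, u <+: v
  bounded : ∃ L : ℕ, 0 < L ∧
    ∀ k, ∀ u ∈ ℳ k, ∀ v ∈ ℳ (k + 1), u <+: v → v.length - u.length ≤ L

/-- The maps `S_u`, `u ∈ ℳ k`, i.e. the maps of the vertices of level `k`. -/
def levelMaps (S : Fin N → X → X) (ℳ : ℕ → Finset (List (Fin N))) (k : ℕ) : Set (X → X) :=
  {f | ∃ u ∈ ℳ k, f = wordMap S u}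

/-- A vertex `η = (S_u, k)`, `u ∈ ℳ k`. It remembers the map `S_η = S_u`, not the word `u`. -/
@[ext]
structure Vertex (S : Fin N → X → X) (ℳ : ℕ → Finset (List (Fin N))) where
  level : ℕ
  map : X → X
  mem : map ∈ levelMaps S ℳ level

variable {S : Fin N → X → X} {ℳ : ℕ → Finset (List (Fin N))}

/-- The neighbourhood `Ω(η)`: the vertices `σ` of the same level with
`S_η(Ω) ∩ S_σ(Ω) ≠ ∅`. -/
def Vertex.nbhd (Ω : Set X) (η : Vertex S ℳ) : Set (Vertex S ℳ) :=
  {σ | σ.level = η.level ∧ (η.map '' Ω ∩ σ.map '' Ω).Nonempty}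

/-- The set `⋃_{σ ∈ Ω(η)} S_σ(W)`. -/
def Vertex.dom (Ω : Set X) (η : Vertex S ℳ) : Set X :=
  ⋃ σ ∈ η.nbhd Ω, range σ.map

/-- Equivalence of vertices. Here `τ` is `S_η' S_η⁻¹` on `⋃_{σ ∈ Ω(η)} S_σ(W)`: the similitude
that is given by `S_η' ∘ S_η⁻¹` on `S_η(W)`. Its values off this union are irrelevant. -/
def Vertex.Equivalent [MetricSpace X] (Ω : Set X) (η η' : Vertex S ℳ) : Prop :=
  ∃ τ : X → X,
    (∃ c : ℝ, 0 < c ∧ ∀ x ∈ η.dom Ω, ∀ y ∈ η.dom Ω, dist (τ x) (τ y) = c * dist x y) ∧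
    τ ∘ η.map = η'.map ∧
    {f | ∃ σ' ∈ η'.nbhd Ω, f = σ'.map} = {f | ∃ σ ∈ η.nbhd Ω, f = τ ∘ σ.map} ∧
    ∀ σ ∈ η.nbhd Ω, ∀ σ' ∈ η'.nbhd Ω, σ'.map = τ ∘ σ.map →
      ∀ l : ℕ, 1 ≤ l → ∀ u : List (Fin N),
        (σ.map ∘ wordMap S u ∈ levelMaps S ℳ (η.level + l) ↔
          σ'.map ∘ wordMap S u ∈ levelMaps S ℳ (η'.level + l))

lemma Vertex.Equivalent.refl [MetricSpace X] (Ω : Set X) (η : Vertex S ℳ) :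
    η.Equivalent Ω η := by
  refine ⟨id, ⟨1, one_pos, fun x _ y _ => by simp⟩, rfl, rfl, ?_⟩
  intro σ _ σ' _ h l _ u
  rw [h, Function.id_comp]

lemma Vertex.mem_dom {Ω : Set X} {η σ : Vertex S ℳ} (hσ : σ ∈ η.nbhd Ω) (x : X) :
    σ.map x ∈ η.dom Ω :=
  mem_iUnion₂.2 ⟨σ, hσ, mem_range_self x⟩

lemma Vertex.Equivalent.trans [MetricSpace X] {Ω : Set X} {η₁ η₂ η₃ : Vertex S ℳ}
    (h₁ : η₁.Equivalent Ω η₂) (h₂ : η₂.Equivalent Ω η₃) : η₁.Equivalent Ω η₃ := by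
  obtain ⟨τ, ⟨c, hc, hd⟩, hm, hs, hu⟩ := h₁
  obtain ⟨τ', ⟨c', hc', hd'⟩, hm', hs', hu'⟩ := h₂
  have key : ∀ σ ∈ η₁.nbhd Ω, ∃ σ' ∈ η₂.nbhd Ω, σ'.map = τ ∘ σ.map := by
    intro σ hσ
    have : τ ∘ σ.map ∈ {f | ∃ σ' ∈ η₂.nbhd Ω, f = σ'.map} := by
      rw [hs]; exact ⟨σ, hσ, rfl⟩
    obtain ⟨σ', h, e⟩ := this
    exact ⟨σ', h, e.symm⟩
  have key2 : ∀ σ' ∈ η₂.nbhd Ω, ∃ σ ∈ η₁.nbhd Ω, σ'.map = τ ∘ σ.map := by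
    intro σ' hσ'
    have : σ'.map ∈ {f | ∃ σ ∈ η₁.nbhd Ω, f = τ ∘ σ.map} := by
      rw [← hs]; exact ⟨σ', hσ', rfl⟩
    exact this
  have hdom : ∀ x ∈ η₁.dom Ω, τ x ∈ η₂.dom Ω := by
    intro x hx
    obtain ⟨σ, hσ, y, rfl⟩ := mem_iUnion₂.1 hx
    obtain ⟨σ', h, e⟩ := key σ hσ
    have := Vertex.mem_dom h y
    rwa [e] at this
  refine ⟨τ' ∘ τ, ⟨c' * c, mul_pos hc' hc, ?_⟩, ?_, ?_, ?_⟩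
  · intro x hx y hy
    rw [Function.comp, Function.comp, hd' _ (hdom x hx) _ (hdom y hy), hd x hx y hy, mul_assoc]
  · rw [Function.comp_assoc, hm, hm']
  · rw [hs']
    ext f
    constructor
    · rintro ⟨σ', h, rfl⟩
      obtain ⟨σ, hσ, e⟩ := key2 σ' h
      exact ⟨σ, hσ, by rw [e, Function.comp_assoc]⟩
    · rintro ⟨σ, h, rfl⟩
      obtain ⟨σ', hσ', e⟩ := key σ h
      exact ⟨σ', hσ', by rw [e, Function.comp_assoc]⟩
  · intro σ hσ σ'' hσ'' e l hl u
    obtain ⟨σ', hσ', e'⟩ := key σ hσ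
    rw [hu σ hσ σ' hσ' e' l hl u]
    exact hu' σ' hσ' σ'' hσ'' (by rw [e, e', Function.comp_assoc]) l hl u

lemma Vertex.mem_nbhd_self {Ω : Set X} (hΩ : Ω.Nonempty) (η : Vertex S ℳ) : η ∈ η.nbhd Ω := by
  obtain ⟨z, hz⟩ := hΩ
  exact ⟨rfl, η.map z, ⟨z, hz, rfl⟩, ⟨z, hz, rfl⟩⟩

lemma Vertex.Equivalent.symm [MetricSpace X] {Ω : Set X} (hΩ : Ω.Nonempty) {η₁ η₂ : Vertex S ℳ}
    (h₁ : η₁.Equivalent Ω η₂) : η₂.Equivalent Ω η₁ := by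
  obtain ⟨τ, ⟨c, hc, hd⟩, hm, hs, hu⟩ := h₁
  have hX : Nonempty X := ⟨hΩ.some⟩
  have key2 : ∀ σ' ∈ η₂.nbhd Ω, ∃ σ ∈ η₁.nbhd Ω, σ'.map = τ ∘ σ.map := by
    intro σ' hσ'
    have : σ'.map ∈ {f | ∃ σ ∈ η₁.nbhd Ω, f = τ ∘ σ.map} := by
      rw [← hs]; exact ⟨σ', hσ', rfl⟩
    exact this
  have key : ∀ σ ∈ η₁.nbhd Ω, ∃ σ' ∈ η₂.nbhd Ω, σ'.map = τ ∘ σ.map := by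
    intro σ hσ
    have : τ ∘ σ.map ∈ {f | ∃ σ' ∈ η₂.nbhd Ω, f = σ'.map} := by
      rw [hs]; exact ⟨σ, hσ, rfl⟩
    obtain ⟨σ', h, e⟩ := this
    exact ⟨σ', h, e.symm⟩
  have hinj : InjOn τ (η₁.dom Ω) := by
    intro x hx y hy hxy
    have h := hd x hx y hy
    rw [hxy, dist_self] at h
    exact dist_eq_zero.1 ((mul_eq_zero.1 h.symm).resolve_left hc.ne')
  have hdom : ∀ y ∈ η₂.dom Ω, ∃ x ∈ η₁.dom Ω, τ x = y := by
    intro y hy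
    obtain ⟨σ', hσ', z, rfl⟩ := mem_iUnion₂.1 hy
    obtain ⟨σ, hσ, e⟩ := key2 σ' hσ'
    exact ⟨σ.map z, Vertex.mem_dom hσ z, by rw [e]; rfl⟩
  let κ : X → X := Function.invFunOn τ (η₁.dom Ω)
  have hκ : ∀ x ∈ η₁.dom Ω, κ (τ x) = x := fun x hx => hinj.leftInvOn_invFunOn hx
  have hκm : ∀ σ ∈ η₁.nbhd Ω, κ ∘ (τ ∘ σ.map) = σ.map := by
    intro σ hσ
    funext z
    exact hκ _ (Vertex.mem_dom hσ z)
  refine ⟨κ, ⟨c⁻¹, inv_pos.2 hc, ?_⟩, ?_, ?_, ?_⟩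
  · intro x hx y hy
    obtain ⟨a, ha, rfl⟩ := hdom x hx
    obtain ⟨b, hb, rfl⟩ := hdom y hy
    rw [hκ a ha, hκ b hb, hd a ha b hb, inv_mul_cancel_left₀ hc.ne']
  · rw [← hm]
    exact hκm η₁ (η₁.mem_nbhd_self hΩ)
  · ext f
    constructor
    · rintro ⟨σ, h, rfl⟩
      obtain ⟨σ', hσ', e⟩ := key σ h
      exact ⟨σ', hσ', by rw [e, hκm σ h]⟩
    · rintro ⟨σ', h, rfl⟩
      obtain ⟨σ, hσ, e⟩ := key2 σ' h
      exact ⟨σ, hσ, by rw [e, hκm σ hσ]⟩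
  · intro σ' hσ' σ hσ e l hl u
    refine (hu σ hσ σ' hσ' ?_ l hl u).symm
    obtain ⟨σ₀, hσ₀, e₀⟩ := key2 σ' hσ'
    rw [e, e₀, hκm σ₀ hσ₀]

/-- Equivalence of vertices as an equivalence relation. -/
def vertexSetoid [MetricSpace X] (S : Fin N → X → X) (ℳ : ℕ → Finset (List (Fin N)))
    (Ω : Set X) (hΩ : Ω.Nonempty) : Setoid (Vertex S ℳ) where
  r := Vertex.Equivalent Ω
  iseqv := ⟨Vertex.Equivalent.refl Ω, Vertex.Equivalent.symm hΩ, Vertex.Equivalent.trans⟩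

/-- The set `𝒱/∼` of neighbourhood types. -/
abbrev NbhdType [MetricSpace X] (S : Fin N → X → X) (ℳ : ℕ → Finset (List (Fin N)))
    (Ω : Set X) (hΩ : Ω.Nonempty) : Type _ :=
  Quotient (vertexSetoid S ℳ Ω hΩ)

/-- The neighbourhood type `[η]` of a vertex. -/
def nbhdType [MetricSpace X] (Ω : Set X) (hΩ : Ω.Nonempty) (η : Vertex S ℳ) :
    NbhdType S ℳ Ω hΩ :=
  Quotient.mk (vertexSetoid S ℳ Ω hΩ) η

/-- There is a directed edge in `𝒢` from `η = (S_u, k)` to `σ = (S_v, k + 1)` with label `w`,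
where `v = uw`. -/
def IsEdge (η : Vertex S ℳ) (w : List (Fin N)) (σ : Vertex S ℳ) : Prop :=
  σ.level = η.level + 1 ∧ σ.map = η.map ∘ wordMap S w

/-- The edges of `𝒢` that remain when, among all edges going to the same vertex, only the one
with the lexicographically smallest label is kept. -/
def IsMinEdge (η : Vertex S ℳ) (w : List (Fin N)) (σ : Vertex S ℳ) : Prop :=
  IsEdge η w σ ∧ ∀ (η' : Vertex S ℳ) (w' : List (Fin N)), IsEdge η' w' σ → w ≤ w'

/-- The vertex set `𝒱_R` of the reduced graph. Removing the vertices without offspring, then the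
vertices all of whose offspring have been removed, and so on, leaves exactly the vertices from
which an infinite path of remaining edges starts. -/
def reducedVertices (S : Fin N → X → X) (ℳ : ℕ → Finset (List (Fin N))) : Set (Vertex S ℳ) :=
  {η | ∃ p : ℕ → Vertex S ℳ, p 0 = η ∧ ∀ j, ∃ w, IsMinEdge (p j) w (p (j + 1))}

/-- The edges of the reduced graph `𝒢_R`. -/
def IsReducedEdge (η : Vertex S ℳ) (w : List (Fin N)) (σ : Vertex S ℳ) : Prop :=
  IsMinEdge η w σ ∧ η ∈ reducedVertices S ℳ ∧ σ ∈ reducedVertices S ℳ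

/-- The weighted incidence matrix `A_α`, where row `T` is computed from the vertex `rep T` of
type `T`: the entry `(T, T')` is the sum of `ρ_w ^ α` over the (finitely many) edges
`rep T → σ` of `𝒢_R` with label `w` and `[σ] = T'`; an edge is determined by its initial vertex
and its label. -/
noncomputable def weightedIncidenceMatrix [MetricSpace X] (ρ : Fin N → ℝ)
    (Ω : Set X) (hΩ : Ω.Nonempty) (rep : NbhdType S ℳ Ω hΩ → Vertex S ℳ) (α : ℝ) :
    Matrix (NbhdType S ℳ Ω hΩ) (NbhdType S ℳ Ω hΩ) ℝ :=
  Matrix.of fun T T' =>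
    ∑ᶠ w ∈ {w | ∃ σ, IsReducedEdge (rep T) w σ ∧ nbhdType Ω hΩ σ = T'}, wordRatio ρ w ^ α

/-- A choice of a vertex of each type, taken from the reduced graph for every type that occurs in
the reduced graph. -/
def IsRepresentatives [MetricSpace X] {Ω : Set X} {hΩ : Ω.Nonempty}
    (rep : NbhdType S ℳ Ω hΩ → Vertex S ℳ) : Prop :=
  ∀ T, nbhdType Ω hΩ (rep T) = T ∧
    ((∃ η ∈ reducedVertices S ℳ, nbhdType Ω hΩ η = T) → rep T ∈ reducedVertices S ℳ)

end IFS

/-- `W` is a subset of `M`, the `Sᵢ` are self-maps of `W`; the finite type condition holds with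
respect to `Ω ⊆ W` and the sequence `ℳ`. -/
structure IsFiniteType {M : Type*} [MetricSpace M] {W : Set M} {N : ℕ} (S : Fin N → W → W)
    (ℳ : ℕ → Finset (List (Fin N))) (Ω : Set W) (hΩ : Ω.Nonempty) : Prop where
  nested : IsNestedIndexSets ℳ
  isOpen : IsOpen (Subtype.val '' Ω : Set M)
  invariant : ∀ i, S i '' Ω ⊆ Ω
  finite : Finite (NbhdType S ℳ Ω hΩ)

open Classical in
/-- The spectral radius of a real square matrix with finite index set: the maximal modulus of its
complex eigenvalues. -/
noncomputable def matrixSpectralRadius {ι : Type*} [Finite ι] (A : Matrix ι ι ℝ) : ℝ≥0∞ :=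
  letI := Fintype.ofFinite ι
  spectralRadius ℂ (A.map Complex.ofReal)

end FiniteTypeIFS

open FiniteTypeIFS

namespace FiniteTypeIFS

variable {X : Type*} {N : ℕ} {S : Fin N → X → X} {ρ : Fin N → ℝ}
  {ℳ : ℕ → Finset (List (Fin N))}

/-! ### Words -/

/-! An equivalence of vertices carries neighbourhoods, edge labels and minimality of labels to the
next level (`Vertex.Equivalent.exists_isEdge`). Hence the labelled tree of reduced descendants of a
vertex depends only on its type, and the entries of the k-th power of the incidence matrix are sums
of α-th powers of relative contraction ratios over the k-th generation
(`weightedIncidenceMatrix_pow_apply`). For generations to be counted without repetition, a vertex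
must have at most one parent in the reduced graph. This is right cancellation: S_u S_w = S_u' S_w
forces S_u = S_u'. On the manifold the two maps have the same ratio and agree on the image of S_w,
so the images of any given point under them have equal distances from all points of a nonempty open
set. A point is determined by such distances, because geodesics of a flat manifold do not branch
(`eq_of_dist_eq_on_open`).

Existence and uniqueness of α: over a fixed number of levels all ratios shrink at least by 1/2 and
at most by a fixed factor. By Gelfand's formula the spectral radius then has exponential bounds from
both sides in α. It is at least one at α = 0, since the tree below the root never dies out, and so
it equals one exactly once, at some α ≥ 0.

Upper bound: for β > α the cells of the k-th generation below the root cover the attractor, and the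
sum of their β-th powers tends to zero (`dimH_le_of_spectralRadius_lt_one`).

Lower bound: the moduli of an eigenvector for an eigenvalue of modulus one form a subinvariant
weight, whose total over any cut of the tree is bounded below (`le_sum_of_cut`). A cover of the
attractor by sets of diameter at most r_i induces a cut. By a volume argument each covering set
accounts for boundedly many cut vertices (`exists_card_cut_le`). The sums of r_i^α are therefore
bounded below and the α-dimensional Hausdorff measure is positive. Neither irreducibility nor a
limiting mass distribution is needed. -/

lemma wordMap_append (u v : List (Fin N)) :
    wordMap S (u ++ v) = wordMap S u ∘ wordMap S v := by
  induction u with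
  | nil => rfl
  | cons i u ih => simp only [List.cons_append, wordMap, ih, Function.comp_assoc]

lemma wordRatio_append (u v : List (Fin N)) :
    wordRatio ρ (u ++ v) = wordRatio ρ u * wordRatio ρ v := by
  simp [wordRatio]

lemma wordMap_image_subset {Ω : Set X} (hinv : ∀ i, S i '' Ω ⊆ Ω) (u : List (Fin N)) :
    wordMap S u '' Ω ⊆ Ω := by
  induction u with
  | nil => simp [wordMap]
  | cons i u ih =>
    rw [wordMap, image_comp]
    exact (image_mono ih).trans (hinv i)

section Metric

variable [MetricSpace X]

lemma wordRatio_pos (hS : IsContractiveSimilitudes S ρ) (u : List (Fin N)) :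
    0 < wordRatio ρ u := by
  induction u with
  | nil => simp [wordRatio]
  | cons i u ih =>
    have : wordRatio ρ (i :: u) = ρ i * wordRatio ρ u := by simp [wordRatio]
    rw [this]
    exact mul_pos (hS i).1 ih

lemma dist_wordMap (hS : IsContractiveSimilitudes S ρ) (u : List (Fin N)) (x y : X) :
    dist (wordMap S u x) (wordMap S u y) = wordRatio ρ u * dist x y := by
  induction u with
  | nil => simp [wordRatio, wordMap]
  | cons i u ih =>
    have : wordRatio ρ (i :: u) = ρ i * wordRatio ρ u := by simp [wordRatio]
    rw [this, wordMap, Function.comp, Function.comp, (hS i).2.2, ih, mul_assoc]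

lemma exists_wordRatio_le_pow (hS : IsContractiveSimilitudes S ρ) :
    ∃ r : ℝ, 0 < r ∧ r < 1 ∧ ∀ u : List (Fin N), wordRatio ρ u ≤ r ^ u.length := by
  obtain ⟨r, hr0, hr1, hr⟩ : ∃ r : ℝ, 0 < r ∧ r < 1 ∧ ∀ i, ρ i ≤ r := by
    rcases isEmpty_or_nonempty (Fin N) with h | h
    · exact ⟨1 / 2, by norm_num, by norm_num, fun i => isEmptyElim i⟩
    · obtain ⟨i, hi⟩ := Finite.exists_max ρ
      exact ⟨ρ i, (hS i).1, (hS i).2.1, hi⟩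
  refine ⟨r, hr0, hr1, fun u => ?_⟩
  induction u with
  | nil => simp [wordRatio]
  | cons i u ih =>
    have : wordRatio ρ (i :: u) = ρ i * wordRatio ρ u := by simp [wordRatio]
    rw [this, List.length_cons, pow_succ']
    exact mul_le_mul (hr i) ih (wordRatio_pos hS u).le hr0.le

lemma wordRatio_le_one (hS : IsContractiveSimilitudes S ρ) (u : List (Fin N)) :
    wordRatio ρ u ≤ 1 := by
  obtain ⟨r, h0, h1, h⟩ := exists_wordRatio_le_pow hS
  exact (h u).trans (pow_le_one₀ h0.le h1.le)

/-- Ratios decay geometrically with the length. The finiteness is needed because the lexicographic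
order on words is not well-founded, so a smallest label exists only among finitely many candidates.
-/
lemma finite_setOf_le_wordRatio (hS : IsContractiveSimilitudes S ρ) {c : ℝ} (hc : 0 < c) :
    {u : List (Fin N) | c ≤ wordRatio ρ u}.Finite := by
  obtain ⟨r, h0, h1, h⟩ := exists_wordRatio_le_pow hS
  obtain ⟨m, hm⟩ := exists_pow_lt_of_lt_one hc h1
  refine (List.finite_length_lt (Fin N) m).subset fun u hu => ?_
  by_contra hlt
  have hlt : m ≤ u.length := not_lt.1 hlt
  exact absurd (hu.trans ((h u).trans (pow_le_pow_of_le_one h0.le h1.le hlt))) (not_le.2 hm)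

/-- Two distinct points suffice to read the ratio off the map. A vertex remembers a map and not a
word, so this makes its ratio independent of the chosen word. -/
lemma wordRatio_eq_of_wordMap_eq [Nontrivial X] (hS : IsContractiveSimilitudes S ρ)
    {u v : List (Fin N)} (h : wordMap S u = wordMap S v) : wordRatio ρ u = wordRatio ρ v := by
  obtain ⟨x, y, hxy⟩ := exists_pair_ne X
  have h1 := dist_wordMap hS u x y
  rw [h, dist_wordMap hS v] at h1
  exact (mul_right_cancel₀ (dist_ne_zero.2 hxy) h1).symm

end Metric

/-! ### Vertices -/

namespace Vertex

/-- A word representing the vertex. -/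
noncomputable def word (σ : Vertex S ℳ) : List (Fin N) := σ.mem.choose

lemma word_mem (σ : Vertex S ℳ) : σ.word ∈ ℳ σ.level := σ.mem.choose_spec.1

lemma map_eq (σ : Vertex S ℳ) : σ.map = wordMap S σ.word := σ.mem.choose_spec.2

/-- The contraction ratio of the map of the vertex. -/
noncomputable def ratio (ρ : Fin N → ℝ) (σ : Vertex S ℳ) : ℝ := wordRatio ρ σ.word

lemma finite_level (S : Fin N → X → X) (ℳ : ℕ → Finset (List (Fin N))) (k : ℕ) :
    {σ : Vertex S ℳ | σ.level = k}.Finite := by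
  refine Set.Finite.of_finite_image (f := Vertex.map)
    (((ℳ k).finite_toSet.image (wordMap S)).subset ?_) ?_
  · rintro _ ⟨σ, rfl, rfl⟩
    exact ⟨σ.word, σ.word_mem, σ.map_eq.symm⟩
  · rintro σ hσ τ hτ h
    exact Vertex.ext (hσ.trans hτ.symm) h

lemma nbhd_finite (Ω : Set X) (η : Vertex S ℳ) : (η.nbhd Ω).Finite :=
  (finite_level S ℳ η.level).subset fun _ h => h.1

/-- There is an ancestor of level `k` in the (unreduced) graph. -/
lemma exists_map_eq_comp (hℳ : IsNestedIndexSets ℳ) (σ : Vertex S ℳ) {k : ℕ}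
    (hk : k ≤ σ.level) :
    ∃ (ζ : Vertex S ℳ) (w : List (Fin N)), ζ.level = k ∧ σ.map = ζ.map ∘ wordMap S w := by
  suffices H : ∀ l, k ≤ l → ∀ v ∈ ℳ l, ∃ u ∈ ℳ k, u <+: v by
    obtain ⟨u, hu, w, hw⟩ := H _ hk _ σ.word_mem
    refine ⟨⟨k, wordMap S u, u, hu, rfl⟩, w, rfl, ?_⟩
    rw [σ.map_eq, ← hw, wordMap_append]
  intro l hl
  induction l, hl using Nat.le_induction with
  | base => exact fun v hv => ⟨v, hv, List.prefix_rfl⟩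
  | succ l _ ih =>
    intro v hv
    obtain ⟨u, hu, huv⟩ := hℳ.nested l v hv
    obtain ⟨t, ht, htu⟩ := ih u hu
    exact ⟨t, ht, htu.trans huv⟩

/-- The root of the graph. -/
def root (S : Fin N → X → X) (hℳ : IsNestedIndexSets ℳ) : Vertex S ℳ :=
  ⟨0, id, [], by simp [hℳ.root], rfl⟩

lemma eq_root (hℳ : IsNestedIndexSets ℳ) {σ : Vertex S ℳ} (h : σ.level = 0) :
    σ = root S hℳ := by
  refine Vertex.ext h ?_
  have := σ.word_mem
  rw [h, hℳ.root, Finset.mem_singleton] at this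
  rw [σ.map_eq, this]
  rfl

section Metric

variable [MetricSpace X]

lemma ratio_pos (hS : IsContractiveSimilitudes S ρ) (σ : Vertex S ℳ) : 0 < σ.ratio ρ :=
  wordRatio_pos hS _

lemma dist_map (hS : IsContractiveSimilitudes S ρ) (σ : Vertex S ℳ) (x y : X) :
    dist (σ.map x) (σ.map y) = σ.ratio ρ * dist x y := by
  rw [map_eq, dist_wordMap hS]; rfl

variable [Nontrivial X]

lemma ratio_of_map_eq_comp (hS : IsContractiveSimilitudes S ρ) {η σ : Vertex S ℳ}
    {w : List (Fin N)} (h : σ.map = η.map ∘ wordMap S w) :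
    σ.ratio ρ = η.ratio ρ * wordRatio ρ w := by
  rw [ratio, ratio, ← wordRatio_append]
  apply wordRatio_eq_of_wordMap_eq hS
  rw [wordMap_append, ← map_eq, ← map_eq, h]

/-- The contraction ratio is determined by the map. -/
lemma ratio_eq_of_dist (hS : IsContractiveSimilitudes S ρ) (σ : Vertex S ℳ) {c : ℝ}
    (h : ∀ x y, dist (σ.map x) (σ.map y) = c * dist x y) : σ.ratio ρ = c := by
  obtain ⟨x, y, hxy⟩ := exists_pair_ne X
  have := h x y
  rw [dist_map hS] at this
  exact mul_right_cancel₀ (dist_ne_zero.2 hxy) this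

lemma exists_isMinEdge (hS : IsContractiveSimilitudes S ρ) (hℳ : IsNestedIndexSets ℳ)
    {σ : Vertex S ℳ} {k : ℕ} (hk : σ.level = k + 1) :
    ∃ (η : Vertex S ℳ) (w : List (Fin N)), IsMinEdge η w σ := by
  have hfin : {w | ∃ η : Vertex S ℳ, IsEdge η w σ}.Finite := by
    -- The ratio of σ is that of the parent, which is at most one, times that of the label; so each
    -- candidate label has ratio at least that of σ.
    refine (finite_setOf_le_wordRatio hS (ratio_pos hS σ)).subset ?_
    rintro w ⟨η, -, h⟩
    rw [mem_ofPred_eq, ratio_of_map_eq_comp hS h]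
    exact mul_le_of_le_one_left (wordRatio_pos hS w).le (wordRatio_le_one hS _)
  obtain ⟨η, w, hη, h⟩ := exists_map_eq_comp hℳ σ (k := k) (by omega)
  obtain ⟨w₀, ⟨η₀, h₀⟩, hmin⟩ :=
    Set.exists_min_image _ id hfin ⟨w, η, by rw [hη, hk], h⟩
  exact ⟨η₀, w₀, h₀, fun η' w' h' => hmin w' ⟨η', h'⟩⟩

end Metric

end Vertex

/-! ### Minimal lengths -/

lemma IsNestedIndexSets.eventually_le_length (hℳ : IsNestedIndexSets ℳ) (m : ℕ) :
    ∃ k₀, ∀ k ≥ k₀, ∀ u ∈ ℳ k, m ≤ u.length := by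
  obtain ⟨lo, hi, hlo, -, -, -, htend, -⟩ := hℳ.lengths
  obtain ⟨k₀, h⟩ := (htend.eventually_ge_atTop m).exists_forall_of_atTop
  exact ⟨k₀, fun k hk u hu => (h k hk).trans ((hlo k).2 u hu)⟩

lemma Vertex.eventually_ratio_le [MetricSpace X] (hS : IsContractiveSimilitudes S ρ)
    (hℳ : IsNestedIndexSets ℳ) {ε : ℝ} (hε : 0 < ε) :
    ∃ k₀, ∀ σ : Vertex S ℳ, k₀ ≤ σ.level → σ.ratio ρ ≤ ε := by
  obtain ⟨r, h0, h1, h⟩ := exists_wordRatio_le_pow hS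
  obtain ⟨m, hm⟩ := exists_pow_lt_of_lt_one hε h1
  obtain ⟨k₀, hk⟩ := hℳ.eventually_le_length m
  exact ⟨k₀, fun σ hσ => ((h _).trans
    (pow_le_pow_of_le_one h0.le h1.le (hk _ hσ _ σ.word_mem))).trans hm.le⟩

/-! ### The attractor -/

lemma IsAttractor.wordMap_mem [TopologicalSpace X] {K : Set X} (hK : IsAttractor S K)
    (u : List (Fin N)) {x : X} (hx : x ∈ K) : wordMap S u x ∈ K := by
  induction u with
  | nil => exact hx
  | cons i u ih =>
    rw [hK.2.2]
    exact mem_iUnion.2 ⟨i, mem_image_of_mem _ ih⟩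

lemma IsAttractor.exists_word [TopologicalSpace X] {K : Set X} (hK : IsAttractor S K) (m : ℕ) :
    ∀ x ∈ K, ∃ u : List (Fin N), u.length = m ∧ x ∈ wordMap S u '' K := by
  induction m with
  | zero => exact fun x hx => ⟨[], rfl, x, hx, rfl⟩
  | succ m ih =>
    intro x hx
    rw [hK.2.2] at hx
    obtain ⟨i, y, hy, rfl⟩ := mem_iUnion.1 hx
    obtain ⟨u, hu, z, hz, rfl⟩ := ih y hy
    exact ⟨i :: u, by simp [hu], z, hz, rfl⟩

/-- The attractor is covered by the cells of each level. -/
lemma IsAttractor.exists_vertex [TopologicalSpace X] {K : Set X} (hK : IsAttractor S K)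
    (hℳ : IsNestedIndexSets ℳ) (k : ℕ) {x : X} (hx : x ∈ K) :
    ∃ σ : Vertex S ℳ, σ.level = k ∧ x ∈ σ.map '' K := by
  obtain ⟨lo, hi, -, -, -, -, -, -, hpre, -⟩ := hℳ.lengths
  -- Only words strictly longer than `hi k` are guaranteed an initial segment in `ℳ k`.
  obtain ⟨v, hv, z, hz, rfl⟩ := hK.exists_word (hi k + 1) x hx
  obtain ⟨u, hu, w, rfl⟩ := hpre k v (by omega)
  refine ⟨⟨k, wordMap S u, u, hu, rfl⟩, rfl, wordMap S w z, hK.wordMap_mem w hz, ?_⟩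
  rw [wordMap_append]
  rfl

/-! ### Invariants of neighbourhood types -/

lemma Vertex.image_subset_of_map_eq_comp {Ω : Set X} (hinv : ∀ i, S i '' Ω ⊆ Ω)
    {η σ : Vertex S ℳ} {w : List (Fin N)} (h : σ.map = η.map ∘ wordMap S w) :
    σ.map '' Ω ⊆ η.map '' Ω := by
  rw [h, image_comp]
  exact image_mono (wordMap_image_subset hinv w)

/-- Images of Ω shrink along edges, so overlapping vertices have overlapping ancestors. This is why
the neighbourhood of a child is visible from the neighbourhood of its parent. -/
lemma Vertex.mem_nbhd_of_map_eq_comp {Ω : Set X} (hinv : ∀ i, S i '' Ω ⊆ Ω)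
    {η ζ σ ξ : Vertex S ℳ} {v w : List (Fin N)} (hlev : ζ.level = η.level)
    (hσ : σ.map = η.map ∘ wordMap S w) (hξ : ξ.map = ζ.map ∘ wordMap S v)
    (h : (σ.map '' Ω ∩ ξ.map '' Ω).Nonempty) : ζ ∈ η.nbhd Ω :=
  ⟨hlev, h.mono (inter_subset_inter (image_subset_of_map_eq_comp hinv hσ)
    (image_subset_of_map_eq_comp hinv hξ))⟩

section Metric

variable [MetricSpace X] {Ω : Set X}

/-- The similitude τ for the parents also serves for the children: neighbours of σ descend from
neighbours of η, and τ transports both together with the words between them. The last clause pulls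
back edges competing for σ', which is what makes lexicographic minimality of a label invariant. -/
lemma Vertex.Equivalent.exists_isEdge (hΩ : Ω.Nonempty) (hinv : ∀ i, S i '' Ω ⊆ Ω)
    (hℳ : IsNestedIndexSets ℳ) {η η' σ : Vertex S ℳ} {w : List (Fin N)}
    (h : η.Equivalent Ω η') (he : IsEdge η w σ) :
    ∃ σ' : Vertex S ℳ, IsEdge η' w σ' ∧ σ.Equivalent Ω σ' ∧
      ∀ (ζ' : Vertex S ℳ) (w' : List (Fin N)), IsEdge ζ' w' σ' → ∃ ζ, IsEdge ζ w' σ := by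
  obtain ⟨τ, ⟨c, hc, hd⟩, hm, hs, hu⟩ := h
  have key : ∀ ζ ∈ η.nbhd Ω, ∃ ζ' ∈ η'.nbhd Ω, ζ'.map = τ ∘ ζ.map := by
    intro ζ hζ
    have : τ ∘ ζ.map ∈ {f | ∃ σ' ∈ η'.nbhd Ω, f = σ'.map} := by
      rw [hs]; exact ⟨ζ, hζ, rfl⟩
    obtain ⟨σ', h, e⟩ := this
    exact ⟨σ', h, e.symm⟩
  have key2 : ∀ ζ' ∈ η'.nbhd Ω, ∃ ζ ∈ η.nbhd Ω, ζ'.map = τ ∘ ζ.map := by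
    intro ζ' hζ'
    have : ζ'.map ∈ {f | ∃ σ ∈ η.nbhd Ω, f = τ ∘ σ.map} := by
      rw [← hs]; exact ⟨ζ', hζ', rfl⟩
    exact this
  have hinj : InjOn τ (η.dom Ω) := by
    intro x hx y hy hxy
    have h := hd x hx y hy
    rw [hxy, dist_self] at h
    exact dist_eq_zero.1 ((mul_eq_zero.1 h.symm).resolve_left hc.ne')
  have hη := η.mem_nbhd_self hΩ
  have hη' := η'.mem_nbhd_self hΩ
  have hmem : η'.map ∘ wordMap S w ∈ levelMaps S ℳ (η'.level + 1) := by
    refine (hu η hη η' hη' hm.symm 1 le_rfl w).1 ?_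
    rw [← he.2, ← he.1]
    exact σ.mem
  let σ' : Vertex S ℳ := ⟨η'.level + 1, η'.map ∘ wordMap S w, hmem⟩
  have hσ' : σ'.map = τ ∘ σ.map := by
    change η'.map ∘ wordMap S w = _
    rw [he.2, ← hm, Function.comp_assoc]
  have he' : IsEdge η' w σ' := ⟨rfl, rfl⟩
  have par : ∀ ξ ∈ σ.nbhd Ω, ∃ ζ ∈ η.nbhd Ω, ∃ v, ξ.map = ζ.map ∘ wordMap S v := by
    rintro ξ ⟨hl, hne⟩
    obtain ⟨ζ, v, hζ, hv⟩ := ξ.exists_map_eq_comp hℳ (k := η.level) (by rw [hl, he.1]; omega)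
    exact ⟨ζ, Vertex.mem_nbhd_of_map_eq_comp hinv hζ he.2 hv hne, v, hv⟩
  have par' : ∀ ξ ∈ σ'.nbhd Ω, ∃ ζ ∈ η'.nbhd Ω, ∃ v, ξ.map = ζ.map ∘ wordMap S v := by
    rintro ξ ⟨hl, hne⟩
    obtain ⟨ζ, v, hζ, hv⟩ :=
      ξ.exists_map_eq_comp hℳ (k := η'.level) (by rw [hl]; exact Nat.le_succ _)
    exact ⟨ζ, Vertex.mem_nbhd_of_map_eq_comp hinv hζ he'.2 hv hne, v, hv⟩
  have hdomσ : ∀ x, σ.map x ∈ η.dom Ω := by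
    intro x
    rw [he.2]
    exact Vertex.mem_dom hη _
  have hdom : σ.dom Ω ⊆ η.dom Ω := by
    intro x hx
    obtain ⟨ξ, hξ, y, rfl⟩ := mem_iUnion₂.1 hx
    obtain ⟨ζ, hζ, v, hv⟩ := par ξ hξ
    rw [hv]
    exact Vertex.mem_dom hζ _
  have fwd : ∀ ξ ∈ σ.nbhd Ω, ∃ ξ' ∈ σ'.nbhd Ω, ξ'.map = τ ∘ ξ.map := by
    intro ξ hξ
    obtain ⟨ζ, hζ, v, hv⟩ := par ξ hξ
    obtain ⟨ζ', hζ', e⟩ := key ζ hζ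
    have hmem : ζ'.map ∘ wordMap S v ∈ levelMaps S ℳ (η'.level + 1) := by
      refine (hu ζ hζ ζ' hζ' e 1 le_rfl v).1 ?_
      rw [← hv, ← he.1, ← hξ.1]
      exact ξ.mem
    refine ⟨⟨η'.level + 1, ζ'.map ∘ wordMap S v, hmem⟩, ⟨rfl, ?_⟩, ?_⟩
    · obtain ⟨z, ⟨a, ha, rfl⟩, b, hb, hab⟩ := hξ.2
      refine ⟨τ (σ.map a), ⟨a, ha, by rw [hσ']; rfl⟩, b, hb, ?_⟩
      change ζ'.map (wordMap S v b) = _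
      rw [e, ← hab, hv]
      rfl
    · change ζ'.map ∘ wordMap S v = _
      rw [e, hv, Function.comp_assoc]
  have bwd : ∀ ξ' ∈ σ'.nbhd Ω, ∃ ξ ∈ σ.nbhd Ω, ξ'.map = τ ∘ ξ.map := by
    intro ξ' hξ'
    obtain ⟨ζ', hζ', v, hv⟩ := par' ξ' hξ'
    obtain ⟨ζ, hζ, e⟩ := key2 ζ' hζ'
    have hmem : ζ.map ∘ wordMap S v ∈ levelMaps S ℳ (η.level + 1) := by
      refine (hu ζ hζ ζ' hζ' e 1 le_rfl v).2 ?_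
      have := ξ'.mem
      rwa [hv, hξ'.1] at this
    have hmap : ξ'.map = τ ∘ (ζ.map ∘ wordMap S v) := by rw [hv, e, Function.comp_assoc]
    refine ⟨⟨η.level + 1, ζ.map ∘ wordMap S v, hmem⟩, ⟨he.1.symm, ?_⟩, hmap⟩
    obtain ⟨z, ⟨a, ha, rfl⟩, b, hb, hab⟩ := hξ'.2
    refine ⟨σ.map a, ⟨a, ha, rfl⟩, b, hb, ?_⟩
    refine hinj (Vertex.mem_dom hζ _) (hdomσ a) ?_
    rw [hσ', hmap] at hab
    exact hab
  refine ⟨σ', he', ⟨τ, ⟨c, hc, fun x hx y hy => hd x (hdom hx) y (hdom hy)⟩, hσ'.symm, ?_, ?_⟩, ?_⟩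
  · ext f
    constructor
    · rintro ⟨ξ', h, rfl⟩
      exact bwd ξ' h
    · rintro ⟨ξ, h, rfl⟩
      obtain ⟨ξ', h', e⟩ := fwd ξ h
      exact ⟨ξ', h', e.symm⟩
  · intro ξ hξ ξ' hξ' e l hl u
    obtain ⟨ζ, hζ, v, hv⟩ := par ξ hξ
    obtain ⟨ζ', hζ', e'⟩ := key ζ hζ
    -- Being a vertex `l` levels below ξ via u means being one `1 + l` levels below its ancestor ζ
    -- via vu, where the hypothesis on the parents applies.
    have h1 : ξ.map ∘ wordMap S u = ζ.map ∘ wordMap S (v ++ u) := by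
      rw [wordMap_append, hv, Function.comp_assoc]
    have h2 : ξ'.map ∘ wordMap S u = ζ'.map ∘ wordMap S (v ++ u) := by
      rw [wordMap_append, e, hv, e']
      simp only [Function.comp_assoc]
    have h3 : σ.level + l = η.level + (1 + l) := by rw [he.1, add_assoc]
    have h4 : σ'.level + l = η'.level + (1 + l) := add_assoc _ _ _
    rw [h1, h2, h3, h4]
    exact hu ζ hζ ζ' hζ' e' (1 + l) (by omega) _
  · rintro ζ' w' ⟨hl, hw⟩
    have hlev : ζ'.level = η'.level := by
      have : η'.level + 1 = ζ'.level + 1 := hl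
      omega
    have hne : (σ'.map '' Ω ∩ σ'.map '' Ω).Nonempty := by
      rw [inter_self]; exact hΩ.image _
    -- Any other parent of σ' overlaps η' in the image of Ω under σ', hence it is a neighbour of η'
    -- and can be pulled back by τ.
    obtain ⟨ζ, hζ, e⟩ := key2 ζ' (Vertex.mem_nbhd_of_map_eq_comp hinv hlev he'.2 hw hne)
    refine ⟨ζ, by rw [he.1, hζ.1], funext fun x => ?_⟩
    refine hinj (hdomσ x) (Vertex.mem_dom hζ _) ?_
    have h1 := congrFun hσ' x
    rw [hw, e] at h1
    exact h1.symm

lemma Vertex.Equivalent.exists_isMinEdge (hΩ : Ω.Nonempty) (hinv : ∀ i, S i '' Ω ⊆ Ω)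
    (hℳ : IsNestedIndexSets ℳ) {η η' σ : Vertex S ℳ} {w : List (Fin N)}
    (h : η.Equivalent Ω η') (he : IsMinEdge η w σ) :
    ∃ σ' : Vertex S ℳ, IsMinEdge η' w σ' ∧ σ.Equivalent Ω σ' := by
  obtain ⟨σ', h1, h2, h3⟩ := h.exists_isEdge hΩ hinv hℳ he.1
  refine ⟨σ', ⟨h1, fun ζ' w' h' => ?_⟩, h2⟩
  obtain ⟨ζ, hζ⟩ := h3 ζ' w' h'
  exact he.2 ζ w' hζ

lemma Vertex.Equivalent.mem_reducedVertices (hΩ : Ω.Nonempty) (hinv : ∀ i, S i '' Ω ⊆ Ω)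
    (hℳ : IsNestedIndexSets ℳ) {η η' : Vertex S ℳ} (h : η.Equivalent Ω η')
    (hη : η ∈ reducedVertices S ℳ) : η' ∈ reducedVertices S ℳ := by
  obtain ⟨p, rfl, hp⟩ := hη
  have step : ∀ j (q : {q : Vertex S ℳ // (p j).Equivalent Ω q}),
      ∃ q' : {q : Vertex S ℳ // (p (j + 1)).Equivalent Ω q}, ∃ w, IsMinEdge q.1 w q'.1 := by
    rintro j ⟨q, hq⟩
    obtain ⟨w, hw⟩ := hp j
    obtain ⟨q', h1, h2⟩ := hq.exists_isMinEdge hΩ hinv hℳ hw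
    exact ⟨⟨q', h2⟩, w, h1⟩
  choose next hnext using step
  -- The infinite path is copied step by step; each copied vertex carries its equivalence with the
  -- original one.
  let Q : ∀ j, {q : Vertex S ℳ // (p j).Equivalent Ω q} := fun j =>
    Nat.rec (motive := fun j => {q : Vertex S ℳ // (p j).Equivalent Ω q}) ⟨η', h⟩ next j
  exact ⟨fun j => (Q j).1, rfl, fun j => hnext j (Q j)⟩

lemma Vertex.Equivalent.exists_isReducedEdge (hΩ : Ω.Nonempty) (hinv : ∀ i, S i '' Ω ⊆ Ω)
    (hℳ : IsNestedIndexSets ℳ) {η η' σ : Vertex S ℳ} {w : List (Fin N)}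
    (h : η.Equivalent Ω η') (he : IsReducedEdge η w σ) :
    ∃ σ' : Vertex S ℳ, IsReducedEdge η' w σ' ∧ σ.Equivalent Ω σ' := by
  obtain ⟨σ', h1, h2⟩ := h.exists_isMinEdge hΩ hinv hℳ he.1
  exact ⟨σ', ⟨h1, h.mem_reducedVertices hΩ hinv hℳ he.2.1,
    h2.mem_reducedVertices hΩ hinv hℳ he.2.2⟩, h2⟩

/-! ### Constants which are uniform over the finitely many types -/

/-- A bound found at one representative of each type is valid for the whole type, and the maximum
over the finitely many types serves everywhere. -/
lemma exists_uniform {hΩ : Ω.Nonempty} (hfin : Finite (NbhdType S ℳ Ω hΩ)) {α : Type*}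
    [LinearOrder α] [Nonempty α] {P : Vertex S ℳ → α → Prop}
    (hmono : ∀ η a b, a ≤ b → P η a → P η b)
    (hinv : ∀ η η' a, η.Equivalent Ω η' → P η a → P η' a) (hex : ∀ η, ∃ a, P η a) :
    ∃ a, ∀ η, P η a := by
  choose f hf using hex
  obtain ⟨a, ha⟩ := Finite.exists_le fun T : NbhdType S ℳ Ω hΩ => f T.out
  refine ⟨a, fun η => hinv (Quotient.out (nbhdType Ω hΩ η)) η a ?_ (hmono _ _ _ (ha _) (hf _))⟩
  exact Quotient.exact (Quotient.out_eq (nbhdType Ω hΩ η))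

lemma exists_forall_wordRatio_le [Nontrivial X] {hΩ : Ω.Nonempty}
    (hfin : Finite (NbhdType S ℳ Ω hΩ)) (hS : IsContractiveSimilitudes S ρ)
    (hℳ : IsNestedIndexSets ℳ) {ε : ℝ} (hε : 0 < ε) :
    ∃ D : ℕ, 1 ≤ D ∧ ∀ (η : Vertex S ℳ) (j : ℕ) (w : List (Fin N)), D ≤ j →
      η.map ∘ wordMap S w ∈ levelMaps S ℳ (η.level + j) → wordRatio ρ w ≤ ε := by
  have H : ∃ D : ℕ, ∀ η : Vertex S ℳ, ∀ (j : ℕ) (w : List (Fin N)), D ≤ j → 1 ≤ j →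
      η.map ∘ wordMap S w ∈ levelMaps S ℳ (η.level + j) → wordRatio ρ w ≤ ε := by
    refine exists_uniform (hΩ := hΩ) hfin (fun η a b hab h j w hj => h j w (hab.trans hj)) ?_ ?_
    · rintro η η' a ⟨τ, -, hm, -, hu⟩ h j w hj hj1 hw
      exact h j w hj hj1
        ((hu η (η.mem_nbhd_self hΩ) η' (η'.mem_nbhd_self hΩ) hm.symm j hj1 w).2 hw)
    · intro η
      obtain ⟨k₀, hk⟩ := Vertex.eventually_ratio_le (S := S) hS hℳ
        (mul_pos (η.ratio_pos hS) hε)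
      refine ⟨k₀, fun j w hj _ hw => ?_⟩
      have h1 := hk ⟨_, _, hw⟩ (by simp only; omega)
      rw [Vertex.ratio_of_map_eq_comp hS (η := η) (w := w) rfl] at h1
      exact le_of_mul_le_mul_left h1 (η.ratio_pos hS)
  obtain ⟨D, hD⟩ := H
  -- The definition of equivalence compares descendants only from one level below on, hence the
  -- shift that ensures `1 ≤ j`.
  exact ⟨D + 1, by omega, fun η j w hj => hD η j w (by omega) (by omega)⟩

lemma exists_le_wordRatio_of_edge [Nontrivial X] {hΩ : Ω.Nonempty}
    (hfin : Finite (NbhdType S ℳ Ω hΩ)) (hS : IsContractiveSimilitudes S ρ) :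
    ∃ c : ℝ, 0 < c ∧ c < 1 ∧ ∀ (η σ : Vertex S ℳ) (w : List (Fin N)),
      IsEdge η w σ → c ≤ wordRatio ρ w := by
  -- The form 1/(m + 2) weakens as m grows, as `exists_uniform` requires, and is always less than
  -- one.
  have H : ∃ m : ℕ, ∀ η : Vertex S ℳ, ∀ w : List (Fin N),
      η.map ∘ wordMap S w ∈ levelMaps S ℳ (η.level + 1) → ((m : ℝ) + 2)⁻¹ ≤ wordRatio ρ w := by
    refine exists_uniform (hΩ := hΩ) hfin ?_ ?_ ?_
    · intro η a b hab h w hw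
      refine le_trans ?_ (h w hw)
      have : (a : ℝ) ≤ b := by exact_mod_cast hab
      gcongr
    · rintro η η' a ⟨τ, -, hm, -, hu⟩ h w hw
      exact h w ((hu η (η.mem_nbhd_self hΩ) η' (η'.mem_nbhd_self hΩ) hm.symm 1 le_rfl w).2 hw)
    · intro η
      obtain ⟨b, hb⟩ := ((Vertex.finite_level S ℳ (η.level + 1)).image
        fun σ => (σ.ratio ρ)⁻¹ * η.ratio ρ).bddAbove
      obtain ⟨m, hm⟩ := exists_nat_ge b
      refine ⟨m, fun w hw => ?_⟩
      have h1 := hb (mem_image_of_mem _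
        (show (⟨_, _, hw⟩ : Vertex S ℳ) ∈ {σ : Vertex S ℳ | σ.level = η.level + 1} from rfl))
      have hη := η.ratio_pos hS
      have hw0 := wordRatio_pos hS w
      simp only [Vertex.ratio_of_map_eq_comp hS (η := η) (w := w) (σ := ⟨_, _, hw⟩) rfl] at h1
      rw [mul_inv, mul_comm, ← mul_assoc, mul_inv_cancel₀ hη.ne', one_mul] at h1
      rw [inv_le_comm₀ (by positivity) hw0]
      linarith
  obtain ⟨m, hm⟩ := H
  refine ⟨((m : ℝ) + 2)⁻¹, by positivity, inv_lt_one_of_one_lt₀ ?_, ?_⟩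
  · have : (0 : ℝ) ≤ m := m.cast_nonneg
    linarith
  · rintro η σ w ⟨h1, h2⟩
    refine hm η w ?_
    rw [← h1, ← h2]
    exact σ.mem

/-- An equivalence multiplies all ratios in a neighbourhood by the same constant, so quotients of
ratios within a neighbourhood are invariants of the type. -/
lemma exists_ratio_le_of_mem_nbhd [Nontrivial X] {hΩ : Ω.Nonempty}
    (hfin : Finite (NbhdType S ℳ Ω hΩ)) (hS : IsContractiveSimilitudes S ρ) :
    ∃ C : ℝ, 0 < C ∧ ∀ (η : Vertex S ℳ), ∀ ζ ∈ η.nbhd Ω, ζ.ratio ρ ≤ C * η.ratio ρ := by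
  have H : ∃ C : ℝ, ∀ η : Vertex S ℳ, ∀ ζ ∈ η.nbhd Ω, ζ.ratio ρ ≤ C * η.ratio ρ := by
    refine exists_uniform (hΩ := hΩ) hfin ?_ ?_ ?_
    · intro η a b hab h ζ hζ
      exact (h ζ hζ).trans (mul_le_mul_of_nonneg_right hab (η.ratio_pos hS).le)
    · rintro η η' a ⟨τ, ⟨c, hc, hd⟩, hm, hs, -⟩ h ζ' hζ'
      have : ζ'.map ∈ {f | ∃ σ ∈ η.nbhd Ω, f = τ ∘ σ.map} := by
        rw [← hs]; exact ⟨ζ', hζ', rfl⟩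
      obtain ⟨ζ, hζ, e⟩ := this
      have scale : ∀ ξ ∈ η.nbhd Ω, ∀ ξ' : Vertex S ℳ, ξ'.map = τ ∘ ξ.map →
          ξ'.ratio ρ = c * ξ.ratio ρ := by
        intro ξ hξ ξ' e
        refine ξ'.ratio_eq_of_dist hS fun x y => ?_
        rw [e, Function.comp, Function.comp, hd _ (Vertex.mem_dom hξ x) _ (Vertex.mem_dom hξ y),
          ξ.dist_map hS, mul_assoc]
      rw [scale ζ hζ ζ' e, scale η (η.mem_nbhd_self hΩ) η' hm.symm]
      calc c * ζ.ratio ρ ≤ c * (a * η.ratio ρ) := mul_le_mul_of_nonneg_left (h ζ hζ) hc.le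
        _ = a * (c * η.ratio ρ) := by ring
    · intro η
      obtain ⟨b, hb⟩ := ((η.nbhd_finite Ω).image fun σ => σ.ratio ρ / η.ratio ρ).bddAbove
      refine ⟨b, fun ζ hζ => ?_⟩
      exact (div_le_iff₀ (η.ratio_pos hS)).1 (hb (mem_image_of_mem _ hζ))
  obtain ⟨C, hC⟩ := H
  refine ⟨max C 1, by positivity, fun η ζ hζ => (hC η ζ hζ).trans ?_⟩
  exact mul_le_mul_of_nonneg_right (le_max_left _ _) (η.ratio_pos hS).le

lemma exists_ncard_nbhd_le {hΩ : Ω.Nonempty} (hfin : Finite (NbhdType S ℳ Ω hΩ)) :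
    ∃ Γ : ℕ, ∀ η : Vertex S ℳ, (η.nbhd Ω).ncard ≤ Γ := by
  refine exists_uniform (hΩ := hΩ) hfin (P := fun η (Γ : ℕ) => (η.nbhd Ω).ncard ≤ Γ)
    (fun η a b hab h => h.trans hab) ?_ fun η => ⟨_, le_rfl⟩
  rintro η η' a ⟨τ, -, -, hs, -⟩ h
  refine le_trans ?_ h
  have h1 : (η'.nbhd Ω).ncard = (Vertex.map '' η'.nbhd Ω).ncard := by
    refine (InjOn.ncard_image fun σ hσ ξ hξ e => ?_).symm
    exact Vertex.ext (hσ.1.trans hξ.1.symm) e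
  have h2 : Vertex.map '' η'.nbhd Ω = (fun σ => τ ∘ Vertex.map σ) '' η.nbhd Ω := by
    ext f
    have := Set.ext_iff.1 hs f
    simp only [mem_ofPred_eq] at this
    simp only [mem_image]
    constructor
    · rintro ⟨σ, hσ, rfl⟩
      obtain ⟨ξ, hξ, e⟩ := this.1 ⟨σ, hσ, rfl⟩
      exact ⟨ξ, hξ, e.symm⟩
    · rintro ⟨σ, hσ, rfl⟩
      obtain ⟨ξ, hξ, e⟩ := this.2 ⟨σ, hσ, rfl⟩
      exact ⟨ξ, hξ, e.symm⟩
  rw [h1, h2]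
  exact ncard_image_le (η.nbhd_finite Ω)

end Metric

/-! ### Trees of descendants -/

/-- Composition with `wordMap S w` on the right can be cancelled. -/
def IsRightCancellative (S : Fin N → X → X) : Prop :=
  ∀ u u' w : List (Fin N),
    wordMap S u ∘ wordMap S w = wordMap S u' ∘ wordMap S w → wordMap S u = wordMap S u'

/-- Both labels are smallest among all edges into σ, hence equal, and then they can be cancelled.
This turns the reduced graph into a forest. -/
lemma IsMinEdge.eq_of_isMinEdge (hcan : IsRightCancellative S) {η η' σ : Vertex S ℳ}
    {w w' : List (Fin N)} (h : IsMinEdge η w σ) (h' : IsMinEdge η' w' σ) : η = η' := by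
  have hw : w = w' := le_antisymm (h.2 _ _ h'.1) (h'.2 _ _ h.1)
  subst hw
  have hl : η.level = η'.level := by
    have := h.1.1.symm.trans h'.1.1
    omega
  refine Vertex.ext hl ?_
  rw [η.map_eq, η'.map_eq]
  refine hcan _ _ w ?_
  rw [← η.map_eq, ← η'.map_eq, ← h.1.2, h'.1.2]

/-- The offspring of a vertex in the reduced graph. -/
noncomputable def Vertex.children (η : Vertex S ℳ) : Finset (Vertex S ℳ) :=
  Set.Finite.toFinset (s := {σ | ∃ w, IsReducedEdge η w σ})
    ((Vertex.finite_level S ℳ (η.level + 1)).subset fun _ ⟨_, h⟩ => h.1.1.1)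

lemma Vertex.mem_children {η σ : Vertex S ℳ} :
    σ ∈ η.children ↔ ∃ w, IsReducedEdge η w σ := by
  simp [children]

open Classical in
/-- The descendants of a vertex in the reduced graph after `k` steps. -/
noncomputable def Vertex.descendants : ℕ → Vertex S ℳ → Finset (Vertex S ℳ)
  | 0, η => {η}
  | k + 1, η => η.children.biUnion (Vertex.descendants k)

lemma Vertex.mem_descendants_zero {η σ : Vertex S ℳ} : σ ∈ descendants 0 η ↔ σ = η := by
  simp [descendants]

lemma Vertex.mem_descendants_succ {k : ℕ} {η σ : Vertex S ℳ} :
    σ ∈ descendants (k + 1) η ↔ ∃ ζ ∈ η.children, σ ∈ descendants k ζ := by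
  simp [descendants]

lemma Vertex.level_of_mem_children {η σ : Vertex S ℳ} (h : σ ∈ η.children) :
    σ.level = η.level + 1 := by
  obtain ⟨w, hw⟩ := mem_children.1 h
  exact hw.1.1.1

lemma Vertex.level_of_mem_descendants {k : ℕ} {η σ : Vertex S ℳ} (h : σ ∈ descendants k η) :
    σ.level = η.level + k := by
  induction k generalizing η with
  | zero => rw [mem_descendants_zero.1 h]; rfl
  | succ k ih =>
    obtain ⟨ζ, hζ, h⟩ := mem_descendants_succ.1 h
    rw [ih h, level_of_mem_children hζ]
    omega

lemma Vertex.eq_of_mem_children (hcan : IsRightCancellative S) {η η' σ : Vertex S ℳ}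
    (h : σ ∈ η.children) (h' : σ ∈ η'.children) : η = η' := by
  obtain ⟨w, hw⟩ := mem_children.1 h
  obtain ⟨w', hw'⟩ := mem_children.1 h'
  exact hw.1.eq_of_isMinEdge hcan hw'.1

lemma Vertex.eq_of_mem_descendants (hcan : IsRightCancellative S) {k : ℕ} {η η' σ : Vertex S ℳ}
    (h : σ ∈ descendants k η) (h' : σ ∈ descendants k η') : η = η' := by
  induction k generalizing η η' with
  | zero => rw [← mem_descendants_zero.1 h, ← mem_descendants_zero.1 h']
  | succ k ih =>
    obtain ⟨ζ, hζ, h⟩ := mem_descendants_succ.1 h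
    obtain ⟨ζ', hζ', h'⟩ := mem_descendants_succ.1 h'
    have := ih h h'
    subst this
    exact eq_of_mem_children hcan hζ hζ'

lemma Vertex.children_nonempty {η : Vertex S ℳ} (hη : η ∈ reducedVertices S ℳ) :
    η.children.Nonempty := by
  obtain ⟨p, rfl, hp⟩ := hη
  obtain ⟨w, hw⟩ := hp 0
  exact ⟨p 1, mem_children.2 ⟨w, hw, ⟨p, rfl, hp⟩, fun j => p (j + 1), rfl, fun j => hp (j + 1)⟩⟩

lemma Vertex.descendants_nonempty {η : Vertex S ℳ} (hη : η ∈ reducedVertices S ℳ) (k : ℕ) :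
    (descendants k η).Nonempty := by
  induction k generalizing η with
  | zero => exact ⟨η, mem_descendants_zero.2 rfl⟩
  | succ k ih =>
    obtain ⟨ζ, hζ⟩ := children_nonempty hη
    obtain ⟨w, hw⟩ := mem_children.1 hζ
    obtain ⟨σ, hσ⟩ := ih hw.2.2
    exact ⟨σ, mem_descendants_succ.2 ⟨ζ, hζ, hσ⟩⟩

lemma Vertex.exists_map_eq_of_mem_descendants {k : ℕ} {η σ : Vertex S ℳ}
    (h : σ ∈ descendants k η) : ∃ w, σ.map = η.map ∘ wordMap S w := by
  induction k generalizing η with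
  | zero => exact ⟨[], by rw [mem_descendants_zero.1 h]; rfl⟩
  | succ k ih =>
    obtain ⟨ζ, hζ, h⟩ := mem_descendants_succ.1 h
    obtain ⟨w, hw⟩ := ih h
    obtain ⟨v, hv⟩ := mem_children.1 hζ
    exact ⟨v ++ w, by rw [hw, hv.1.1.2, wordMap_append, Function.comp_assoc]⟩

section Metric

variable [MetricSpace X] {Ω : Set X} {hΩ : Ω.Nonempty}

/-- The labels of the edges of the reduced graph from `η` to vertices of a given type depend only
on the type of `η`. -/
lemma setOf_isReducedEdge_congr (hinv : ∀ i, S i '' Ω ⊆ Ω)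
    (hℳ : IsNestedIndexSets ℳ) {η η' : Vertex S ℳ} (h : η.Equivalent Ω η')
    (T : NbhdType S ℳ Ω hΩ) :
    {w | ∃ σ, IsReducedEdge η w σ ∧ nbhdType Ω hΩ σ = T} =
      {w | ∃ σ, IsReducedEdge η' w σ ∧ nbhdType Ω hΩ σ = T} := by
  have aux : ∀ {η η' : Vertex S ℳ}, η.Equivalent Ω η' →
      {w | ∃ σ, IsReducedEdge η w σ ∧ nbhdType Ω hΩ σ = T} ⊆
      {w | ∃ σ, IsReducedEdge η' w σ ∧ nbhdType Ω hΩ σ = T} := by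
    rintro η η' h w ⟨σ, hσ, rfl⟩
    obtain ⟨σ', h1, h2⟩ := h.exists_isReducedEdge hΩ hinv hℳ hσ
    exact ⟨σ', h1, Quotient.sound (h2.symm hΩ)⟩
  exact (aux h).antisymm (aux (h.symm hΩ))

lemma weightedIncidenceMatrix_nonneg (hS : IsContractiveSimilitudes S ρ)
    (rep : NbhdType S ℳ Ω hΩ → Vertex S ℳ) (α : ℝ) (T T' : NbhdType S ℳ Ω hΩ) :
    0 ≤ weightedIncidenceMatrix ρ Ω hΩ rep α T T' :=
  finsum_nonneg fun w => finsum_nonneg fun _ => Real.rpow_nonneg (wordRatio_pos hS w).le _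

variable [Nontrivial X]

open Classical in
-- This is the one-step meaning of the matrix. Row entries are indexed by labels and the sum by
-- target vertices, so the two indexings have to be matched.
lemma sum_children [Fintype (NbhdType S ℳ Ω hΩ)] (hS : IsContractiveSimilitudes S ρ)
    (hinv : ∀ i, S i '' Ω ⊆ Ω) (hℳ : IsNestedIndexSets ℳ)
    {rep : NbhdType S ℳ Ω hΩ → Vertex S ℳ} (hrep : IsRepresentatives rep) (α : ℝ)
    (x : NbhdType S ℳ Ω hΩ → ℝ) (η : Vertex S ℳ) :
    ∑ σ ∈ η.children, σ.ratio ρ ^ α * x (nbhdType Ω hΩ σ) =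
      η.ratio ρ ^ α * (weightedIncidenceMatrix ρ Ω hΩ rep α).mulVec x (nbhdType Ω hΩ η) := by
  set A := weightedIncidenceMatrix ρ Ω hΩ rep α with hA
  have hrow : ∀ T, A (nbhdType Ω hΩ η) T =
      ∑ᶠ w ∈ {w | ∃ σ, IsReducedEdge η w σ ∧ nbhdType Ω hΩ σ = T}, wordRatio ρ w ^ α := by
    intro T
    have he : (rep (nbhdType Ω hΩ η)).Equivalent Ω η :=
      Quotient.exact (hrep (nbhdType Ω hΩ η)).1
    rw [hA, weightedIncidenceMatrix, Matrix.of_apply, setOf_isReducedEdge_congr hinv hℳ he]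
  have hex : ∀ σ : Vertex S ℳ, ∃ w, σ ∈ η.children → IsReducedEdge η w σ := by
    intro σ
    by_cases h : σ ∈ η.children
    · obtain ⟨w, hw⟩ := Vertex.mem_children.1 h
      exact ⟨w, fun _ => hw⟩
    · exact ⟨[], fun h' => absurd h' h⟩
  choose lab hlab using hex
  have hfib : ∀ T, ∑ σ ∈ η.children with nbhdType Ω hΩ σ = T, σ.ratio ρ ^ α =
      η.ratio ρ ^ α * A (nbhdType Ω hΩ η) T := by
    intro T
    -- A label determines its target through the composed map, and a target determines its label
    -- because only the smallest one is kept.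
    have hbij : BijOn lab (↑({σ ∈ η.children | nbhdType Ω hΩ σ = T}) : Set (Vertex S ℳ))
        {w | ∃ σ, IsReducedEdge η w σ ∧ nbhdType Ω hΩ σ = T} := by
      refine ⟨?_, ?_, ?_⟩
      · intro σ hσ
        have hσ := Finset.mem_filter.1 hσ
        exact ⟨σ, hlab σ hσ.1, hσ.2⟩
      · intro σ hσ σ' hσ' e
        have h1 := hlab σ (Finset.mem_filter.1 hσ).1
        have h2 := hlab σ' (Finset.mem_filter.1 hσ').1
        refine Vertex.ext (h1.1.1.1.trans h2.1.1.1.symm) ?_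
        rw [h1.1.1.2, h2.1.1.2, e]
      · rintro w ⟨σ, hσ, hT⟩
        have hmem : σ ∈ η.children := Vertex.mem_children.2 ⟨w, hσ⟩
        exact ⟨σ, Finset.mem_filter.2 ⟨hmem, hT⟩,
          le_antisymm ((hlab σ hmem).1.2 _ _ hσ.1.1) (hσ.1.2 _ _ (hlab σ hmem).1.1)⟩
    rw [hrow, ← finsum_mem_eq_of_bijOn (f := fun σ => wordRatio ρ (lab σ) ^ α) lab hbij
      (fun _ _ => rfl), finsum_mem_coe_finset, Finset.mul_sum]
    refine Finset.sum_congr rfl fun σ hσ => ?_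
    rw [Vertex.ratio_of_map_eq_comp hS (hlab σ (Finset.mem_filter.1 hσ).1).1.1.2,
      Real.mul_rpow (η.ratio_pos hS).le (wordRatio_pos hS _).le]
  rw [← Finset.sum_fiberwise η.children (nbhdType Ω hΩ), Matrix.mulVec, dotProduct,
    Finset.mul_sum]
  refine Finset.sum_congr rfl fun T _ => ?_
  rw [← mul_assoc, ← hfib T, Finset.sum_mul]
  refine Finset.sum_congr rfl fun σ hσ => ?_
  rw [(Finset.mem_filter.1 hσ).2]

/-- The one-step identity is iterated; since parents are unique, different children have disjoint
sets of descendants. -/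
lemma sum_descendants [Fintype (NbhdType S ℳ Ω hΩ)] [DecidableEq (NbhdType S ℳ Ω hΩ)]
    (hcan : IsRightCancellative S) (hS : IsContractiveSimilitudes S ρ)
    (hinv : ∀ i, S i '' Ω ⊆ Ω) (hℳ : IsNestedIndexSets ℳ)
    {rep : NbhdType S ℳ Ω hΩ → Vertex S ℳ} (hrep : IsRepresentatives rep) (α : ℝ)
    (x : NbhdType S ℳ Ω hΩ → ℝ) (k : ℕ) (η : Vertex S ℳ) :
    ∑ σ ∈ Vertex.descendants k η, σ.ratio ρ ^ α * x (nbhdType Ω hΩ σ) =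
      η.ratio ρ ^ α *
        ((weightedIncidenceMatrix ρ Ω hΩ rep α) ^ k).mulVec x (nbhdType Ω hΩ η) := by
  classical
  induction k generalizing η with
  | zero => simp [Vertex.descendants]
  | succ k ih =>
    rw [Vertex.descendants, Finset.sum_biUnion]
    · rw [Finset.sum_congr rfl fun ζ _ => ih ζ, sum_children hS hinv hℳ hrep, pow_succ',
        Matrix.mulVec_mulVec]
    · intro ζ _ ζ' _ hne
      rw [Function.onFun, Finset.disjoint_left]
      exact fun σ h h' => hne (Vertex.eq_of_mem_descendants hcan h h')

lemma weightedIncidenceMatrix_pow_apply [Fintype (NbhdType S ℳ Ω hΩ)]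
    [DecidableEq (NbhdType S ℳ Ω hΩ)]
    (hcan : IsRightCancellative S) (hS : IsContractiveSimilitudes S ρ)
    (hinv : ∀ i, S i '' Ω ⊆ Ω) (hℳ : IsNestedIndexSets ℳ)
    {rep : NbhdType S ℳ Ω hΩ → Vertex S ℳ} (hrep : IsRepresentatives rep) (α : ℝ)
    (k : ℕ) (T T' : NbhdType S ℳ Ω hΩ) :
    ((weightedIncidenceMatrix ρ Ω hΩ rep α) ^ k) T T' =
      ∑ σ ∈ Vertex.descendants k (rep T) with nbhdType Ω hΩ σ = T',
        (σ.ratio ρ / (rep T).ratio ρ) ^ α := by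
  have h := sum_descendants hcan hS hinv hℳ hrep α (Pi.single T' 1) k (rep T)
  rw [(hrep T).1, Matrix.mulVec_single_one] at h
  have h0 := (rep T).ratio_pos hS
  have h1 : (0 : ℝ) < (rep T).ratio ρ ^ α := Real.rpow_pos_of_pos h0 _
  have h2 : ((weightedIncidenceMatrix ρ Ω hΩ rep α) ^ k) T T' = ((rep T).ratio ρ ^ α)⁻¹ *
      ∑ σ ∈ Vertex.descendants k (rep T),
        σ.ratio ρ ^ α * (Pi.single T' (1 : ℝ) : NbhdType S ℳ Ω hΩ → ℝ) (nbhdType Ω hΩ σ) := by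
    rw [h, inv_mul_cancel_left₀ h1.ne']; rfl
  rw [h2, Finset.mul_sum, Finset.sum_filter]
  refine Finset.sum_congr rfl fun σ _ => ?_
  rw [Pi.single_apply]
  split_ifs with h
  · rw [mul_one, Real.div_rpow (σ.ratio_pos hS).le h0.le, div_eq_inv_mul]
  · simp

/-- The comparison of the matrices for different exponents. -/
lemma exists_weightedIncidenceMatrix_pow_le [Fintype (NbhdType S ℳ Ω hΩ)]
    [DecidableEq (NbhdType S ℳ Ω hΩ)]
    (hcan : IsRightCancellative S) (hS : IsContractiveSimilitudes S ρ)
    (hinv : ∀ i, S i '' Ω ⊆ Ω) (hℳ : IsNestedIndexSets ℳ)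
    {rep : NbhdType S ℳ Ω hΩ → Vertex S ℳ} (hrep : IsRepresentatives rep) :
    ∃ (k : ℕ) (c : ℝ), 1 ≤ k ∧ 0 < c ∧ c < 1 ∧ ∀ α β : ℝ, α ≤ β → ∀ T T',
      c ^ (β - α) * ((weightedIncidenceMatrix ρ Ω hΩ rep α) ^ k) T T' ≤
          ((weightedIncidenceMatrix ρ Ω hΩ rep β) ^ k) T T' ∧
        ((weightedIncidenceMatrix ρ Ω hΩ rep β) ^ k) T T' ≤
          (1 / 2 : ℝ) ^ (β - α) * ((weightedIncidenceMatrix ρ Ω hΩ rep α) ^ k) T T' := by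
  -- A single edge may have the empty label and not contract at all, so the comparison is made for a
  -- power of the matrix.
  obtain ⟨k, hk1, hk⟩ := exists_forall_wordRatio_le (S := S) (ℳ := ℳ) (hΩ := hΩ) inferInstance hS hℳ
    (show (0 : ℝ) < 1 / 2 by norm_num)
  obtain ⟨c, hc0, hc1, hc⟩ := exists_le_wordRatio_of_edge (S := S) (ℳ := ℳ) (hΩ := hΩ)
    inferInstance hS
  have low : ∀ (j : ℕ) (η σ : Vertex S ℳ), σ ∈ Vertex.descendants j η →
      c ^ j * η.ratio ρ ≤ σ.ratio ρ := by
    intro j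
    induction j with
    | zero => intro η σ h; rw [Vertex.mem_descendants_zero.1 h]; simp
    | succ j ih =>
      intro η σ h
      obtain ⟨ζ, hζ, h⟩ := Vertex.mem_descendants_succ.1 h
      obtain ⟨w, hw⟩ := Vertex.mem_children.1 hζ
      refine le_trans ?_ (ih ζ σ h)
      rw [Vertex.ratio_of_map_eq_comp hS hw.1.1.2, pow_succ, mul_assoc]
      refine mul_le_mul_of_nonneg_left ?_ (pow_nonneg hc0.le _)
      rw [mul_comm]
      exact mul_le_mul_of_nonneg_left (hc _ _ _ hw.1.1) (η.ratio_pos hS).le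
  refine ⟨k, c ^ k, hk1, pow_pos hc0 _, pow_lt_one₀ hc0.le hc1 (by omega), fun α β hαβ T T' => ?_⟩
  have e := fun γ => weightedIncidenceMatrix_pow_apply hcan hS hinv hℳ hrep γ k T T'
  have h0 := (rep T).ratio_pos hS
  rw [e α, e β, Finset.mul_sum, Finset.mul_sum]
  have split : ∀ σ : Vertex S ℳ, (σ.ratio ρ / (rep T).ratio ρ) ^ β =
      (σ.ratio ρ / (rep T).ratio ρ) ^ (β - α) * (σ.ratio ρ / (rep T).ratio ρ) ^ α := by
    intro σ
    rw [← Real.rpow_add (div_pos (σ.ratio_pos hS) h0), sub_add_cancel]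
  constructor
  · refine Finset.sum_le_sum fun σ hσ => ?_
    have hσ := (Finset.mem_filter.1 hσ).1
    have hpos := div_pos (σ.ratio_pos hS) h0
    rw [split]
    refine mul_le_mul_of_nonneg_right ?_ (Real.rpow_nonneg hpos.le _)
    exact Real.rpow_le_rpow (pow_nonneg hc0.le _) ((le_div_iff₀ h0).2 (low k _ _ hσ))
      (sub_nonneg.2 hαβ)
  · refine Finset.sum_le_sum fun σ hσ => ?_
    have hσ := (Finset.mem_filter.1 hσ).1
    have hpos := div_pos (σ.ratio_pos hS) h0
    rw [split]
    refine mul_le_mul_of_nonneg_right ?_ (Real.rpow_nonneg hpos.le _)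
    refine Real.rpow_le_rpow hpos.le ?_ (sub_nonneg.2 hαβ)
    obtain ⟨w, hw⟩ := Vertex.exists_map_eq_of_mem_descendants hσ
    rw [Vertex.ratio_of_map_eq_comp hS hw, mul_div_cancel_left₀ _ h0.ne']
    refine hk (rep T) k w le_rfl ?_
    rw [← hw, ← Vertex.level_of_mem_descendants hσ]
    exact σ.mem

end Metric

end FiniteTypeIFS

namespace FiniteTypeIFS

/-! ### Spectral radii of nonnegative matrices -/

section SpectralRadius

open Filter Topology
open scoped NNReal

variable {ι : Type*} [Fintype ι] [DecidableEq ι]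

attribute [local instance] Matrix.linftyOpNormedRing Matrix.linftyOpNormedAlgebra

/-- Gelfand's formula for the complexified matrix; the row-sum norm does not change under
complexification. -/
lemma tendsto_nnnorm_pow_spectralRadius (A : Matrix ι ι ℝ) :
    Tendsto (fun m : ℕ => (‖A ^ m‖₊ : ℝ≥0∞) ^ (1 / m : ℝ)) atTop
      (𝓝 (spectralRadius ℂ (A.map Complex.ofReal))) := by
  have h := spectrum.pow_nnnorm_pow_one_div_tendsto_nhds_spectralRadius (A.map Complex.ofReal)
  refine h.congr fun m => ?_
  have h1 : (A.map Complex.ofReal) ^ m = (A ^ m).map Complex.ofReal :=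
    (map_pow (Complex.ofRealHom.mapMatrix) A m).symm
  have h2 : ‖(A ^ m).map Complex.ofReal‖₊ = ‖A ^ m‖₊ := by
    simp [Matrix.linfty_opNNNorm_def]
  rw [h1, h2]

lemma spectralRadius_map_ofReal_ne_top (A : Matrix ι ι ℝ) :
    spectralRadius ℂ (A.map Complex.ofReal) ≠ ⊤ := by
  rcases isEmpty_or_nonempty ι with h | h
  · rw [spectralRadius, spectrum.of_subsingleton]
    simp
  · exact (spectrum.spectralRadius_le_nnnorm (𝕜 := ℂ) (A.map Complex.ofReal)).trans_lt
      ENNReal.coe_lt_top |>.ne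

lemma nnnorm_le_of_entrywise_le {A B : Matrix ι ι ℝ} (hA : ∀ i j, 0 ≤ A i j)
    (h : ∀ i j, A i j ≤ B i j) : ‖A‖₊ ≤ ‖B‖₊ := by
  rw [Matrix.linfty_opNNNorm_def, Matrix.linfty_opNNNorm_def]
  refine Finset.sup_mono_fun fun i _ => Finset.sum_le_sum fun j _ => ?_
  rw [← NNReal.coe_le_coe, coe_nnnorm, coe_nnnorm, Real.norm_of_nonneg (hA i j),
    Real.norm_of_nonneg ((hA i j).trans (h i j))]
  exact h i j

lemma mul_entrywise_nonneg {ι : Type*} [Fintype ι] {A B : Matrix ι ι ℝ} (hA : ∀ i j, 0 ≤ A i j)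
    (hB : ∀ i j, 0 ≤ B i j) (i j : ι) : 0 ≤ (A * B) i j :=
  Finset.sum_nonneg fun l _ => mul_nonneg (hA i l) (hB l j)

lemma pow_entrywise_nonneg {A : Matrix ι ι ℝ} (hA : ∀ i j, 0 ≤ A i j) (m : ℕ) (i j : ι) :
    0 ≤ (A ^ m) i j := by
  induction m generalizing i j with
  | zero => rw [pow_zero, Matrix.one_apply]; split_ifs <;> norm_num
  | succ m ih => rw [pow_succ]; exact mul_entrywise_nonneg (fun i j => ih i j) hA i j

lemma pow_entrywise_le {A B : Matrix ι ι ℝ} {t : ℝ} (hA : ∀ i j, 0 ≤ A i j)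
    (hB : ∀ i j, 0 ≤ B i j) (ht : 0 ≤ t)
    (h : ∀ i j, A i j ≤ t * B i j) (m : ℕ) (i j : ι) : (A ^ m) i j ≤ t ^ m * (B ^ m) i j := by
  induction m generalizing i j with
  | zero => simp
  | succ m ih =>
    rw [pow_succ, pow_succ, pow_succ, Matrix.mul_apply, Matrix.mul_apply, Finset.mul_sum]
    refine Finset.sum_le_sum fun l _ => ?_
    calc (A ^ m) i l * A l j ≤ (t ^ m * (B ^ m) i l) * (t * B l j) :=
          mul_le_mul (ih i l) (h l j) (hA l j)
            (mul_nonneg (pow_nonneg ht m) (pow_entrywise_nonneg hB m i l))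
      _ = t ^ m * t * ((B ^ m) i l * B l j) := by ring

/-- The entrywise bound iterates to `A ^ (k * m)` against `t ^ m` times `B ^ (k * m)`. Gelfand's
formula along the multiples of k turns the factor into a k-th root. -/
lemma spectralRadius_le_of_pow_le {A B : Matrix ι ι ℝ} {t : ℝ≥0} {k : ℕ} (hk : 1 ≤ k)
    (hA : ∀ i j, 0 ≤ A i j) (hB : ∀ i j, 0 ≤ B i j)
    (h : ∀ i j, (A ^ k) i j ≤ t * (B ^ k) i j) :
    spectralRadius ℂ (A.map Complex.ofReal) ≤
      (t : ℝ≥0∞) ^ (1 / k : ℝ) * spectralRadius ℂ (B.map Complex.ofReal) := by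
  have hsub : Tendsto (fun m : ℕ => k * m) atTop atTop :=
    tendsto_id.const_mul_atTop' (by omega)
  have h1 := (tendsto_nnnorm_pow_spectralRadius A).comp hsub
  have h2 := ENNReal.Tendsto.const_mul (a := (t : ℝ≥0∞) ^ (1 / k : ℝ))
    ((tendsto_nnnorm_pow_spectralRadius B).comp hsub)
    (Or.inr (ENNReal.rpow_ne_top_of_nonneg (by positivity) ENNReal.coe_ne_top))
  refine le_of_tendsto_of_tendsto h1 h2 ?_
  filter_upwards [eventually_ge_atTop 1] with m hm
  have hkm : (0 : ℝ) ≤ 1 / ((k * m : ℕ) : ℝ) := by positivity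
  have hn : ‖A ^ (k * m)‖₊ ≤ t ^ m * ‖B ^ (k * m)‖₊ := by
    have hs : ‖(t ^ m : ℝ) • B ^ (k * m)‖₊ = t ^ m * ‖B ^ (k * m)‖₊ := by
      rw [nnnorm_smul]
      congr 1
      rw [nnnorm_pow]
      congr 1
      ext
      simp
    rw [← hs]
    refine nnnorm_le_of_entrywise_le (pow_entrywise_nonneg hA _) fun i j => ?_
    rw [Matrix.smul_apply, smul_eq_mul, pow_mul, pow_mul]
    exact pow_entrywise_le (pow_entrywise_nonneg hA k) (pow_entrywise_nonneg hB k) t.2 h m i j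
  have hexp : ((t : ℝ≥0∞) ^ m) ^ (1 / ((k * m : ℕ) : ℝ)) = (t : ℝ≥0∞) ^ (1 / k : ℝ) := by
    rw [← ENNReal.rpow_natCast, ← ENNReal.rpow_mul]
    congr 1
    have : (m : ℝ) ≠ 0 := by positivity
    have : (k : ℝ) ≠ 0 := by positivity
    push_cast
    field_simp
  calc (‖A ^ (k * m)‖₊ : ℝ≥0∞) ^ (1 / ((k * m : ℕ) : ℝ))
      ≤ ((t : ℝ≥0∞) ^ m * ‖B ^ (k * m)‖₊) ^ (1 / ((k * m : ℕ) : ℝ)) := by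
        refine ENNReal.rpow_le_rpow ?_ hkm
        exact_mod_cast hn
    _ = (t : ℝ≥0∞) ^ (1 / k : ℝ) * (‖B ^ (k * m)‖₊ : ℝ≥0∞) ^ (1 / ((k * m : ℕ) : ℝ)) := by
        rw [ENNReal.mul_rpow_of_nonneg _ _ hkm, hexp]

lemma one_le_spectralRadius_of_one_le {A : Matrix ι ι ℝ} (i : ι)
    (h : ∀ m, 1 ≤ (A ^ m).mulVec (fun _ => 1) i) :
    1 ≤ spectralRadius ℂ (A.map Complex.ofReal) := by
  refine ge_of_tendsto' (tendsto_nnnorm_pow_spectralRadius A) fun m => ?_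
  have h1 : 1 ≤ ‖A ^ m‖₊ := by
    rw [Matrix.linfty_opNNNorm_def]
    refine le_trans ?_ (Finset.le_sup (Finset.mem_univ i))
    rw [← NNReal.coe_le_coe, NNReal.coe_one, NNReal.coe_sum]
    refine (h m).trans (Finset.sum_le_sum fun j _ => ?_)
    rw [mul_one, coe_nnnorm]
    exact le_abs_self _
  rw [← ENNReal.one_rpow (1 / m : ℝ)]
  exact ENNReal.rpow_le_rpow (by exact_mod_cast h1) (by positivity)

lemma tendsto_pow_mulVec_of_spectralRadius_lt_one {A : Matrix ι ι ℝ}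
    (h : spectralRadius ℂ (A.map Complex.ofReal) < 1) (i : ι) :
    Tendsto (fun m => (A ^ m).mulVec (fun _ => 1) i) atTop (𝓝 0) := by
  obtain ⟨s, hs, hs1⟩ := exists_between h
  have hs_top : s ≠ ⊤ := (hs1.trans ENNReal.one_lt_top).ne
  have hev := (tendsto_nnnorm_pow_spectralRadius A).eventually_lt_const hs
  refine squeeze_zero_norm' (a := fun m => s.toReal ^ m) ?_
    (tendsto_pow_atTop_nhds_zero_of_lt_one ENNReal.toReal_nonneg
      (by simpa using (ENNReal.toReal_lt_toReal hs_top ENNReal.one_ne_top).2 hs1))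
  filter_upwards [hev, eventually_ge_atTop 1] with m hm hm1
  have hm0 : (m : ℝ) ≠ 0 := by positivity
  have h1 : (‖A ^ m‖₊ : ℝ≥0∞) ≤ s ^ m := by
    have := ENNReal.rpow_le_rpow hm.le (z := (m : ℝ)) (by positivity)
    rwa [← ENNReal.rpow_mul, one_div_mul_cancel hm0, ENNReal.rpow_one,
      ENNReal.rpow_natCast] at this
  have h2 : ‖A ^ m‖ ≤ s.toReal ^ m := by
    have := ENNReal.toReal_mono (ENNReal.pow_ne_top hs_top) h1
    simpa using this
  refine le_trans ?_ h2
  have h3 : ∑ j, ‖(A ^ m) i j‖₊ ≤ ‖A ^ m‖₊ := by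
    rw [Matrix.linfty_opNNNorm_def]
    exact Finset.le_sup (f := fun i => ∑ j, ‖(A ^ m) i j‖₊) (Finset.mem_univ i)
  have h4 : ∑ j, ‖(A ^ m) i j‖ ≤ ‖A ^ m‖ := by
    simpa [NNReal.coe_sum] using NNReal.coe_le_coe.2 h3
  refine le_trans ?_ h4
  refine (norm_sum_le _ _).trans (Finset.sum_le_sum fun j _ => ?_)
  rw [mul_one]

/-- A nonnegative matrix with spectral radius one has a nonnegative subinvariant vector. -/
lemma exists_le_mulVec_of_spectralRadius_eq_one {A : Matrix ι ι ℝ} (hA : ∀ i j, 0 ≤ A i j)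
    (h : spectralRadius ℂ (A.map Complex.ofReal) = 1) :
    ∃ w : ι → ℝ, (∀ i, 0 ≤ w i) ∧ w ≠ 0 ∧ ∀ i, w i ≤ A.mulVec w i := by
  have hne : Nonempty ι := by
    by_contra hne
    rw [not_nonempty_iff] at hne
    rw [spectralRadius, spectrum.of_subsingleton] at h
    simp at h
  -- The vector consists of the moduli of an eigenvector for an eigenvalue of modulus one. The
  -- triangle inequality gives subinvariance, so Perron–Frobenius theory is not needed.
  obtain ⟨z, hz, hz1⟩ := spectrum.exists_nnnorm_eq_spectralRadius (A.map Complex.ofReal)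
  rw [h, ENNReal.coe_eq_one] at hz1
  rw [← Matrix.spectrum_toLin', ← Module.End.hasEigenvalue_iff_mem_spectrum] at hz
  obtain ⟨v, hv⟩ := hz.exists_hasEigenvector
  have hv1 : (A.map Complex.ofReal).mulVec v = z • v := by
    rw [← Matrix.toLin'_apply]; exact hv.apply_eq_smul
  refine ⟨fun i => ‖v i‖, fun i => norm_nonneg _, fun h0 => hv.2 ?_, fun i => ?_⟩
  · funext i
    exact norm_eq_zero.1 (congrFun h0 i)
  · have hz1' : ‖z‖ = 1 := by
      rw [← coe_nnnorm, hz1]; rfl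
    have h1 := congrFun hv1 i
    have h2 : ‖v i‖ = ‖(A.map Complex.ofReal).mulVec v i‖ := by
      rw [h1, Pi.smul_apply, norm_smul, hz1', one_mul]
    refine h2.trans_le ?_
    refine (norm_sum_le _ _).trans (Finset.sum_le_sum fun j _ => ?_)
    refine (norm_mul _ _).trans_le (mul_le_mul_of_nonneg_right ?_ (norm_nonneg _))
    change ‖(A i j : ℂ)‖ ≤ A i j
    rw [Complex.norm_real, Real.norm_of_nonneg (hA i j)]

end SpectralRadius

/-- A positive function which decays exponentially, with exponential bounds on both sides, takes
the value one exactly once. -/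
lemma exists_unique_eq_one {R : ℝ → ℝ} {θ C : ℝ} (hθ0 : 0 < θ) (hθ1 : θ < 1) (hC : 0 < C)
    (h0 : 1 ≤ R 0) (hup : ∀ α β, α ≤ β → R β ≤ θ ^ (β - α) * R α)
    (hlow : ∀ α β, α ≤ β → R α ≤ C ^ (β - α) * R β) :
    ∃ α, 0 ≤ α ∧ R α = 1 ∧ (∀ β, R β = 1 → β = α) ∧ ∀ β, α < β → R β < 1 := by
  have hpos : ∀ α, 0 < R α := by
    intro α
    rcases le_total 0 α with h | h
    · have := hlow 0 α h
      by_contra hR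
      have h1 : C ^ (α - 0) * R α ≤ 0 :=
        mul_nonpos_of_nonneg_of_nonpos (Real.rpow_nonneg hC.le _) (not_lt.1 hR)
      linarith
    · have := hup α 0 h
      by_contra hR
      have h1 : θ ^ (0 - α) * R α ≤ 0 :=
        mul_nonpos_of_nonneg_of_nonpos (Real.rpow_nonneg hθ0.le _) (not_lt.1 hR)
      linarith
  have hlt : ∀ α β, α < β → R β < R α := by
    intro α β h
    refine (hup α β h.le).trans_lt ?_
    exact mul_lt_of_lt_one_left (hpos α)
      (Real.rpow_lt_one hθ0.le hθ1 (sub_pos.2 h))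
  -- The two-sided exponential bounds make log R Lipschitz with constant |log C|.
  have hcont : Continuous fun α => Real.log (R α) := by
    have key : ∀ α β, α ≤ β →
        |Real.log (R α) - Real.log (R β)| ≤ |Real.log C| * |α - β| := by
      intro α β h
      have h1 := Real.log_le_log (hpos α) (hlow α β h)
      rw [Real.log_mul (Real.rpow_pos_of_pos hC _).ne' (hpos β).ne', Real.log_rpow hC] at h1
      have h2 : Real.log (R β) ≤ Real.log (R α) := by
        rcases h.eq_or_lt with rfl | h
        · exact le_rfl
        · exact Real.log_le_log (hpos β) (hlt α β h).le
      rw [abs_of_nonneg (sub_nonneg.2 h2), abs_sub_comm α β, abs_of_nonneg (sub_nonneg.2 h)]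
      have := mul_le_mul_of_nonneg_left (le_abs_self (Real.log C)) (sub_nonneg.2 h)
      linarith
    refine (LipschitzWith.of_dist_le_mul (K := ⟨|Real.log C|, abs_nonneg _⟩)
      fun α β => ?_).continuous
    rw [Real.dist_eq, Real.dist_eq]
    rcases le_total α β with h | h
    · exact key α β h
    · rw [abs_sub_comm, abs_sub_comm α β]
      exact key β α h
  have hRcont : Continuous R := by
    have := Real.continuous_exp.comp hcont
    refine this.congr fun α => ?_
    simp [Real.exp_log (hpos α)]
  obtain ⟨T, hT0, hT⟩ : ∃ T : ℝ, 0 ≤ T ∧ R T ≤ 1 := by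
    obtain ⟨m, hm⟩ := exists_pow_lt_of_lt_one (inv_pos.2 (hpos 0)) hθ1
    refine ⟨m, m.cast_nonneg, (hup 0 m m.cast_nonneg).trans ?_⟩
    rw [sub_zero, Real.rpow_natCast]
    calc θ ^ m * R 0 ≤ (R 0)⁻¹ * R 0 := mul_le_mul_of_nonneg_right hm.le (hpos 0).le
      _ = 1 := inv_mul_cancel₀ (hpos 0).ne'
  obtain ⟨α, hα, hα1⟩ := intermediate_value_Icc' hT0 hRcont.continuousOn ⟨hT, h0⟩
  refine ⟨α, hα.1, hα1, fun β hβ => ?_, fun β hβ => hα1 ▸ hlt α β hβ⟩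
  rcases lt_trichotomy α β with h | h | h
  · have := hlt _ _ h; rw [hβ, hα1] at this; exact absurd this (lt_irrefl _)
  · exact h.symm
  · have := hlt _ _ h; rw [hβ, hα1] at this; exact absurd this (lt_irrefl _)

/-- For a family of nonnegative matrices which decays exponentially in the parameter, the spectral
radius is one for exactly one parameter. -/
lemma exists_unique_spectralRadius_eq_one {ι : Type*} [Fintype ι] [DecidableEq ι]
    {A : ℝ → Matrix ι ι ℝ} (hA : ∀ α i j, 0 ≤ A α i j) {k : ℕ} {c : ℝ} (hk : 1 ≤ k)
    (hc : 0 < c)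
    (h : ∀ α β : ℝ, α ≤ β → ∀ i j, c ^ (β - α) * ((A α) ^ k) i j ≤ ((A β) ^ k) i j ∧
      ((A β) ^ k) i j ≤ (1 / 2 : ℝ) ^ (β - α) * ((A α) ^ k) i j)
    (h0 : 1 ≤ spectralRadius ℂ ((A 0).map Complex.ofReal)) :
    ∃ α, 0 ≤ α ∧ spectralRadius ℂ ((A α).map Complex.ofReal) = 1 ∧
      (∀ β, spectralRadius ℂ ((A β).map Complex.ofReal) = 1 → β = α) ∧
      ∀ β, α < β → spectralRadius ℂ ((A β).map Complex.ofReal) < 1 := by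
  set R : ℝ → ℝ := fun α => (spectralRadius ℂ ((A α).map Complex.ofReal)).toReal with hR
  have htop := fun α => spectralRadius_map_ofReal_ne_top (A α)
  have hkey : ∀ α β t : ℝ, 0 ≤ t → (∀ i j, ((A α) ^ k) i j ≤ t * ((A β) ^ k) i j) →
      R α ≤ t ^ (1 / k : ℝ) * R β := by
    intro α β t ht hle
    lift t to NNReal using ht
    have h1 := spectralRadius_le_of_pow_le hk (hA α) (hA β) hle
    have h2 := ENNReal.toReal_mono (ENNReal.mul_ne_top
      (ENNReal.rpow_ne_top_of_nonneg (by positivity) ENNReal.coe_ne_top) (htop β)) h1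
    rwa [ENNReal.toReal_mul, ← ENNReal.toReal_rpow, ENNReal.coe_toReal] at h2
  have hiff : ∀ α, spectralRadius ℂ ((A α).map Complex.ofReal) = 1 ↔ R α = 1 := fun α => by
    rw [hR]; simp only; rw [ENNReal.toReal_eq_one_iff]
  have hk0 : (0 : ℝ) < 1 / k := by positivity
  -- The bounds hold for k-th powers of the matrices, so the constants for the spectral radius are
  -- k-th roots.
  obtain ⟨α, h1, h2, h3, h4⟩ := exists_unique_eq_one (R := R) (θ := (1 / 2 : ℝ) ^ (1 / k : ℝ))
    (C := (c⁻¹) ^ (1 / k : ℝ)) (by positivity)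
    (Real.rpow_lt_one (by norm_num) (by norm_num) hk0) (by positivity)
    (by simpa using ENNReal.toReal_mono (htop 0) h0)
    (fun α β hαβ => by
      have := hkey β α ((1 / 2 : ℝ) ^ (β - α)) (by positivity) fun i j => (h α β hαβ i j).2
      rwa [← Real.rpow_mul (by norm_num), mul_comm, mul_comm (β - α), Real.rpow_mul (by norm_num),
        mul_comm] at this)
    (fun α β hαβ => by
      have := hkey α β ((c⁻¹) ^ (β - α)) (by positivity) fun i j => by
        have := (h α β hαβ i j).1
        rw [Real.inv_rpow hc.le, inv_mul_eq_div, le_div_iff₀ (by positivity), mul_comm]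
        exact this
      rwa [← Real.rpow_mul (by positivity), mul_comm, mul_comm (β - α),
        Real.rpow_mul (by positivity), mul_comm] at this)
  refine ⟨α, h1, (hiff α).2 h2, fun β hβ => h3 β ((hiff β).1 hβ), fun β hβ => ?_⟩
  have := h4 β hβ
  rw [← ENNReal.toReal_lt_toReal (htop β) ENNReal.one_ne_top]
  simpa using this

end FiniteTypeIFS

namespace FiniteTypeIFS

variable {X : Type*} {N : ℕ} {S : Fin N → X → X} {ρ : Fin N → ℝ}
  {ℳ : ℕ → Finset (List (Fin N))}

/-! ### The upper bound for the dimension -/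

/-- Every point of the attractor lies in the cells along an infinite path of the reduced graph. -/
lemma exists_mem_descendants_root [MetricSpace X] [Nontrivial X]
    (hS : IsContractiveSimilitudes S ρ) (hℳ : IsNestedIndexSets ℳ) {K : Set X}
    (hK : IsAttractor S K) {x : X} (hx : x ∈ K) (k : ℕ) :
    ∃ σ ∈ Vertex.descendants k (Vertex.root S hℳ), x ∈ σ.map '' K := by
  -- `P j η`: some vertex `j` levels below `η` in the tree has a cell containing `x`
  let P : ℕ → Vertex S ℳ → Prop := fun j => Nat.rec (fun η => x ∈ η.map '' K)
    (fun _ Q η => ∃ w σ, IsMinEdge η w σ ∧ Q σ) j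
  have hP0 : ∀ η, P 0 η ↔ x ∈ η.map '' K := fun _ => Iff.rfl
  have hPs : ∀ j η, P (j + 1) η ↔ ∃ w σ, IsMinEdge η w σ ∧ P j σ := fun _ _ => Iff.rfl
  have hcell : ∀ j η, P j η → x ∈ η.map '' K := by
    intro j
    induction j with
    | zero => exact fun η h => h
    | succ j ih =>
      rintro η ⟨w, σ, h, hσ⟩
      obtain ⟨y, hy, rfl⟩ := ih σ hσ
      exact ⟨wordMap S w y, hK.wordMap_mem w hy, by rw [h.1.2]; rfl⟩
  have hmono : ∀ j η, P (j + 1) η → P j η := by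
    intro j
    induction j with
    | zero => exact fun η h => hcell 1 η h
    | succ j ih =>
      rintro η ⟨w, σ, h, hσ⟩
      exact ⟨w, σ, h, ih σ hσ⟩
  have hanti : ∀ η i j, i ≤ j → P j η → P i η := by
    intro η i j hij
    induction j, hij using Nat.le_induction with
    | base => exact id
    | succ j _ ih => exact fun h => ih (hmono j η h)
  -- Every vertex below the root has a minimal incoming edge, so one can climb from any cell
  -- containing x to the root; hence the root satisfies P at every depth.
  have hup : ∀ l j (σ : Vertex S ℳ), σ.level = l → P j σ → P (j + l) (Vertex.root S hℳ) := by
    intro l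
    induction l with
    | zero => intro j σ hl h; rwa [← Vertex.eq_root hℳ hl]
    | succ l ih =>
      intro j σ hl h
      obtain ⟨η, w, hw⟩ := σ.exists_isMinEdge hS hℳ hl
      have := ih (j + 1) η (by have := hw.1.1; omega) ⟨w, σ, hw, h⟩
      rwa [show j + (l + 1) = j + 1 + l by ring]
  have hroot : ∀ j, P j (Vertex.root S hℳ) := by
    intro j
    obtain ⟨σ, hσ, h⟩ := hK.exists_vertex hℳ j hx
    simpa using hup j 0 σ hσ h
  -- König's lemma: if each of the finitely many candidates on the next level failed at some depth,
  -- then `P (m + 1) η` would fail for a common bound m of these depths.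
  have step : ∀ η : {η : Vertex S ℳ // ∀ j, P j η},
      ∃ σ : {η : Vertex S ℳ // ∀ j, P j η}, ∃ w, IsMinEdge η.1 w σ.1 := by
    rintro ⟨η, hη⟩
    by_contra hcon
    push Not at hcon
    have h1 : ∀ σ : Vertex S ℳ, ∃ j, (∃ w, IsMinEdge η w σ) → ¬ P j σ := by
      intro σ
      by_contra h
      push Not at h
      obtain ⟨w, hw⟩ := (h 0).1
      exact hcon ⟨σ, fun j => (h j).2⟩ w hw
    choose f hf using h1
    obtain ⟨m, hm⟩ := ((Vertex.finite_level S ℳ (η.level + 1)).image f).bddAbove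
    obtain ⟨w, σ, hw, hσ⟩ := hη (m + 1)
    exact hf σ ⟨w, hw⟩ (hanti σ _ _ (hm (mem_image_of_mem f hw.1.1)) hσ)
  choose next hnext using step
  have hred : ∀ η : {η : Vertex S ℳ // ∀ j, P j η}, η.1 ∈ reducedVertices S ℳ := by
    intro η
    refine ⟨fun j => (next^[j] η).1, rfl, fun j => ?_⟩
    simp only [Function.iterate_succ_apply']
    exact hnext _
  have hdesc : ∀ k (η : {η : Vertex S ℳ // ∀ j, P j η}),
      ∃ σ ∈ Vertex.descendants k η.1, x ∈ σ.map '' K := by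
    intro k
    induction k with
    | zero => exact fun η => ⟨η.1, Vertex.mem_descendants_zero.2 rfl, η.2 0⟩
    | succ k ih =>
      intro η
      obtain ⟨σ, hσ, h⟩ := ih (next η)
      obtain ⟨w, hw⟩ := hnext η
      exact ⟨σ, Vertex.mem_descendants_succ.2
        ⟨next η, Vertex.mem_children.2 ⟨w, hw, hred η, hred _⟩, hσ⟩, h⟩
  exact hdesc k ⟨_, hroot⟩

lemma root_mem_reducedVertices [MetricSpace X] [Nontrivial X]
    (hS : IsContractiveSimilitudes S ρ) (hℳ : IsNestedIndexSets ℳ) {K : Set X}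
    (hK : IsAttractor S K) : Vertex.root S hℳ ∈ reducedVertices S ℳ := by
  obtain ⟨x, hx⟩ := hK.1
  obtain ⟨σ, hσ, -⟩ := exists_mem_descendants_root hS hℳ hK hx 1
  obtain ⟨ζ, hζ, -⟩ := Vertex.mem_descendants_succ.1 hσ
  obtain ⟨w, hw⟩ := Vertex.mem_children.1 hζ
  exact hw.2.1

section Dimension

open Filter Topology MeasureTheory

variable [MetricSpace X]

lemma Vertex.ediam_image_le (hS : IsContractiveSimilitudes S ρ) (σ : Vertex S ℳ) (K : Set X) :
    Metric.ediam (σ.map '' K) ≤ ENNReal.ofReal (σ.ratio ρ) * Metric.ediam K := by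
  have h : LipschitzWith (σ.ratio ρ).toNNReal σ.map := LipschitzWith.of_dist_le_mul fun x y => by
    rw [σ.dist_map hS, Real.coe_toNNReal _ (σ.ratio_pos hS).le]
  exact h.ediam_image_le K

variable [Nontrivial X] {Ω : Set X} {hΩ : Ω.Nonempty}

/-- The k-th generation below the root covers K with mesh tending to zero. The sum of the β-th
powers of its ratios is a row sum of the k-th matrix power up to a constant, so it tends to zero and
the β-dimensional measure vanishes. -/
lemma dimH_le_of_spectralRadius_lt_one
    [Fintype (NbhdType S ℳ Ω hΩ)] [DecidableEq (NbhdType S ℳ Ω hΩ)]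
    (hcan : IsRightCancellative S) (hS : IsContractiveSimilitudes S ρ)
    (hinv : ∀ i, S i '' Ω ⊆ Ω) (hℳ : IsNestedIndexSets ℳ) {K : Set X}
    (hK : IsAttractor S K)
    {rep : NbhdType S ℳ Ω hΩ → Vertex S ℳ} (hrep : IsRepresentatives rep) {β : ℝ} (hβ : 0 ≤ β)
    (h : spectralRadius ℂ ((weightedIncidenceMatrix ρ Ω hΩ rep β).map Complex.ofReal) < 1) :
    dimH K ≤ ENNReal.ofReal β := by
  borelize X
  have hd : Metric.ediam K ≠ ⊤ := hK.2.1.isBounded.ediam_ne_top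
  set root := Vertex.root S hℳ
  have hsum : ∀ k, ∑ σ ∈ Vertex.descendants k root, σ.ratio ρ ^ β =
      root.ratio ρ ^ β * ((weightedIncidenceMatrix ρ Ω hΩ rep β) ^ k).mulVec (fun _ => 1)
        (nbhdType Ω hΩ root) := by
    intro k
    rw [← sum_descendants hcan hS hinv hℳ hrep β (fun _ => 1) k root]
    simp
  have hlim : Tendsto (fun k => ∑ σ ∈ Vertex.descendants k root, σ.ratio ρ ^ β) atTop (𝓝 0) := by
    simp only [hsum]
    simpa using (tendsto_pow_mulVec_of_spectralRadius_lt_one h (nbhdType Ω hΩ root)).const_mul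
      (root.ratio ρ ^ β)
  have hsmall : ∀ ε : ℝ, 0 < ε → ∀ᶠ k in atTop, ∀ σ ∈ Vertex.descendants k root,
      σ.ratio ρ ≤ ε := by
    intro ε hε
    obtain ⟨k₀, hk⟩ := Vertex.eventually_ratio_le (S := S) hS hℳ hε
    filter_upwards [eventually_ge_atTop k₀] with k hk0 σ hσ
    exact hk σ (by rw [Vertex.level_of_mem_descendants hσ]; omega)
  -- the mesh of the covers
  set r : ℕ → ℝ≥0∞ := fun k => ⨆ σ ∈ Vertex.descendants k root, Metric.ediam (σ.map '' K) with hr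
  have hr0 : Tendsto r atTop (𝓝 0) := by
    rw [ENNReal.tendsto_nhds_zero]
    intro ε hε
    obtain ⟨δ, hδ, hδε⟩ : ∃ δ : ℝ, 0 < δ ∧ ENNReal.ofReal δ * Metric.ediam K ≤ ε := by
      have h1 : Tendsto (fun δ : ℝ => ENNReal.ofReal δ * Metric.ediam K) (𝓝[>] 0) (𝓝 0) := by
        have h2 : Tendsto (fun δ : ℝ => ENNReal.ofReal δ) (𝓝[>] 0) (𝓝 0) := by
          have := (ENNReal.continuous_ofReal.tendsto (0 : ℝ)).mono_left
            (nhdsWithin_le_nhds (s := Ioi 0))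
          simpa using this
        simpa using ENNReal.Tendsto.mul_const h2 (Or.inr hd)
      have h3 := (h1.eventually (ge_mem_nhds hε)).and self_mem_nhdsWithin
      obtain ⟨δ, h4, h5⟩ := h3.exists
      exact ⟨δ, h5, h4⟩
    filter_upwards [hsmall δ hδ] with k hk
    refine iSup₂_le fun σ hσ => (σ.ediam_image_le hS K).trans (le_trans ?_ hδε)
    gcongr
    exact hk σ hσ
  have hmeas : Measure.hausdorffMeasure β K ≤ 0 := by
    refine (Measure.hausdorffMeasure_le_liminf_sum β K (l := atTop)
      (ι := fun k => {σ // σ ∈ Vertex.descendants k root}) r hr0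
      (fun k σ => σ.1.map '' K) (Eventually.of_forall fun k σ => ?_)
      (Eventually.of_forall fun k x hx => ?_)).trans ?_
    · exact le_iSup₂_of_le σ.1 σ.2 le_rfl
    · obtain ⟨σ, hσ, h⟩ := exists_mem_descendants_root hS hℳ hK hx k
      exact mem_iUnion.2 ⟨⟨σ, hσ⟩, h⟩
    · have hle : ∀ k, ∑ σ : {σ // σ ∈ Vertex.descendants k root}, Metric.ediam (σ.1.map '' K) ^ β ≤
          ENNReal.ofReal (∑ σ ∈ Vertex.descendants k root, σ.ratio ρ ^ β) *
            Metric.ediam K ^ β := by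
        intro k
        rw [ENNReal.ofReal_sum_of_nonneg fun σ _ => Real.rpow_nonneg (σ.ratio_pos hS).le _,
          Finset.sum_mul, ← Finset.sum_coe_sort (Vertex.descendants k root)]
        refine Finset.sum_le_sum fun σ _ => ?_
        refine (ENNReal.rpow_le_rpow (σ.1.ediam_image_le hS K) hβ).trans ?_
        rw [ENNReal.mul_rpow_of_nonneg _ _ hβ, ENNReal.ofReal_rpow_of_pos (σ.1.ratio_pos hS)]
      have hz : Tendsto (fun k => ENNReal.ofReal
          (∑ σ ∈ Vertex.descendants k root, σ.ratio ρ ^ β) * Metric.ediam K ^ β) atTop (𝓝 0) := by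
        have h1 := (ENNReal.continuous_ofReal.tendsto (0 : ℝ)).comp hlim
        rw [ENNReal.ofReal_zero] at h1
        simpa using ENNReal.Tendsto.mul_const h1
          (Or.inr (ENNReal.rpow_ne_top_of_nonneg hβ hd))
      rw [← hz.liminf_eq]
      exact liminf_le_liminf (Eventually.of_forall hle)
  have : Measure.hausdorffMeasure ((β.toNNReal : NNReal) : ℝ) K ≠ ⊤ := by
    rw [Real.coe_toNNReal _ hβ]
    exact (hmeas.trans_lt ENNReal.zero_lt_top).ne
  exact dimH_le_of_hausdorffMeasure_ne_top this

end Dimension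

/-! ### The lower bound for the dimension -/

section Hausdorff

open MeasureTheory

/-- If every finite cover by sets of small diameter has a large sum of powers of diameters, then
the Hausdorff measure of a compact set does not vanish. -/
lemma hausdorffMeasure_ne_zero_of_finite_covers [MetricSpace X] [MeasurableSpace X] [BorelSpace X]
    {K : Set X} (hK : IsCompact K) {α c r₁ : ℝ} (hα : 0 < α) (hc : 0 < c) (hr₁ : 0 < r₁)
    (h : ∀ (I : Finset ℕ) (U : ℕ → Set X) (r : ℕ → ℝ), (∀ i, 0 < r i) → (∀ i, r i ≤ r₁) →
      (∀ i, ∀ x ∈ U i, ∀ y ∈ U i, dist x y ≤ r i) → K ⊆ ⋃ i ∈ I, U i →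
      c ≤ ∑ i ∈ I, r i ^ α) :
    Measure.hausdorffMeasure α K ≠ 0 := by
  intro h0
  have h2 : (0 : ℝ) < 2 ^ α := by positivity
  -- Diameters and thickening errors each contribute at most ε, and a factor `2 ^ α` is lost in
  -- combining them; the total is c/2 < c.
  set ε : ℝ := c / (4 * 2 ^ α) with hε
  have hε0 : 0 < ε := by positivity
  rw [Measure.hausdorffMeasure_apply] at h0
  have hr4 : 0 < ENNReal.ofReal (r₁ / 4) := ENNReal.ofReal_pos.2 (by linarith)
  have h1 := (le_iSup₂ (f := fun (r : ℝ≥0∞) (_ : 0 < r) => ⨅ (t : ℕ → Set X) (_ : K ⊆ ⋃ n, t n)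
    (_ : ∀ n, Metric.ediam (t n) ≤ r), ∑' n, ⨆ (_ : (t n).Nonempty), Metric.ediam (t n) ^ α)
    _ hr4).trans h0.le
  have h1' := h1.trans_lt (ENNReal.ofReal_pos.2 hε0)
  simp only [iInf_lt_iff] at h1'
  obtain ⟨t, hcov, hdiam, hsum⟩ := h1'
  have hterm : ∀ i, ⨆ (_ : (t i).Nonempty), Metric.ediam (t i) ^ α = Metric.ediam (t i) ^ α := by
    intro i
    rcases (t i).eq_empty_or_nonempty with he | he
    · simp [he, hα]
    · simp [he]
  simp only [hterm] at hsum
  obtain ⟨e, he0, hesum⟩ := ENNReal.exists_pos_sum_of_countable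
    (ENNReal.ofReal_pos.2 hε0).ne' ℕ
  have hfin : ∀ i, Metric.ediam (t i) ≠ ⊤ := fun i =>
    ((hdiam i).trans_lt ENNReal.ofReal_lt_top).ne
  set d : ℕ → ℝ := fun i => (Metric.ediam (t i)).toReal with hd
  have hd0 : ∀ i, 0 ≤ d i := fun i => ENNReal.toReal_nonneg
  have hd4 : ∀ i, d i ≤ r₁ / 4 := fun i => ENNReal.toReal_le_of_le_ofReal (by linarith) (hdiam i)
  -- Thickening makes the cover open, so that compactness applies. The first bound keeps the added
  -- sum below `∑ e i`; the second keeps the enlarged diameter `d i + 2 * δ i` below r₁.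
  set δ : ℕ → ℝ := fun i => min (((e i : ℝ) ^ (1 / α)) / 2) (r₁ / 8) with hδ
  have hδ0 : ∀ i, 0 < δ i := fun i =>
    lt_min (half_pos (Real.rpow_pos_of_pos (by exact_mod_cast he0 i) _)) (by linarith)
  have hδe : ∀ i, (2 * δ i) ^ α ≤ e i := by
    intro i
    have h3 : 2 * δ i ≤ (e i : ℝ) ^ (1 / α) := by
      have := min_le_left (((e i : ℝ) ^ (1 / α)) / 2) (r₁ / 8)
      simp only [hδ]
      linarith
    calc (2 * δ i) ^ α ≤ ((e i : ℝ) ^ (1 / α)) ^ α :=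
          Real.rpow_le_rpow (by linarith [hδ0 i]) h3 hα.le
      _ = e i := by
          rw [← Real.rpow_mul (NNReal.coe_nonneg (e i)), one_div_mul_cancel hα.ne', Real.rpow_one]
  obtain ⟨I, hI⟩ := hK.elim_finite_subcover (fun i => Metric.thickening (δ i) (t i))
    (fun i => Metric.isOpen_thickening)
    (hcov.trans (iUnion_mono fun i => Metric.self_subset_thickening (hδ0 i) _))
  have hmain := h I (fun i => Metric.thickening (δ i) (t i)) (fun i => d i + 2 * δ i)
    (fun i => by linarith [hd0 i, hδ0 i])
    (fun i => by
      have := min_le_right (((e i : ℝ) ^ (1 / α)) / 2) (r₁ / 8)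
      have h5 := hd4 i
      simp only [hδ]
      linarith)
    (fun i x hx y hy => by
      obtain ⟨x', hx', hxx⟩ := Metric.mem_thickening_iff.1 hx
      obtain ⟨y', hy', hyy⟩ := Metric.mem_thickening_iff.1 hy
      have h3 : dist x' y' ≤ d i := by
        rw [dist_edist]
        exact ENNReal.toReal_mono (hfin i) (Metric.edist_le_ediam_of_mem hx' hy')
      have h4 := dist_triangle4 x x' y' y
      rw [dist_comm y' y] at h4
      linarith) hI
  have hbound : ∀ i, (d i + 2 * δ i) ^ α ≤ 2 ^ α * (d i ^ α + e i) := by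
    intro i
    have hm : d i + 2 * δ i ≤ 2 * max (d i) (2 * δ i) := by
      have := le_max_left (d i) (2 * δ i)
      have := le_max_right (d i) (2 * δ i)
      linarith
    have hm0 : 0 ≤ max (d i) (2 * δ i) := (hd0 i).trans (le_max_left _ _)
    calc (d i + 2 * δ i) ^ α ≤ (2 * max (d i) (2 * δ i)) ^ α :=
          Real.rpow_le_rpow (by linarith [hd0 i, hδ0 i]) hm hα.le
      _ = 2 ^ α * (max (d i) (2 * δ i)) ^ α := Real.mul_rpow (by norm_num) hm0
      _ ≤ 2 ^ α * (d i ^ α + e i) := by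
          refine mul_le_mul_of_nonneg_left ?_ h2.le
          have h6 := Real.rpow_nonneg (hd0 i) α
          rcases max_choice (d i) (2 * δ i) with hmx | hmx <;> rw [hmx]
          · linarith [(e i).2, show (0 : ℝ) ≤ e i from (e i).2]
          · linarith [hδe i]
  have hs1 : ∑ i ∈ I, d i ^ α ≤ ε := by
    have h7 : ∑ i ∈ I, Metric.ediam (t i) ^ α ≤ ENNReal.ofReal ε :=
      (ENNReal.sum_le_tsum I).trans hsum.le
    have h8 := ENNReal.toReal_mono ENNReal.ofReal_ne_top h7
    rw [ENNReal.toReal_sum fun i _ => ENNReal.rpow_ne_top_of_nonneg hα.le (hfin i),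
      ENNReal.toReal_ofReal hε0.le] at h8
    simpa only [← ENNReal.toReal_rpow] using h8
  have hs2 : ∑ i ∈ I, (e i : ℝ) ≤ ε := by
    have h7 : ∑ i ∈ I, (e i : ℝ≥0∞) ≤ ENNReal.ofReal ε :=
      (ENNReal.sum_le_tsum I).trans hesum.le
    have h8 := ENNReal.toReal_mono ENNReal.ofReal_ne_top h7
    rw [ENNReal.toReal_sum fun i _ => ENNReal.coe_ne_top, ENNReal.toReal_ofReal hε0.le] at h8
    simpa using h8
  have h9 : ∑ i ∈ I, (d i + 2 * δ i) ^ α ≤ 2 ^ α * (ε + ε) := by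
    refine (Finset.sum_le_sum fun i _ => hbound i).trans ?_
    rw [← Finset.mul_sum, Finset.sum_add_distrib]
    exact mul_le_mul_of_nonneg_left (add_le_add hs1 hs2) h2.le
  have h10 : 2 ^ α * (ε + ε) = c / 2 := by
    rw [hε]; field_simp; norm_num
  linarith

/-- A packing bound: sets of measure at least `a` inside `T` that cover each point at most `P`
times. -/
lemma card_mul_le_of_multiplicity {Y ι : Type*} [MeasurableSpace Y] {μ : Measure Y} (F : Finset ι)
    {s : ι → Set Y} {T : Set Y} (P : ℕ) {a : ℝ≥0∞} (hs : ∀ i ∈ F, MeasurableSet (s i))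
    (hT : MeasurableSet T) (hsub : ∀ i ∈ F, s i ⊆ T) (ha : ∀ i ∈ F, a ≤ μ (s i))
    (hP : ∀ y, ∀ G ⊆ F, (∀ i ∈ G, y ∈ s i) → G.card ≤ P) : F.card * a ≤ P * μ T := by
  classical
  calc (F.card : ℝ≥0∞) * a = ∑ i ∈ F, a := by rw [Finset.sum_const, nsmul_eq_mul]
    _ ≤ ∑ i ∈ F, μ (s i) := Finset.sum_le_sum ha
    _ = ∑ i ∈ F, ∫⁻ y, (s i).indicator 1 y ∂μ :=
        Finset.sum_congr rfl fun i hi => (lintegral_indicator_one (hs i hi)).symm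
    _ = ∫⁻ y, ∑ i ∈ F, (s i).indicator 1 y ∂μ :=
        (lintegral_finsetSum' _ fun i hi => (measurable_one.indicator (hs i hi)).aemeasurable).symm
    _ ≤ ∫⁻ y, T.indicator (fun _ => (P : ℝ≥0∞)) y ∂μ := by
        refine lintegral_mono fun y => ?_
        have h1 : ∑ i ∈ F, (s i).indicator (1 : Y → ℝ≥0∞) y =
            ({i ∈ F | y ∈ s i} : Finset ι).card := by
          rw [Finset.card_filter, Nat.cast_sum]
          refine Finset.sum_congr rfl fun i _ => ?_
          by_cases h : y ∈ s i <;> simp [h]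
        rw [h1]
        by_cases hy : y ∈ T
        · rw [indicator_of_mem hy]
          exact Nat.cast_le.2
            (hP y _ (Finset.filter_subset _ _) fun i hi => (Finset.mem_filter.1 hi).2)
        · have : ({i ∈ F | y ∈ s i} : Finset ι) = ∅ :=
            Finset.filter_eq_empty_iff.2 fun i hi h => hy (hsub i hi h)
          simp [this]
    _ = P * μ T := by rw [lintegral_indicator_const hT]

end Hausdorff

/-! ### Counting cells near a small set -/

section Counting

variable [MetricSpace X] [Nontrivial X] {Ω : Set X} {hΩ : Ω.Nonempty}

/-- Cells of comparable size cover each point a bounded number of times. -/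
lemma exists_multiplicity_le (hfin : Finite (NbhdType S ℳ Ω hΩ))
    (hS : IsContractiveSimilitudes S ρ) (hinv : ∀ i, S i '' Ω ⊆ Ω) (hℳ : IsNestedIndexSets ℳ)
    {c : ℝ} (hc : 0 < c) :
    ∃ P : ℕ, ∀ (r : ℝ) (y : X) (G : Finset (Vertex S ℳ)), 0 < r →
      (∀ ξ ∈ G, c * r ≤ ξ.ratio ρ ∧ ξ.ratio ρ ≤ r ∧ y ∈ ξ.map '' Ω) → G.card ≤ P := by
  classical
  obtain ⟨C, hC0, hC⟩ := exists_ratio_le_of_mem_nbhd (ρ := ρ) hfin hS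
  obtain ⟨Γ, hΓ⟩ := exists_ncard_nbhd_le hfin
  -- Let ξ₀ be a cell over y of smallest level. A cell over y at least D levels deeper descends from
  -- a neighbour of ξ₀, so its ratio is at most C r · c/(2C) = c r/2, which is too small. Thus at
  -- most D levels occur, and the cells over y on one level lie in a single neighbourhood, of size
  -- at most Γ.
  obtain ⟨D, hD1, hD⟩ := exists_forall_wordRatio_le hfin hS hℳ
    (show 0 < c / (2 * C) by positivity)
  refine ⟨Γ * D, fun r y G hr hG => ?_⟩
  rcases G.eq_empty_or_nonempty with rfl | hne
  · simp
  obtain ⟨ξ₀, hξ₀, hmin⟩ := Finset.exists_min_image G Vertex.level hne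
  have hlev : ∀ ξ ∈ G, ξ.level - ξ₀.level ∈ Finset.range D := by
    intro ξ hξ
    rw [Finset.mem_range]
    by_contra hge
    have hle := hmin ξ hξ
    obtain ⟨ζ, w, hζ, hw⟩ := ξ.exists_map_eq_comp hℳ hle
    have hmem : ζ ∈ ξ₀.nbhd Ω := ⟨hζ, y, (hG ξ₀ hξ₀).2.2,
      Vertex.image_subset_of_map_eq_comp hinv hw (hG ξ hξ).2.2⟩
    have h1 : wordRatio ρ w ≤ c / (2 * C) := by
      refine hD ζ (ξ.level - ξ₀.level) w (not_lt.1 hge) ?_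
      rw [← hw, hζ, Nat.add_sub_cancel' hle]
      exact ξ.mem
    have h2 := hC ξ₀ ζ hmem
    have h3 := Vertex.ratio_of_map_eq_comp hS hw
    have h4 := (hG ξ hξ).1
    have h5 := (hG ξ₀ hξ₀).2.1
    have h6 : ζ.ratio ρ * wordRatio ρ w ≤ (C * r) * (c / (2 * C)) :=
      mul_le_mul (h2.trans (mul_le_mul_of_nonneg_left h5 hC0.le)) h1 (wordRatio_pos hS w).le
        (by positivity)
    have h7 : (C * r) * (c / (2 * C)) = c * r / 2 := by field_simp
    have h8 : 0 < c * r := by positivity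
    linarith
  have := Finset.card_le_mul_card_image_of_maps_to hlev Γ fun j hj => ?_
  · rwa [Finset.card_range] at this
  · rcases Finset.eq_empty_or_nonempty ({a ∈ G | a.level - ξ₀.level = j}) with he | ⟨ξ₁, hξ₁⟩
    · rw [he]; simp
    · refine le_trans ?_ (hΓ ξ₁)
      rw [← Set.ncard_coe_finset]
      refine Set.ncard_le_ncard (fun ξ hξ => ?_) (ξ₁.nbhd_finite Ω)
      have h1 := Finset.mem_filter.1 hξ₁
      have h2 := Finset.mem_filter.1 (Finset.mem_coe.1 hξ)
      have h3 := hmin ξ₁ h1.1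
      have h4 := hmin ξ h2.1
      exact ⟨by omega, y, (hG ξ₁ h1.1).2.2, (hG ξ h2.1).2.2⟩

/-- The number of cells of size about `r` which meet a set of diameter at most `r` is bounded. -/
lemma exists_card_cut_le [MeasurableSpace X] [BorelSpace X] [CompactSpace X]
    (hfin : Finite (NbhdType S ℳ Ω hΩ))
    (hS : IsContractiveSimilitudes S ρ) (hinv : ∀ i, S i '' Ω ⊆ Ω) (hℳ : IsNestedIndexSets ℳ)
    (K : Set X) {n : ℕ} {μ : MeasureTheory.Measure X}
    (hμ : μ = MeasureTheory.Measure.hausdorffMeasure n)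
    {B : Set X} (hBΩ : B ⊆ Ω) (hB : IsCompact B) (hB0 : μ B ≠ 0) {C R₀ : ℝ}
    (hR₀ : 0 < R₀)
    (hreg : ∀ x R, 0 < R → R ≤ R₀ → μ (Metric.closedBall x R) ≤ ENNReal.ofReal (C * R ^ n)) :
    ∃ (Q : ℕ) (r₀ : ℝ), 0 < r₀ ∧ ∀ (U : Set X) (r : ℝ), 0 < r → r ≤ r₀ →
      (∀ x ∈ U, ∀ y ∈ U, dist x y ≤ r) → ∀ F : Finset (Vertex S ℳ),
      (∀ ξ ∈ F, ξ.ratio ρ ≤ r ∧ (∃ η w, IsEdge η w ξ ∧ r < η.ratio ρ) ∧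
        (ξ.map '' K ∩ U).Nonempty) → F.card ≤ Q := by
  obtain ⟨c, hc0, hc1, hc⟩ := exists_le_wordRatio_of_edge (ρ := ρ) hfin hS
  obtain ⟨P, hP⟩ := exists_multiplicity_le hfin hS hinv hℳ hc0
  obtain ⟨Δ, hΔ⟩ := (Metric.isBounded_iff.1 (isCompact_univ (X := X)).isBounded)
  have hΔ : ∀ x y : X, dist x y ≤ Δ := fun x y => hΔ (mem_univ x) (mem_univ y)
  have hΔ0 : 0 ≤ Δ := by
    obtain ⟨x⟩ := (inferInstance : Nonempty X)
    simpa using hΔ x x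
  -- The images of B lie in a ball of radius r(Δ + 1), have measure at least (c r)^n μ(B), and cover
  -- each point at most P times. The powers of r cancel, so Z / μ(B) bounds the number of cells
  -- independently of r.
  set Z : ℝ≥0∞ := P * ENNReal.ofReal (C * ((Δ + 1) / c) ^ n) with hZ
  have hZt : Z ≠ ⊤ := ENNReal.mul_ne_top (ENNReal.natCast_ne_top P) ENNReal.ofReal_ne_top
  refine ⟨⌈(Z / μ B).toReal⌉₊, R₀ / (Δ + 1), by positivity, fun U r hr hr0 hU F hF => ?_⟩
  rcases F.eq_empty_or_nonempty with rfl | ⟨ξ₁, hξ₁⟩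
  · simp
  obtain ⟨x₀, -, hx₀⟩ := (hF ξ₁ hξ₁).2.2
  have hlow : ∀ ξ ∈ F, c * r ≤ ξ.ratio ρ := by
    intro ξ hξ
    obtain ⟨η, w, he, hη⟩ := (hF ξ hξ).2.1
    rw [Vertex.ratio_of_map_eq_comp hS he.2, mul_comm]
    exact mul_le_mul hη.le (hc _ _ _ he) hc0.le (hr.trans hη).le
  have hcr : 0 < c * r := by positivity
  have hmeasure : ∀ ξ ∈ F, ENNReal.ofReal ((c * r) ^ n) * μ B ≤ μ (ξ.map '' B) := by
    intro ξ hξ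
    have hanti : AntilipschitzWith ((c * r)⁻¹).toNNReal ξ.map :=
      AntilipschitzWith.of_le_mul_dist fun x y => by
        rw [Real.coe_toNNReal _ (inv_pos.2 hcr).le, ξ.dist_map hS, inv_mul_eq_div,
          le_div_iff₀ hcr, mul_comm]
        exact mul_le_mul_of_nonneg_right (hlow ξ hξ) dist_nonneg
    have h1 := hanti.le_hausdorffMeasure_image (d := n) (by positivity) B
    rw [← hμ] at h1
    calc ENNReal.ofReal ((c * r) ^ n) * μ B
        ≤ ENNReal.ofReal ((c * r) ^ n) *
          ((((c * r)⁻¹).toNNReal : ℝ≥0∞) ^ (n : ℝ) * μ (ξ.map '' B)) := by gcongr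
      _ = μ (ξ.map '' B) := by
        rw [← mul_assoc, ENNReal.rpow_natCast, ENNReal.ofReal_pow hcr.le, ← mul_pow,
          show (((c * r)⁻¹).toNNReal : ℝ≥0∞) = ENNReal.ofReal (c * r)⁻¹ from rfl,
          ← ENNReal.ofReal_mul hcr.le, mul_inv_cancel₀ hcr.ne']
        simp
  have hsub : ∀ ξ ∈ F, ξ.map '' B ⊆ Metric.closedBall x₀ (r * (Δ + 1)) := by
    rintro ξ hξ _ ⟨b, -, rfl⟩
    obtain ⟨h1, -, z, ⟨p, -, rfl⟩, hz⟩ := hF ξ hξ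
    rw [Metric.mem_closedBall]
    have h2 := dist_triangle (ξ.map b) (ξ.map p) x₀
    have h3 : dist (ξ.map b) (ξ.map p) ≤ r * Δ := by
      rw [ξ.dist_map hS]
      exact mul_le_mul h1 (hΔ _ _) dist_nonneg hr.le
    have h4 := hU _ hz _ hx₀
    linarith
  have hcont : ∀ ξ : Vertex S ℳ, Continuous ξ.map := fun ξ =>
    (LipschitzWith.of_dist_le_mul (K := (ξ.ratio ρ).toNNReal) fun x y => by
      rw [ξ.dist_map hS, Real.coe_toNNReal _ (ξ.ratio_pos hS).le]).continuous
  have hpack := card_mul_le_of_multiplicity (μ := μ) F P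
    (fun ξ _ => (hB.image (hcont ξ)).measurableSet) Metric.isClosed_closedBall.measurableSet
    hsub hmeasure fun y G hGF hG => hP r y G hr fun ξ hξ =>
      ⟨hlow ξ (hGF hξ), (hF ξ (hGF hξ)).1, image_mono hBΩ (hG ξ hξ)⟩
  have hrR : r * (Δ + 1) ≤ R₀ := (le_div_iff₀ (by positivity)).1 hr0
  have h1 : (F.card : ℝ≥0∞) * (ENNReal.ofReal ((c * r) ^ n) * μ B) ≤
      P * ENNReal.ofReal (C * (r * (Δ + 1)) ^ n) :=
    hpack.trans (by gcongr; exact hreg _ _ (by positivity) hrR)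
  have h2 : (F.card : ℝ≥0∞) * μ B ≤ Z := by
    have h3 : C * (r * (Δ + 1)) ^ n = (c * r) ^ n * (C * ((Δ + 1) / c) ^ n) := by
      rw [div_pow, mul_pow, mul_pow]; field_simp
    have h4 : ENNReal.ofReal ((c * r) ^ n) ≠ 0 := by
      rw [Ne, ENNReal.ofReal_eq_zero, not_le]; positivity
    rw [h3, ENNReal.ofReal_mul (by positivity), mul_left_comm, mul_left_comm (P : ℝ≥0∞)] at h1
    exact (ENNReal.mul_le_mul_iff_right h4 ENNReal.ofReal_ne_top).1 h1
  have h5 : (F.card : ℝ≥0∞) ≤ Z / μ B :=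
    (ENNReal.le_div_iff_mul_le (Or.inl hB0) (Or.inr hZt)).2 h2
  have h6 := ENNReal.toReal_mono (ENNReal.div_ne_top hZt hB0) h5
  rw [ENNReal.toReal_natCast] at h6
  exact_mod_cast h6.trans (Nat.le_ceil _)

end Counting

/-! ### Cuts of the tree and the weight they carry -/

lemma Vertex.mem_descendants_add {j i : ℕ} {η ξ σ : Vertex S ℳ} (h : ξ ∈ descendants j η)
    (h' : σ ∈ descendants i ξ) : σ ∈ descendants (j + i) η := by
  induction j generalizing η with
  | zero => rw [mem_descendants_zero] at h; subst h; simpa using h'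
  | succ j ih =>
    obtain ⟨ζ, hζ, h⟩ := mem_descendants_succ.1 h
    rw [show j + 1 + i = j + i + 1 by ring]
    exact mem_descendants_succ.2 ⟨ζ, hζ, ih h⟩

/-- On a path from a large to a small vertex there is a first small vertex. -/
lemma exists_first_le {k : ℕ} {η σ : Vertex S ℳ} {r : ℝ} (h : σ ∈ Vertex.descendants k η)
    (hη : r < η.ratio ρ) (hσ : σ.ratio ρ ≤ r) :
    ∃ j i, j + i = k ∧ ∃ ξ, ξ ∈ Vertex.descendants j η ∧ σ ∈ Vertex.descendants i ξ ∧
      ξ.ratio ρ ≤ r ∧ ∃ ζ w, IsEdge ζ w ξ ∧ r < ζ.ratio ρ := by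
  induction k generalizing η with
  | zero =>
    rw [Vertex.mem_descendants_zero.1 h] at hσ
    exact absurd hσ (not_le.2 hη)
  | succ k ih =>
    obtain ⟨ζ, hζ, h⟩ := Vertex.mem_descendants_succ.1 h
    rcases le_or_gt (ζ.ratio ρ) r with hle | hlt
    · obtain ⟨w, hw⟩ := Vertex.mem_children.1 hζ
      exact ⟨1, k, add_comm _ _, ζ, Vertex.mem_descendants_succ.2
        ⟨ζ, hζ, Vertex.mem_descendants_zero.2 rfl⟩, h, hle, η, w, hw.1.1, hη⟩
    · obtain ⟨j, i, hji, ξ, h1, h2⟩ := ih h hlt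
      exact ⟨j + 1, i, by omega, ξ, Vertex.mem_descendants_succ.2 ⟨ζ, hζ, h1⟩, h2⟩

lemma sum_biUnion_le_of_nonneg {ι κ : Type*} [DecidableEq ι] [DecidableEq κ] (I : Finset ι)
    (t : ι → Finset κ) {f : κ → ℝ} (hf : ∀ x, 0 ≤ f x) :
    ∑ x ∈ I.biUnion t, f x ≤ ∑ i ∈ I, ∑ x ∈ t i, f x := by
  induction I using Finset.induction_on with
  | empty => simp
  | insert a I ha ih =>
    rw [Finset.biUnion_insert, Finset.sum_insert ha]
    have h1 := Finset.sum_union_inter (s₁ := t a) (s₂ := I.biUnion t) (f := f)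
    have h2 : 0 ≤ ∑ x ∈ t a ∩ I.biUnion t, f x := Finset.sum_nonneg fun x _ => hf x
    linarith

section CutSets

variable [MetricSpace X] [Nontrivial X] {Ω : Set X} {hΩ : Ω.Nonempty}

open Classical in
/-- A subinvariant vector gives a lower bound for the sum over a set of vertices which meets every
path of the reduced graph. -/
lemma le_sum_of_cut [Fintype (NbhdType S ℳ Ω hΩ)]
    (hcan : IsRightCancellative S) (hS : IsContractiveSimilitudes S ρ)
    (hinv : ∀ i, S i '' Ω ⊆ Ω) (hℳ : IsNestedIndexSets ℳ)
    {rep : NbhdType S ℳ Ω hΩ → Vertex S ℳ} (hrep : IsRepresentatives rep) {α : ℝ}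
    {w : NbhdType S ℳ Ω hΩ → ℝ} (hw0 : ∀ T, 0 ≤ w T)
    (hw : ∀ T, w T ≤ (weightedIncidenceMatrix ρ Ω hΩ rep α).mulVec w T)
    (𝒞 : Finset (Vertex S ℳ)) (k : ℕ) (η : Vertex S ℳ)
    (hcut : ∀ σ ∈ Vertex.descendants k η, ∃ j i, j + i = k ∧
      ∃ ξ ∈ 𝒞, ξ ∈ Vertex.descendants j η ∧ σ ∈ Vertex.descendants i ξ) :
    η.ratio ρ ^ α * w (nbhdType Ω hΩ η) ≤
      ∑ ξ ∈ 𝒞 with ∃ j, ξ ∈ Vertex.descendants j η, ξ.ratio ρ ^ α * w (nbhdType Ω hΩ ξ) := by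
  classical
  have hnn : ∀ ξ : Vertex S ℳ, 0 ≤ ξ.ratio ρ ^ α * w (nbhdType Ω hΩ ξ) := fun ξ =>
    mul_nonneg (Real.rpow_nonneg (ξ.ratio_pos hS).le _) (hw0 _)
  have hself : ∀ η ∈ 𝒞, η.ratio ρ ^ α * w (nbhdType Ω hΩ η) ≤
      ∑ ξ ∈ 𝒞 with ∃ j, ξ ∈ Vertex.descendants j η, ξ.ratio ρ ^ α * w (nbhdType Ω hΩ ξ) :=
    fun η hη => Finset.single_le_sum (f := fun ξ : Vertex S ℳ => ξ.ratio ρ ^ α *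
      w (nbhdType Ω hΩ ξ)) (fun ξ _ => hnn ξ)
      (Finset.mem_filter.2 ⟨hη, 0, Vertex.mem_descendants_zero.2 rfl⟩)
  induction k generalizing η with
  | zero =>
    obtain ⟨j, i, hji, ξ, hξ, h1, -⟩ := hcut η (Vertex.mem_descendants_zero.2 rfl)
    obtain rfl : j = 0 := by omega
    rw [Vertex.mem_descendants_zero.1 h1] at hξ
    exact hself η hξ
  | succ k ih =>
    -- If η is not in the cut, each path is cut below a child, so subinvariance passes the weight to
    -- the children and the induction applies there.
    by_cases hη : η ∈ 𝒞
    · exact hself η hη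
    have hchild : ∀ ζ ∈ η.children, ζ.ratio ρ ^ α * w (nbhdType Ω hΩ ζ) ≤
        ∑ ξ ∈ 𝒞 with ∃ j, ξ ∈ Vertex.descendants j ζ, ξ.ratio ρ ^ α * w (nbhdType Ω hΩ ξ) := by
      intro ζ hζ
      refine ih ζ fun σ hσ => ?_
      obtain ⟨j, i, hji, ξ, hξ, h1, h2⟩ := hcut σ (Vertex.mem_descendants_succ.2 ⟨ζ, hζ, hσ⟩)
      rcases j with _ | j
      · rw [Vertex.mem_descendants_zero.1 h1] at hξ
        exact absurd hξ hη
      · obtain ⟨ζ', hζ', h3⟩ := Vertex.mem_descendants_succ.1 h1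
        have h4 := Vertex.mem_descendants_add h3 h2
        rw [show j + i = k by omega] at h4
        -- σ lies k steps below both ζ and ζ', so they coincide: the cut vertex lies below the given
        -- child.
        rw [Vertex.eq_of_mem_descendants hcan h4 hσ] at h3
        exact ⟨j, i, by omega, ξ, hξ, h3, h2⟩
    have hdisj : ((η.children : Finset (Vertex S ℳ)) : Set (Vertex S ℳ)).PairwiseDisjoint
        fun ζ => ({ξ ∈ 𝒞 | ∃ j, ξ ∈ Vertex.descendants j ζ} : Finset (Vertex S ℳ)) := by
      intro ζ hζ ζ' hζ' hne
      rw [Function.onFun, Finset.disjoint_left]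
      intro ξ h h'
      obtain ⟨-, j, hj⟩ := Finset.mem_filter.1 h
      obtain ⟨-, j', hj'⟩ := Finset.mem_filter.1 h'
      have h1 := Vertex.level_of_mem_descendants hj
      have h2 := Vertex.level_of_mem_descendants hj'
      rw [Vertex.level_of_mem_children hζ] at h1
      rw [Vertex.level_of_mem_children hζ'] at h2
      obtain rfl : j = j' := by omega
      exact hne (Vertex.eq_of_mem_descendants hcan hj hj')
    calc η.ratio ρ ^ α * w (nbhdType Ω hΩ η)
        ≤ η.ratio ρ ^ α *
          (weightedIncidenceMatrix ρ Ω hΩ rep α).mulVec w (nbhdType Ω hΩ η) :=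
          mul_le_mul_of_nonneg_left (hw _) (Real.rpow_nonneg (η.ratio_pos hS).le _)
      _ = ∑ ζ ∈ η.children, ζ.ratio ρ ^ α * w (nbhdType Ω hΩ ζ) :=
          (sum_children hS hinv hℳ hrep α w η).symm
      _ ≤ ∑ ζ ∈ η.children, ∑ ξ ∈ 𝒞 with ∃ j, ξ ∈ Vertex.descendants j ζ,
            ξ.ratio ρ ^ α * w (nbhdType Ω hΩ ξ) := Finset.sum_le_sum hchild
      _ = ∑ ξ ∈ η.children.biUnion fun ζ => {ξ ∈ 𝒞 | ∃ j, ξ ∈ Vertex.descendants j ζ},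
            ξ.ratio ρ ^ α * w (nbhdType Ω hΩ ξ) := (Finset.sum_biUnion hdisj).symm
      _ ≤ _ := by
          refine Finset.sum_le_sum_of_subset_of_nonneg (fun ξ hξ => ?_) fun ξ _ _ => hnn ξ
          obtain ⟨ζ, hζ, h⟩ := Finset.mem_biUnion.1 hξ
          obtain ⟨h1, j, h2⟩ := Finset.mem_filter.1 h
          exact Finset.mem_filter.2 ⟨h1, j + 1, Vertex.mem_descendants_succ.2 ⟨ζ, hζ, h2⟩⟩

/-- For a finite cover, take the vertices below η₀ that are the first of ratio at most r_i on their
path and whose cells meet U_i, for some i. They form a cut, so their weight is at least that of η₀,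
while each U_i contributes at most a constant times r_i^α. -/
lemma le_dimH_of_spectralRadius_eq_one [MeasurableSpace X] [BorelSpace X] [CompactSpace X]
    [Fintype (NbhdType S ℳ Ω hΩ)] [DecidableEq (NbhdType S ℳ Ω hΩ)]
    (hcan : IsRightCancellative S) (hS : IsContractiveSimilitudes S ρ)
    (hinv : ∀ i, S i '' Ω ⊆ Ω) (hℳ : IsNestedIndexSets ℳ) {K : Set X}
    (hK : IsAttractor S K) {rep : NbhdType S ℳ Ω hΩ → Vertex S ℳ} (hrep : IsRepresentatives rep)
    {n : ℕ} {B : Set X} (hBΩ : B ⊆ Ω) (hB : IsCompact B)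
    (hB0 : MeasureTheory.Measure.hausdorffMeasure n B ≠ 0) {C R₀ : ℝ} (hR₀ : 0 < R₀)
    (hreg : ∀ x R, 0 < R → R ≤ R₀ →
      MeasureTheory.Measure.hausdorffMeasure n (Metric.closedBall (x : X) R) ≤
        ENNReal.ofReal (C * R ^ n))
    {α : ℝ} (hα : 0 ≤ α)
    (h : spectralRadius ℂ ((weightedIncidenceMatrix ρ Ω hΩ rep α).map Complex.ofReal) = 1) :
    ENNReal.ofReal α ≤ dimH K := by
  classical
  rcases hα.eq_or_lt with rfl | hα
  · simp
  obtain ⟨w, hw0, hwne, hw⟩ := exists_le_mulVec_of_spectralRadius_eq_one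
    (weightedIncidenceMatrix_nonneg hS rep α) h
  obtain ⟨T, hT⟩ : ∃ T, 0 < w T := by
    obtain ⟨T, hT⟩ := Function.ne_iff.1 hwne
    exact ⟨T, lt_of_le_of_ne (hw0 T) (Ne.symm hT)⟩
  obtain ⟨Wm, hWm⟩ := Finite.exists_le w
  have hWm0 : 0 < Wm := hT.trans_le (hWm T)
  obtain ⟨Q, r₀, hr₀, hQ⟩ := exists_card_cut_le (hΩ := hΩ) (S := S) (ρ := ρ) (ℳ := ℳ)
    inferInstance hS hinv hℳ K rfl hBΩ hB hB0 hR₀ hreg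
  set η₀ := rep T with hη₀
  have hη₀p := η₀.ratio_pos hS
  set m₀ : ℝ := η₀.ratio ρ ^ α * w (nbhdType Ω hΩ η₀) with hm₀
  have hm₀p : 0 < m₀ := by
    rw [hm₀, hη₀, (hrep T).1]
    exact mul_pos (Real.rpow_pos_of_pos hη₀p _) hT
  have hmain : MeasureTheory.Measure.hausdorffMeasure α K ≠ 0 := by
    -- `Q + 1` keeps the denominator positive when Q = 0. Taking r₁ at most half the ratio of η₀
    -- ensures that η₀ itself is large, so a first small vertex is preceded by a large one.
    refine hausdorffMeasure_ne_zero_of_finite_covers hK.2.1 (c := m₀ / ((Q + 1) * Wm))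
      (r₁ := min r₀ (η₀.ratio ρ / 2)) hα (by positivity) (by positivity) ?_
    intro I U r hr hr₁ hU hcov
    have hr₀' : ∀ i, r i ≤ r₀ := fun i => (hr₁ i).trans (min_le_left _ _)
    have hrη : ∀ i, r i < η₀.ratio ρ := fun i => by
      have := (hr₁ i).trans (min_le_right _ _)
      linarith
    -- a level at which all vertices are small
    obtain ⟨ε, hε0, hε⟩ : ∃ ε : ℝ, 0 < ε ∧ ∀ i ∈ I, ε ≤ r i := by
      rcases I.eq_empty_or_nonempty with rfl | hne
      · exact ⟨1, one_pos, by simp⟩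
      · obtain ⟨i, hi, hmin⟩ := I.exists_min_image r hne
        exact ⟨r i, hr i, hmin⟩
    obtain ⟨k, hk⟩ := Vertex.eventually_ratio_le (S := S) hS hℳ hε0
    let tree : Finset (Vertex S ℳ) :=
      (Finset.range (k + 1)).biUnion fun j => Vertex.descendants j η₀
    let cut : ℕ → Finset (Vertex S ℳ) := fun i => {ξ ∈ tree | ξ.ratio ρ ≤ r i ∧
      (∃ η w, IsEdge η w ξ ∧ r i < η.ratio ρ) ∧ (ξ.map '' K ∩ U i).Nonempty}
    have hcut : ∀ σ ∈ Vertex.descendants k η₀, ∃ j i, j + i = k ∧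
        ∃ ξ ∈ I.biUnion cut, ξ ∈ Vertex.descendants j η₀ ∧ σ ∈ Vertex.descendants i ξ := by
      intro σ hσ
      -- One point of the cell of σ selects the covering set `U a`; every ancestor's cell contains
      -- this point too and therefore meets `U a`.
      obtain ⟨p, hp⟩ := hK.1
      have hσK : σ.map p ∈ K := by rw [σ.map_eq]; exact hK.wordMap_mem _ hp
      obtain ⟨a, ha, hpa⟩ := mem_iUnion₂.1 (hcov hσK)
      have hσr : σ.ratio ρ ≤ r a :=
        (hk σ (by rw [Vertex.level_of_mem_descendants hσ]; omega)).trans (hε a ha)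
      obtain ⟨j, i, hji, ξ, h1, h2, h3, h4⟩ := exists_first_le hσ (hrη a) hσr
      refine ⟨j, i, hji, ξ, Finset.mem_biUnion.2 ⟨a, ha, Finset.mem_filter.2
        ⟨Finset.mem_biUnion.2 ⟨j, Finset.mem_range.2 (by omega), h1⟩, h3, h4, ?_⟩⟩, h1, h2⟩
      obtain ⟨v, hv⟩ := Vertex.exists_map_eq_of_mem_descendants h2
      refine ⟨σ.map p, ⟨wordMap S v p, hK.wordMap_mem v hp, ?_⟩, hpa⟩
      rw [hv]; rfl
    have hnn : ∀ ξ : Vertex S ℳ, 0 ≤ ξ.ratio ρ ^ α * w (nbhdType Ω hΩ ξ) := fun ξ =>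
      mul_nonneg (Real.rpow_nonneg (ξ.ratio_pos hS).le _) (hw0 _)
    have hcard : ∀ i, ∑ ξ ∈ cut i, ξ.ratio ρ ^ α * w (nbhdType Ω hΩ ξ) ≤
        (Q + 1) * Wm * r i ^ α := by
      intro i
      have h1 : ∀ ξ ∈ cut i, ξ.ratio ρ ^ α * w (nbhdType Ω hΩ ξ) ≤ r i ^ α * Wm := by
        intro ξ hξ
        exact mul_le_mul (Real.rpow_le_rpow (ξ.ratio_pos hS).le (Finset.mem_filter.1 hξ).2.1 hα.le)
          (hWm _) (hw0 _) (Real.rpow_nonneg (hr i).le _)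
      refine (Finset.sum_le_card_nsmul _ _ _ h1).trans ?_
      have h2 : (cut i).card ≤ Q := hQ (U i) (r i) (hr i) (hr₀' i) (hU i) _
        fun ξ hξ => (Finset.mem_filter.1 hξ).2
      have h3 : ((cut i).card : ℝ) ≤ Q + 1 := by
        have : ((cut i).card : ℝ) ≤ Q := by exact_mod_cast h2
        linarith
      rw [nsmul_eq_mul]
      have h4 : 0 ≤ r i ^ α * Wm := mul_nonneg (Real.rpow_nonneg (hr i).le _) hWm0.le
      calc ((cut i).card : ℝ) * (r i ^ α * Wm) ≤ (Q + 1) * (r i ^ α * Wm) :=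
            mul_le_mul_of_nonneg_right h3 h4
        _ = (Q + 1) * Wm * r i ^ α := by ring
    rw [div_le_iff₀ (by positivity), mul_comm, Finset.mul_sum]
    calc m₀ ≤ ∑ ξ ∈ I.biUnion cut with ∃ j, ξ ∈ Vertex.descendants j η₀,
          ξ.ratio ρ ^ α * w (nbhdType Ω hΩ ξ) :=
          le_sum_of_cut hcan hS hinv hℳ hrep hw0 hw _ k η₀ hcut
      _ ≤ ∑ ξ ∈ I.biUnion cut, ξ.ratio ρ ^ α * w (nbhdType Ω hΩ ξ) :=
          Finset.sum_le_sum_of_subset_of_nonneg (Finset.filter_subset _ _) fun ξ _ _ => hnn ξ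
      _ ≤ ∑ i ∈ I, ∑ ξ ∈ cut i, ξ.ratio ρ ^ α * w (nbhdType Ω hΩ ξ) :=
          sum_biUnion_le_of_nonneg I cut hnn
      _ ≤ ∑ i ∈ I, (Q + 1) * Wm * r i ^ α := Finset.sum_le_sum fun i _ => hcard i
  have := le_dimH_of_hausdorffMeasure_ne_zero (d := α.toNNReal) (s := K)
    (by rwa [Real.coe_toNNReal _ hα.le])
  exact this

end CutSets

/-- The dimension formula on a compact metric space whose Hausdorff measure of dimension `n` is
upper regular and does not vanish on `Ω`. -/
theorem exists_dimH_eq_of_upperRegular [MetricSpace X] [Nontrivial X] [MeasurableSpace X]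
    [BorelSpace X] [CompactSpace X] {Ω : Set X} {hΩ : Ω.Nonempty}
    (hcan : IsRightCancellative S) (hS : IsContractiveSimilitudes S ρ)
    (hinv : ∀ i, S i '' Ω ⊆ Ω) (hℳ : IsNestedIndexSets ℳ) {K : Set X}
    (hK : IsAttractor S K) [Finite (NbhdType S ℳ Ω hΩ)]
    {rep : NbhdType S ℳ Ω hΩ → Vertex S ℳ} (hrep : IsRepresentatives rep)
    {n : ℕ} {B : Set X} (hBΩ : B ⊆ Ω) (hB : IsCompact B)
    (hB0 : MeasureTheory.Measure.hausdorffMeasure n B ≠ 0) {C R₀ : ℝ} (hR₀ : 0 < R₀)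
    (hreg : ∀ x R, 0 < R → R ≤ R₀ →
      MeasureTheory.Measure.hausdorffMeasure n (Metric.closedBall (x : X) R) ≤
        ENNReal.ofReal (C * R ^ n)) :
    ∃ α : ℝ, 0 ≤ α ∧
      matrixSpectralRadius (weightedIncidenceMatrix ρ Ω hΩ rep α) = 1 ∧
      (∀ β : ℝ, matrixSpectralRadius (weightedIncidenceMatrix ρ Ω hΩ rep β) = 1 → β = α) ∧
      dimH K = ENNReal.ofReal α := by
  classical
  let := Fintype.ofFinite (NbhdType S ℳ Ω hΩ)
  have hdef : ∀ β, matrixSpectralRadius (weightedIncidenceMatrix ρ Ω hΩ rep β) =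
      spectralRadius ℂ ((weightedIncidenceMatrix ρ Ω hΩ rep β).map Complex.ofReal) :=
    fun β => by unfold matrixSpectralRadius; congr!
  simp only [hdef]
  have hone : 1 ≤ spectralRadius ℂ
      ((weightedIncidenceMatrix ρ Ω hΩ rep 0).map Complex.ofReal) := by
    -- At exponent zero the row sums at the type of the root count descendants, and no generation is
    -- empty.
    set root := Vertex.root S hℳ
    refine one_le_spectralRadius_of_one_le (nbhdType Ω hΩ root) fun m => ?_
    have h := sum_descendants hcan hS hinv hℳ hrep 0 (fun _ => 1) m root
    simp only [Real.rpow_zero, one_mul, Finset.sum_const, nsmul_eq_mul, mul_one] at h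
    rw [← h]
    exact_mod_cast Finset.card_pos.2
      (Vertex.descendants_nonempty (root_mem_reducedVertices hS hℳ hK) m)
  obtain ⟨k, c, hk, hc0, -, hcomp⟩ :=
    exists_weightedIncidenceMatrix_pow_le hcan hS hinv hℳ hrep
  obtain ⟨α, hα0, hα1, huniq, hlt⟩ := exists_unique_spectralRadius_eq_one
    (weightedIncidenceMatrix_nonneg hS rep) hk hc0 hcomp hone
  refine ⟨α, hα0, hα1, huniq, le_antisymm ?_
    (le_dimH_of_spectralRadius_eq_one hcan hS hinv hℳ hK hrep hBΩ hB hB0 hR₀ hreg hα0 hα1)⟩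
  -- The upper bound is available for every β > α; let β decrease to α.
  have hlim : Filter.Tendsto (fun β : ℝ => ENNReal.ofReal β) (nhdsWithin α (Ioi α))
      (nhds (ENNReal.ofReal α)) :=
    (ENNReal.continuous_ofReal.tendsto α).mono_left nhdsWithin_le_nhds
  refine ge_of_tendsto hlim ?_
  filter_upwards [self_mem_nhdsWithin] with β hβ
  exact dimH_le_of_spectralRadius_lt_one hcan hS hinv hℳ hK hrep (hα0.trans (le_of_lt hβ))
    (hlt β hβ)

end FiniteTypeIFS

namespace FiniteTypeIFS

/-! ### Locally Euclidean length spaces -/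

/-- Every point has a ball which is isometric to a ball in Euclidean space. -/
def HasEuclideanBalls (n : ℕ) (M : Type*) [MetricSpace M] : Prop :=
  ∀ x : M, ∃ (δ : ℝ) (f : M → EuclideanSpace ℝ (Fin n)), 0 < δ ∧
    (∀ y ∈ Metric.ball x δ, ∀ z ∈ Metric.ball x δ, dist (f y) (f z) = dist y z) ∧
    f '' Metric.ball x δ = Metric.ball (f x) δ

/-- The distance is realised, up to an arbitrarily small error, by chains through points at any
prescribed intermediate distance. -/
def HasIntermediatePoints (M : Type*) [MetricSpace M] : Prop :=
  ∀ (x y : M) (s ε : ℝ), 0 ≤ s → s ≤ dist x y → 0 < ε →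
    ∃ z, dist x z = s ∧ dist z y < dist x y - s + ε

/-! ### From the flat Riemannian metric to metric statements -/

section Riemannian

open MeasureTheory Topology

variable {n : ℕ} {M : Type*} [MetricSpace M]
    [ChartedSpace (EuclideanSpace ℝ (Fin n)) M]
    [RiemannianBundle (fun x : M => TangentSpace (𝓡 n) x)]

lemma pathELength_comp_of_norm_mfderiv_eq
    {φ : OpenPartialHomeomorph M (EuclideanSpace ℝ (Fin n))}
    (hφ : φ ∈ IsManifold.maximalAtlas (𝓡 n) ∞ M)
    (h : ∀ y ∈ φ.source, ∀ v : TangentSpace (𝓡 n) y,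
      ‖mfderiv (𝓡 n) (𝓡 n) φ y v‖ = ‖v‖) {γ : ℝ → M}
    (hγ : ContMDiffOn 𝓘(ℝ, ℝ) (𝓡 n) 1 γ (Icc 0 1)) (hs : ∀ t ∈ Icc (0 : ℝ) 1, γ t ∈ φ.source) :
    pathELength (𝓡 n) (φ ∘ γ) 0 1 = pathELength (𝓡 n) γ 0 1 := by
  rw [pathELength_eq_lintegral_mfderivWithin_Icc, pathELength_eq_lintegral_mfderivWithin_Icc]
  refine setLIntegral_congr_fun measurableSet_Icc fun t ht => ?_
  have hu : UniqueMDiffWithinAt 𝓘(ℝ, ℝ) (Icc (0 : ℝ) 1) t :=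
    (uniqueDiffOn_Icc zero_lt_one t ht).uniqueMDiffWithinAt
  have hφd : MDifferentiableAt (𝓡 n) (𝓡 n) φ (γ t) :=
    ((contMDiffOn_of_mem_maximalAtlas hφ).contMDiffAt
      (φ.open_source.mem_nhds (hs t ht))).mdifferentiableAt (by simp)
  have hγd := hγ.mdifferentiableOn one_ne_zero t ht
  have h1 := congr($(mfderiv_comp_mfderivWithin t hφd hγd hu) 1)
  have h2 := h (γ t) (hs t ht) (mfderivWithin 𝓘(ℝ, ℝ) (𝓡 n) γ (Icc 0 1) t 1)
  rw [← ofReal_norm, ← ofReal_norm]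
  congr 1
  exact (congrArg norm h1).trans h2

lemma pathELength_lineMap (x y : EuclideanSpace ℝ (Fin n)) :
    pathELength (𝓡 n) (ContinuousAffineMap.lineMap (R := ℝ) x y) 0 1 = edist x y := by
  rw [pathELength_eq_lintegral_mfderivWithin_Icc]
  simp only [mfderivWithin_eq_fderivWithin, enorm_tangentSpace_vectorSpace]
  exact lintegral_fderiv_lineMap_eq_edist

lemma edist_le_pathELength [IsRiemannianManifold (𝓡 n) M] {γ : ℝ → M} {a b : ℝ} (hab : a ≤ b)
    (hγ : ContMDiffOn 𝓘(ℝ, ℝ) (𝓡 n) 1 γ (Icc a b)) :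
    edist (γ a) (γ b) ≤ pathELength (𝓡 n) γ a b := by
  rw [IsRiemannianManifold.out (I := 𝓡 n)]
  exact riemannianEDist_le_pathELength hγ rfl rfl hab

lemma exists_path_of_edist_lt [IsRiemannianManifold (𝓡 n) M] {x y : M} {r : ℝ≥0∞}
    (h : edist x y < r) : ∃ γ : ℝ → M, γ 0 = x ∧ γ 1 = y ∧
      ContMDiffOn 𝓘(ℝ, ℝ) (𝓡 n) 1 γ (Icc 0 1) ∧ pathELength (𝓡 n) γ 0 1 < r := by
  rw [IsRiemannianManifold.out (I := 𝓡 n)] at h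
  exact exists_lt_of_riemannianEDist_lt h

lemma edist_comp_le_pathELength
    {φ : OpenPartialHomeomorph M (EuclideanSpace ℝ (Fin n))}
    (hφ : φ ∈ IsManifold.maximalAtlas (𝓡 n) ∞ M)
    (h : ∀ y ∈ φ.source, ∀ v : TangentSpace (𝓡 n) y,
      ‖mfderiv (𝓡 n) (𝓡 n) φ y v‖ = ‖v‖) {γ : ℝ → M}
    (hγ : ContMDiffOn 𝓘(ℝ, ℝ) (𝓡 n) 1 γ (Icc 0 1)) (hs : ∀ t ∈ Icc (0 : ℝ) 1, γ t ∈ φ.source) :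
    edist (φ (γ 0)) (φ (γ 1)) ≤ pathELength (𝓡 n) γ 0 1 := by
  rw [← pathELength_comp_of_norm_mfderiv_eq hφ h hγ hs]
  refine edist_le_pathELength (γ := φ ∘ γ) zero_le_one ?_
  exact ((contMDiffOn_of_mem_maximalAtlas hφ).of_le (by simp)).comp hγ hs

lemma edist_symm_le_of_segment_subset [IsRiemannianManifold (𝓡 n) M]
    {φ : OpenPartialHomeomorph M (EuclideanSpace ℝ (Fin n))}
    (hφ : φ ∈ IsManifold.maximalAtlas (𝓡 n) ∞ M)
    (h : ∀ y ∈ φ.source, ∀ v : TangentSpace (𝓡 n) y,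
      ‖mfderiv (𝓡 n) (𝓡 n) φ y v‖ = ‖v‖) {v w : EuclideanSpace ℝ (Fin n)}
    (hseg : segment ℝ v w ⊆ φ.target) : edist (φ.symm v) (φ.symm w) ≤ edist v w := by
  set η := ContinuousAffineMap.lineMap (R := ℝ) v w with hη
  have hη0 : η 0 = v := by simp [hη, ContinuousAffineMap.coe_lineMap_eq]
  have hη1 : η 1 = w := by simp [hη, ContinuousAffineMap.coe_lineMap_eq]
  have hmem : ∀ t ∈ Icc (0 : ℝ) 1, η t ∈ φ.target := by
    intro t ht
    refine hseg ?_
    rw [segment_eq_image_lineMap]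
    exact ⟨t, ht, by rw [hη, ContinuousAffineMap.coe_lineMap_eq]⟩
  have hηs : ContMDiffOn 𝓘(ℝ, ℝ) (𝓡 n) 1 η (Icc 0 1) := by
    rw [contMDiffOn_iff_contDiffOn]
    exact η.contDiff.contDiffOn
  have hγ : ContMDiffOn 𝓘(ℝ, ℝ) (𝓡 n) 1 (φ.symm ∘ η) (Icc 0 1) :=
    ((contMDiffOn_symm_of_mem_maximalAtlas hφ).of_le (by simp)).comp hηs hmem
  have heq : EqOn (φ ∘ φ.symm ∘ η) η (Icc 0 1) := fun t ht => φ.right_inv (hmem t ht)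
  have h1 := edist_le_pathELength zero_le_one hγ
  rw [← pathELength_comp_of_norm_mfderiv_eq hφ h hγ fun t ht => φ.map_target (hmem t ht),
    pathELength_congr heq, pathELength_lineMap] at h1
  simpa [hη0, hη1] using h1

/-- Charts preserve lengths of curves inside their source. Points of the δ-ball are joined by nearly
minimal curves shorter than 2δ, which stay within 3δ of x and so in the source: the chart does not
increase distances. Conversely, segments in the convex image ball lift to curves of the same length.
-/
lemma hasEuclideanBalls_of_isLocallyEuclidean [IsManifold (𝓡 n) ∞ M]
    [IsRiemannianManifold (𝓡 n) M] (hflat : IsLocallyEuclidean n M) :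
    HasEuclideanBalls n M := by
  intro x
  obtain ⟨φ, hφ, hx, h⟩ := hflat x
  obtain ⟨ε₁, hε₁, h1⟩ := Metric.isOpen_iff.1 φ.open_source x hx
  obtain ⟨ε₂, hε₂, h2⟩ := Metric.isOpen_iff.1 φ.open_target (φ x) (φ.map_source hx)
  set δ := min (ε₁ / 3) ε₂ with hδdef
  have hδ : 0 < δ := lt_min (by linarith) hε₂
  have hδ1 : 3 * δ ≤ ε₁ := by
    have := min_le_left (ε₁ / 3) ε₂
    linarith
  have hsrc : Metric.ball x δ ⊆ φ.source := (Metric.ball_subset_ball (by linarith)).trans h1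
  have htgt : Metric.ball (φ x) δ ⊆ φ.target :=
    (Metric.ball_subset_ball (min_le_right _ _)).trans h2
  have hle : ∀ y ∈ Metric.ball x δ, ∀ z ∈ Metric.ball x δ, dist (φ y) (φ z) ≤ dist y z := by
    intro y hy z hz
    have hyz : dist y z < 2 * δ := by
      have := dist_triangle_right y z x
      rw [Metric.mem_ball] at hy hz
      linarith
    suffices H : ∀ r, dist y z < r → r < 2 * δ → dist (φ y) (φ z) ≤ r by
      refine le_of_forall_gt_imp_ge_of_dense fun r hr => ?_
      rcases lt_or_ge r (2 * δ) with h3 | h3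
      · exact H r hr h3
      · obtain ⟨r', h4, h5⟩ := exists_between hyz
        exact (H r' h4 h5).trans (by linarith)
    intro r hr hr2
    have hr0 : 0 < r := dist_nonneg.trans_lt hr
    obtain ⟨γ, hγ0, hγ1, hγ, hlen⟩ := exists_path_of_edist_lt (n := n) (x := y) (y := z)
      (r := ENNReal.ofReal r) (by rw [edist_dist]; exact (ENNReal.ofReal_lt_ofReal_iff hr0).2 hr)
    have hs : ∀ t ∈ Icc (0 : ℝ) 1, γ t ∈ φ.source := by
      intro t ht
      have h3 := (edist_le_pathELength ht.1 (hγ.mono (Icc_subset_Icc_right ht.2))).trans_lt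
        ((pathELength_mono le_rfl ht.2).trans_lt hlen)
      rw [edist_dist, ENNReal.ofReal_lt_ofReal_iff hr0, hγ0] at h3
      refine h1 ?_
      rw [Metric.mem_ball] at hy ⊢
      have := dist_triangle_left (γ t) x y
      linarith
    have h3 := (edist_comp_le_pathELength hφ h hγ hs).trans hlen.le
    rw [hγ0, hγ1, edist_dist] at h3
    exact (ENNReal.ofReal_le_ofReal_iff hr0.le).1 h3
  have hball : ∀ y ∈ Metric.ball x δ, φ y ∈ Metric.ball (φ x) δ := fun y hy =>
    (hle y hy x (Metric.mem_ball_self hδ)).trans_lt hy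
  have hsymm : ∀ v ∈ Metric.ball (φ x) δ, ∀ w ∈ Metric.ball (φ x) δ,
      dist (φ.symm v) (φ.symm w) ≤ dist v w := by
    intro v hv w hw
    have := edist_symm_le_of_segment_subset hφ h
      (((convex_ball (φ x) δ).segment_subset hv hw).trans htgt)
    rwa [edist_dist, edist_dist, ENNReal.ofReal_le_ofReal_iff dist_nonneg] at this
  refine ⟨δ, φ, hδ, fun y hy z hz => le_antisymm (hle y hy z hz) ?_, ?_⟩
  · have := hsymm _ (hball y hy) _ (hball z hz)
    rwa [φ.left_inv (hsrc hy), φ.left_inv (hsrc hz)] at this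
  · refine Subset.antisymm (image_subset_iff.2 hball) fun v hv => ?_
    refine ⟨φ.symm v, ?_, φ.right_inv (htgt hv)⟩
    have := hsymm v hv _ (Metric.mem_ball_self hδ)
    rw [φ.left_inv hx] at this
    exact this.trans_lt hv

variable (n) in
-- On a nearly minimal curve the distance from x takes the value s, by the intermediate value
-- theorem; the length of the curve bounds the remaining distance.
lemma hasIntermediatePoints_of_isRiemannianManifold [IsRiemannianManifold (𝓡 n) M] :
    HasIntermediatePoints M := by
  intro x y s ε hs hsd hε
  have hpos : 0 < dist x y + ε := by linarith [dist_nonneg (x := x) (y := y)]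
  obtain ⟨γ, hγ0, hγ1, hγ, hlen⟩ := exists_path_of_edist_lt (n := n) (x := x) (y := y)
    (r := ENNReal.ofReal (dist x y + ε))
    (by rw [edist_dist]; exact (ENNReal.ofReal_lt_ofReal_iff hpos).2 (by linarith))
  have hcont : ContinuousOn (fun t => dist x (γ t)) (Icc 0 1) :=
    (continuous_const.dist continuous_id).comp_continuousOn hγ.continuousOn
  obtain ⟨t, ht, hst⟩ := intermediate_value_Icc zero_le_one hcont
    (show s ∈ Icc (dist x (γ 0)) (dist x (γ 1)) by simpa [hγ0, hγ1] using ⟨hs, hsd⟩)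
  refine ⟨γ t, hst, ?_⟩
  have h1 := edist_le_pathELength ht.1 (hγ.mono (Icc_subset_Icc_right ht.2))
  have h2 := edist_le_pathELength ht.2 (hγ.mono (Icc_subset_Icc_left ht.1))
  have h3 := (add_le_add h1 h2).trans_lt ((pathELength_add ht.1 ht.2).trans_lt hlen)
  rw [hγ0, hγ1, edist_dist, edist_dist, ← ENNReal.ofReal_add dist_nonneg dist_nonneg,
    ENNReal.ofReal_lt_ofReal_iff hpos] at h3
  have : dist x (γ t) = s := hst
  linarith

end Riemannian

/-! ### Non-branching geodesics and points determined by distances -/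

section MetricGeometry

open Topology

variable {n : ℕ} {M : Type*} [MetricSpace M]

/-- In a ball which is isometric to a Euclidean ball, small spheres are compact, so that there are
points exactly on the way to any given point. -/
lemma exists_dist_eq_sub (hI : HasIntermediatePoints M) {x : M} {δ : ℝ}
    {f : M → EuclideanSpace ℝ (Fin n)}
    (hf : ∀ y ∈ Metric.ball x δ, ∀ z ∈ Metric.ball x δ, dist (f y) (f z) = dist y z)
    (hfδ : f '' Metric.ball x δ = Metric.ball (f x) δ) {p : M} {s : ℝ} (hs0 : 0 ≤ s) (hsδ : s < δ)
    (hs : s ≤ dist x p) : ∃ y, dist x y = s ∧ dist y p = dist x p - s := by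
  have hne : Nonempty M := ⟨x⟩
  have hx : x ∈ Metric.ball x δ := Metric.mem_ball_self (hs0.trans_lt hsδ)
  have hinj : InjOn f (Metric.ball x δ) := fun y hy z hz h => by
    have := hf y hy z hz
    rw [h, dist_self] at this
    exact dist_eq_zero.1 this.symm
  set g := Function.invFunOn f (Metric.ball x δ) with hg
  have hgm : ∀ v ∈ Metric.ball (f x) δ, g v ∈ Metric.ball x δ ∧ f (g v) = v := by
    intro v hv
    rw [← hfδ] at hv
    exact ⟨Function.invFunOn_mem hv, Function.invFunOn_eq hv⟩
  have hgf : ∀ y ∈ Metric.ball x δ, g (f y) = y := fun y hy => hinj.leftInvOn_invFunOn hy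
  have hgc : ContinuousOn g (Metric.ball (f x) δ) := by
    refine LipschitzOnWith.continuousOn (K := 1)
      (LipschitzOnWith.of_dist_le_mul fun v hv w hw => ?_)
    rw [NNReal.coe_one, one_mul, ← hf _ (hgm v hv).1 _ (hgm w hw).1, (hgm v hv).2, (hgm w hw).2]
  have hsub : Metric.sphere (f x) s ⊆ Metric.ball (f x) δ :=
    Metric.sphere_subset_closedBall.trans (Metric.closedBall_subset_ball hsδ)
  have hcomp : IsCompact (g '' Metric.sphere (f x) s) :=
    (isCompact_sphere _ _).image_of_continuousOn (hgc.mono hsub)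
  have hsph : ∀ y, dist x y = s ↔ y ∈ g '' Metric.sphere (f x) s := by
    intro y
    constructor
    · intro hy
      have hyb : y ∈ Metric.ball x δ := by rw [Metric.mem_ball, dist_comm, hy]; exact hsδ
      refine ⟨f y, ?_, hgf y hyb⟩
      rw [Metric.mem_sphere, hf y hyb x hx, dist_comm, hy]
    · rintro ⟨v, hv, rfl⟩
      rw [← hf _ hx _ (hgm v (hsub hv)).1, (hgm v (hsub hv)).2, dist_comm]
      exact hv
  obtain ⟨y₀, hy₀, -⟩ := hI x p s 1 hs0 hs one_pos
  -- Minimising the distance to p over the compact sphere removes the error ε from the intermediate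
  -- points.
  obtain ⟨y, hy, hmin⟩ := hcomp.exists_isMinOn ⟨y₀, (hsph y₀).1 hy₀⟩
    (f := fun y => dist y p) (continuous_id.dist continuous_const).continuousOn
  have hys := (hsph y).2 hy
  refine ⟨y, hys, le_antisymm ?_ ?_⟩
  · refine le_of_forall_pos_le_add fun ε hε => ?_
    obtain ⟨z, hz, hzp⟩ := hI x p s ε hs0 hs hε
    exact (isMinOn_iff.1 hmin z ((hsph z).1 hz)).trans hzp.le
  · have := dist_triangle x y p
    linarith

/-- Segments in a Euclidean ball. -/
lemma exists_dist_eq_of_ball {x : M} {δ : ℝ} {f : M → EuclideanSpace ℝ (Fin n)}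
    (hf : ∀ y ∈ Metric.ball x δ, ∀ z ∈ Metric.ball x δ, dist (f y) (f z) = dist y z)
    (hfδ : f '' Metric.ball x δ = Metric.ball (f x) δ) {x' : M} (hx' : x' ∈ Metric.ball x δ)
    {t : ℝ} (ht0 : 0 ≤ t) (ht : t ≤ dist x x') :
    ∃ y, dist x y = dist x x' - t ∧ dist y x' = t := by
  have hx : x ∈ Metric.ball x δ := Metric.mem_ball_self (dist_nonneg.trans_lt hx')
  rcases (dist_nonneg (x := x) (y := x')).eq_or_lt with h0 | h0
  · have ht' : t = 0 := le_antisymm (ht.trans h0.symm.le) ht0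
    have : x = x' := dist_eq_zero.1 h0.symm
    exact ⟨x, by subst this; simp [ht'], by subst this; simp [ht']⟩
  set a := t / dist x x' with ha
  have ha0 : 0 ≤ a := by positivity
  have ha1 : a ≤ 1 := (div_le_one h0).2 ht
  have hat : a * dist x x' = t := div_mul_cancel₀ _ h0.ne'
  have hv : AffineMap.lineMap (f x') (f x) a ∈ Metric.ball (f x) δ := by
    refine (convex_ball (f x) δ).segment_subset (hfδ ▸ mem_image_of_mem f hx')
      (hfδ ▸ mem_image_of_mem f hx) ?_
    rw [segment_eq_image_lineMap]
    exact ⟨a, ⟨ha0, ha1⟩, rfl⟩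
  rw [← hfδ] at hv
  obtain ⟨y, hy, hyv⟩ := hv
  refine ⟨y, ?_, ?_⟩
  · rw [← hf x hx y hy, hyv, dist_comm, dist_lineMap_right, Real.norm_of_nonneg (by linarith),
      hf x' hx' x hx, dist_comm x' x]
    linarith
  · rw [← hf y hy x' hx', hyv, dist_lineMap_left, Real.norm_of_nonneg ha0, hf x' hx' x hx,
      dist_comm x' x, hat]

/-- Geodesics do not branch in Euclidean balls. -/
lemma eq_of_dist_eq_add {x : M} {δ : ℝ} {f : M → EuclideanSpace ℝ (Fin n)}
    (hf : ∀ y ∈ Metric.ball x δ, ∀ z ∈ Metric.ball x δ, dist (f y) (f z) = dist y z)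
    {y a b : M} (hy : y ∈ Metric.ball x δ) (hab : a ∈ Metric.ball x δ) (hb : b ∈ Metric.ball x δ)
    (hyx : y ≠ x) (ha1 : dist y a = dist y x + dist x a) (hb1 : dist y b = dist y x + dist x b)
    (hd : dist x a = dist x b) : a = b := by
  have hx : x ∈ Metric.ball x δ := Metric.mem_ball_self (dist_nonneg.trans_lt hy)
  -- Equality in the Euclidean triangle inequality forces the two vectors onto one ray, so c is
  -- determined by y, x and its distance from x.
  have key : ∀ c ∈ Metric.ball x δ, dist y c = dist y x + dist x c →
      dist y x • (f c - f x) = dist x c • (f x - f y) := by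
    intro c hc h
    rw [← hf y hy c hc, ← hf y hy x hx, ← hf x hx c hc, dist_comm (f y) (f c),
      dist_comm (f y) (f x), dist_comm (f x) (f c), dist_eq_norm, dist_eq_norm, dist_eq_norm] at h
    have h1 : ‖(f x - f y) + (f c - f x)‖ = ‖f x - f y‖ + ‖f c - f x‖ := by
      rw [← h]; congr 1; abel
    have h2 := (sameRay_iff_norm_smul_eq).1 (sameRay_iff_norm_add.2 h1)
    rw [← hf y hy x hx, ← hf x hx c hc, dist_comm (f y) (f x), dist_comm (f x) (f c),
      dist_eq_norm, dist_eq_norm]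
    exact h2
  have h1 := (key a hab ha1).trans ((by rw [hd] : _ = _).trans (key b hb hb1).symm)
  have h2 := smul_right_injective _ (dist_ne_zero.2 hyx) h1
  have h3 : f a = f b := by simpa using h2
  have h4 := hf a hab b hb
  rw [h3, dist_self] at h4
  exact dist_eq_zero.1 h4.symm

/-- There are points arbitrarily close to `x` from which the geodesics to `p` and to `q` both pass
through `x`, and `p`, `q` have the same distance from these points and from `x`. -/
def IsOnCommonGeodesic (p q x : M) : Prop :=
  dist x p = dist x q ∧ ∀ ε > 0, ∃ y, y ≠ x ∧ dist y x < ε ∧ dist y p = dist y x + dist x p ∧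
    dist y q = dist y x + dist x q

/-- Points of the Euclidean segment from x to x' close to x' serve as the points behind x'; the
assumed equalities force equality in the triangle inequalities for p and q. -/
lemma isOnCommonGeodesic_of_dist_eq_add {x : M} {δ : ℝ} {f : M → EuclideanSpace ℝ (Fin n)}
    (hf : ∀ y ∈ Metric.ball x δ, ∀ z ∈ Metric.ball x δ, dist (f y) (f z) = dist y z)
    (hfδ : f '' Metric.ball x δ = Metric.ball (f x) δ) {p q x' : M}
    (hx' : x' ∈ Metric.ball x δ) (hne : x' ≠ x) (hpq : dist x' p = dist x' q)
    (hp : dist x p = dist x x' + dist x' p) (hq : dist x q = dist x x' + dist x' q) :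
    IsOnCommonGeodesic p q x' := by
  refine ⟨hpq, fun ε hε => ?_⟩
  have h0 : 0 < dist x x' := dist_pos.2 hne.symm
  obtain ⟨t, ht0, ht⟩ := exists_between (lt_min hε h0)
  obtain ⟨y, hy1, hy2⟩ :=
    exists_dist_eq_of_ball hf hfδ hx' ht0.le (ht.trans_le (min_le_right _ _)).le
  refine ⟨y, fun h => ?_, hy2 ▸ ht.trans_le (min_le_left _ _), ?_, ?_⟩
  · rw [h, dist_self] at hy2
    exact ht0.ne hy2
  · have h1 := dist_triangle y x' p
    have h2 := dist_triangle x y p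
    linarith
  · have h1 := dist_triangle y x' q
    have h2 := dist_triangle x y q
    linarith

/-- Common geodesics can be continued. -/
lemma IsOnCommonGeodesic.exists_next (hE : HasEuclideanBalls n M) (hI : HasIntermediatePoints M)
    {p q x : M} (h : IsOnCommonGeodesic p q x) (hpos : 0 < dist x p) :
    ∃ x', x' ≠ x ∧ dist x p = dist x x' + dist x' p ∧ IsOnCommonGeodesic p q x' := by
  obtain ⟨δ, f, hδ, hf, hfδ⟩ := hE x
  obtain ⟨hpq, hback⟩ := h
  obtain ⟨y, hyx, hyδ, hyp, hyq⟩ := hback δ hδ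
  set s := min δ (dist x p) / 2 with hs
  have hm : 0 < min δ (dist x p) := lt_min hδ hpos
  have hs0 : 0 < s := by positivity
  have hsδ : s < δ := by have := min_le_left δ (dist x p); linarith
  have hsp : s ≤ dist x p := by have := min_le_right δ (dist x p); linarith
  obtain ⟨a, ha1, ha2⟩ := exists_dist_eq_sub hI hf hfδ hs0.le hsδ hsp
  obtain ⟨b, hb1, hb2⟩ := exists_dist_eq_sub hI hf hfδ hs0.le hsδ (hpq ▸ hsp)
  have ha : a ∈ Metric.ball x δ := by rw [Metric.mem_ball, dist_comm, ha1]; exact hsδ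
  have hb : b ∈ Metric.ball x δ := by rw [Metric.mem_ball, dist_comm, hb1]; exact hsδ
  -- Steps of the same length towards p and towards q both prolong the segment from y to x, so
  -- non-branching identifies them.
  have hab : a = b := by
    refine eq_of_dist_eq_add hf hyδ ha hb hyx ?_ ?_ (ha1.trans hb1.symm)
    · have h1 := dist_triangle y a p
      have h2 := dist_triangle y x a
      linarith
    · have h1 := dist_triangle y b q
      have h2 := dist_triangle y x b
      linarith
  subst hab
  have hax : a ≠ x := fun h => by rw [h, dist_self] at ha1; exact hs0.ne ha1
  exact ⟨a, hax, by linarith, isOnCommonGeodesic_of_dist_eq_add hf hfδ ha hax (by linarith)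
    (by linarith) (by linarith)⟩

/-- A common geodesic ends at a common endpoint. -/
lemma IsOnCommonGeodesic.eq [CompleteSpace M] (hE : HasEuclideanBalls n M)
    (hI : HasIntermediatePoints M) {p q x₀ : M} (h₀ : IsOnCommonGeodesic p q x₀) : p = q := by
  by_contra hne
  have hpos : ∀ x, IsOnCommonGeodesic p q x → 0 < dist x p := by
    intro x hx
    refine dist_pos.2 fun h => hne ?_
    have h1 := hx.1
    rw [h, dist_self] at h1
    exact dist_eq_zero.1 h1.symm
  -- successors, chosen almost as close to `p` as possible
  let succ : M → Set M := fun x =>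
    {y | IsOnCommonGeodesic p q y ∧ dist x p = dist x y + dist y p}
  have step : ∀ x : {x // IsOnCommonGeodesic p q x}, ∃ x' : {x // IsOnCommonGeodesic p q x},
      x'.1 ∈ succ x.1 ∧ dist x'.1 p < dist x.1 p ∧
        ∀ y ∈ succ x.1, dist x'.1 p ≤ (dist y p + dist x.1 p) / 2 := by
    rintro ⟨x, hx⟩
    obtain ⟨y, hyx, hyd, hy⟩ := hx.exists_next hE hI (hpos x hx)
    have hylt : dist y p < dist x p := by
      have := dist_pos.2 hyx.symm
      linarith
    set I := (fun y => dist y p) '' succ x with hIdef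
    have hIne : I.Nonempty := ⟨_, y, ⟨hy, hyd⟩, rfl⟩
    have hIbdd : BddBelow I := ⟨0, by rintro _ ⟨z, -, rfl⟩; exact dist_nonneg⟩
    have hinf : sInf I ≤ dist y p := csInf_le hIbdd ⟨y, ⟨hy, hyd⟩, rfl⟩
    obtain ⟨_, ⟨z, hz, rfl⟩, hzlt⟩ := exists_lt_of_csInf_lt hIne
      (show sInf I < (sInf I + dist x p) / 2 by linarith)
    refine ⟨⟨z, hz.1⟩, hz, by linarith, fun y' hy' => ?_⟩
    have : sInf I ≤ dist y' p := csInf_le hIbdd ⟨y', hy', rfl⟩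
    linarith
  choose next hnext1 hnext2 hnext3 using step
  set u : ℕ → {x // IsOnCommonGeodesic p q x} := fun k => next^[k] ⟨x₀, h₀⟩ with hu
  have hus : ∀ k, u (k + 1) = next (u k) := fun k => Function.iterate_succ_apply' _ _ _
  have hchain : ∀ k l, k ≤ l → dist (u k).1 p = dist (u k).1 (u l).1 + dist (u l).1 p := by
    intro k l hkl
    induction l, hkl using Nat.le_induction with
    | base => simp
    | succ l _ ih =>
      have h1 := (hnext1 (u l)).2
      rw [← hus] at h1
      have h2 := dist_triangle (u k).1 (u l).1 (u (l + 1)).1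
      have h3 := dist_triangle (u k).1 (u (l + 1)).1 p
      linarith
  have hanti : StrictAnti fun k => dist (u k).1 p := strictAnti_nat_of_succ_lt fun k => by
    have := hnext2 (u k)
    rwa [← hus] at this
  have hbdd : BddBelow (range fun k => dist (u k).1 p) :=
    ⟨0, by rintro _ ⟨k, rfl⟩; exact dist_nonneg⟩
  have hlimd := tendsto_atTop_ciInf hanti.antitone hbdd
  -- Along the chain, distances between terms are differences of the decreasing distances to p.
  -- Completeness then supplies a limit, which again lies on a common geodesic.
  have hcauchy : CauchySeq fun k => (u k).1 := by
    refine cauchySeq_of_le_tendsto_0' (fun k => dist (u k).1 p - ⨅ k, dist (u k).1 p)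
      (fun k l hkl => ?_) (by simpa using hlimd.sub_const (⨅ k, dist (u k).1 p))
    have h1 := hchain k l hkl
    have h2 := ciInf_le hbdd l
    linarith
  obtain ⟨x, hx⟩ := cauchySeq_tendsto_of_complete hcauchy
  have hxp : Filter.Tendsto (fun k => dist (u k).1 p) Filter.atTop (𝓝 (dist x p)) :=
    hx.dist tendsto_const_nhds
  have hxlt : ∀ k, dist x p < dist (u k).1 p := fun k =>
    (hanti.antitone.le_of_tendsto hxp (k + 1)).trans_lt (hanti k.lt_succ_self)
  have hxchain : ∀ k, dist (u k).1 p = dist (u k).1 x + dist x p := by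
    intro k
    have h1 : Filter.Tendsto (fun l => dist (u k).1 (u l).1 + dist (u l).1 p) Filter.atTop
        (𝓝 (dist (u k).1 x + dist x p)) := (tendsto_const_nhds.dist hx).add hxp
    refine tendsto_nhds_unique ?_ h1
    refine tendsto_const_nhds.congr' ?_
    filter_upwards [Filter.eventually_ge_atTop k] with l hl using hchain k l hl
  have hxq : dist x p = dist x q := by
    refine tendsto_nhds_unique hxp ((hx.dist tendsto_const_nhds).congr fun k => ?_)
    exact (u k).2.1.symm
  have hxG : IsOnCommonGeodesic p q x := by
    refine ⟨hxq, fun ε hε => ?_⟩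
    obtain ⟨k, hk⟩ := (Metric.tendsto_atTop.1 hx ε hε)
    refine ⟨(u k).1, fun h => ?_, hk k le_rfl, hxchain k, ?_⟩
    · have := hxlt k
      rw [h] at this
      exact lt_irrefl _ this
    · rw [← hxq, ← (u k).2.1]
      exact hxchain k
  obtain ⟨y, hyx, hyd, hy⟩ := hxG.exists_next hE hI (hpos x hxG)
  have hysucc : ∀ k, y ∈ succ (u k).1 := by
    intro k
    refine ⟨hy, le_antisymm (dist_triangle _ _ _) ?_⟩
    have h1 := dist_triangle (u k).1 x y
    have h2 := hxchain k
    linarith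
  -- The continuation y of the limit was an admissible successor at every stage, so the nearly
  -- optimal choices must have come at least this close to p; but y is strictly closer to p than x.
  have hlim : dist x p ≤ (dist y p + dist x p) / 2 := by
    refine le_of_tendsto_of_tendsto' (hxp.comp (Filter.tendsto_add_atTop_nat 1))
      ((hxp.const_add (dist y p)).div_const 2) fun k => ?_
    have := hnext3 (u k) y (hysucc k)
    rwa [← hus] at this
  have := dist_pos.2 hyx.symm
  linarith

/-- A point is determined by its distances from the points of a nonempty open set. -/
theorem eq_of_dist_eq_on_open [CompleteSpace M] (hE : HasEuclideanBalls n M)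
    (hI : HasIntermediatePoints M) {p q : M} {V : Set M} (hV : IsOpen V) (hne : V.Nonempty)
    (h : ∀ x ∈ V, dist x p = dist x q) : p = q := by
  obtain ⟨x, hx⟩ := hne
  rcases (dist_nonneg (x := x) (y := p)).eq_or_lt with h0 | h0
  · have h1 := h x hx
    rw [← h0] at h1
    rw [← dist_eq_zero.1 h0.symm, dist_eq_zero.1 h1.symm]
  obtain ⟨δ, f, hδ, hf, hfδ⟩ := hE x
  obtain ⟨ε, hε, hεV⟩ := Metric.isOpen_iff.1 hV x hx
  have hm : 0 < min (min δ ε) (dist x p) := lt_min (lt_min hδ hε) h0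
  set s := min (min δ ε) (dist x p) / 2 with hs
  have hs0 : 0 < s := by positivity
  have h1 := min_le_left (min δ ε) (dist x p)
  have h2 := min_le_right (min δ ε) (dist x p)
  have h3 := min_le_left δ ε
  have h4 := min_le_right δ ε
  -- A short step towards p stays in V. Equality of distances at x and at a shows that it is also a
  -- step towards q, which starts a common geodesic.
  obtain ⟨a, ha1, ha2⟩ := exists_dist_eq_sub hI hf hfδ (p := p) (s := s) hs0.le (by linarith)
    (by linarith)
  have haV : a ∈ V := hεV (by rw [Metric.mem_ball, dist_comm, ha1]; linarith)
  have haδ : a ∈ Metric.ball x δ := by rw [Metric.mem_ball, dist_comm, ha1]; linarith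
  have hax : a ≠ x := fun h => by rw [h, dist_self] at ha1; exact hs0.ne ha1
  have h5 := h x hx
  have h6 := h a haV
  exact (isOnCommonGeodesic_of_dist_eq_add hf hfδ haδ hax h6 (by linarith) (by linarith)).eq hE hI

end MetricGeometry

/-! ### Open images of similitudes and right cancellation -/

section Similitudes

/-- A similitude of a Euclidean ball into a Euclidean space of the same dimension maps onto a
ball. -/
lemma ball_subset_image_of_dist_eq {n : ℕ} {g : EuclideanSpace ℝ (Fin n) → EuclideanSpace ℝ (Fin n)}
    {a : EuclideanSpace ℝ (Fin n)} {ε c : ℝ} (hε : 0 < ε) (hc : 0 < c)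
    (hg : ∀ u ∈ Metric.ball a ε, ∀ v ∈ Metric.ball a ε, dist (g u) (g v) = c * dist u v) :
    Metric.ball (g a) (c * ε) ⊆ g '' Metric.ball a ε := by
  have ha : a ∈ Metric.ball a ε := Metric.mem_ball_self hε
  -- Normalised to fix the origin and to have ratio one, the map preserves inner products by
  -- polarisation. Its values on a rescaled basis give an orthonormal basis, and matching
  -- coordinates produces preimages.
  set G : EuclideanSpace ℝ (Fin n) → EuclideanSpace ℝ (Fin n) :=
    fun u => c⁻¹ • (g (a + u) - g a) with hG
  have hmem : ∀ u : EuclideanSpace ℝ (Fin n), ‖u‖ < ε → a + u ∈ Metric.ball a ε := by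
    intro u hu
    simpa [Metric.mem_ball, dist_eq_norm] using hu
  have hsub : ∀ u v : EuclideanSpace ℝ (Fin n), ‖u‖ < ε → ‖v‖ < ε → ‖G u - G v‖ = ‖u - v‖ := by
    intro u v hu hv
    have h1 := hg _ (hmem u hu) _ (hmem v hv)
    rw [dist_eq_norm, dist_eq_norm, add_sub_add_left_eq_sub] at h1
    rw [hG]
    simp only
    rw [← smul_sub, sub_sub_sub_cancel_right, norm_smul, h1, Real.norm_of_nonneg (inv_pos.2 hc).le,
      inv_mul_cancel_left₀ hc.ne']
  have hG0 : G 0 = 0 := by simp [hG]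
  have hnorm : ∀ u : EuclideanSpace ℝ (Fin n), ‖u‖ < ε → ‖G u‖ = ‖u‖ := by
    intro u hu
    simpa [hG0] using hsub u 0 hu (by simpa using hε)
  have hinner : ∀ u v : EuclideanSpace ℝ (Fin n), ‖u‖ < ε → ‖v‖ < ε →
      inner ℝ (G u) (G v) = inner ℝ u v := by
    intro u v hu hv
    rw [real_inner_eq_norm_mul_self_add_norm_mul_self_sub_norm_sub_mul_self_div_two,
      real_inner_eq_norm_mul_self_add_norm_mul_self_sub_norm_sub_mul_self_div_two,
      hnorm u hu, hnorm v hv, hsub u v hu hv]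
  set e := EuclideanSpace.basisFun (Fin n) ℝ with he
  have heε : ∀ i, ‖(ε / 2) • e i‖ < ε := by
    intro i
    rw [norm_smul, e.orthonormal.1 i, mul_one, Real.norm_of_nonneg (by linarith)]
    linarith
  have hε2 : 2 / ε * (ε / 2) = 1 := by field_simp
  have hon : Orthonormal ℝ fun i => (2 / ε) • G ((ε / 2) • e i) := by
    rw [orthonormal_iff_ite]
    intro i j
    rw [real_inner_smul_left, real_inner_smul_right, hinner _ _ (heε i) (heε j),
      real_inner_smul_left, real_inner_smul_right, orthonormal_iff_ite.1 e.orthonormal i j]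
    calc _ = (2 / ε * (ε / 2)) * (2 / ε * (ε / 2)) * (if i = j then 1 else 0 : ℝ) := by ring
      _ = _ := by rw [hε2]; ring
  obtain ⟨b, hb⟩ := Orthonormal.exists_orthonormalBasis_extension_of_card_eq
    (𝕜 := ℝ) (E := EuclideanSpace ℝ (Fin n)) (ι := Fin n) (by simp)
    (v := fun i => (2 / ε) • G ((ε / 2) • e i)) (s := univ)
    (hon.comp _ Subtype.val_injective)
  intro y hy
  set z := c⁻¹ • (y - g a) with hz
  have hzε : ‖z‖ < ε := by
    rw [hz, norm_smul, Real.norm_of_nonneg (inv_pos.2 hc).le, inv_mul_lt_iff₀ hc]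
    rwa [Metric.mem_ball, dist_eq_norm] at hy
  set u := e.repr.symm (b.repr z) with hu
  have huε : ‖u‖ < ε := by simpa [hu] using hzε
  have hGu : G u = z := by
    refine b.repr.injective ?_
    ext i
    have h1 : b.repr z i = e.repr u i := by simp [hu]
    rw [h1, b.repr_apply_apply, e.repr_apply_apply, hb i (mem_univ i), real_inner_smul_left,
      hinner _ _ (heε i) huε, real_inner_smul_left, ← mul_assoc, hε2, one_mul]
  refine ⟨a + u, hmem u huε, ?_⟩
  have h1 : c⁻¹ • (g (a + u) - g a) = c⁻¹ • (y - g a) := hGu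
  have h2 := smul_right_injective _ (inv_pos.2 hc).ne' h1
  simpa using h2

variable {n : ℕ} {M : Type*} [MetricSpace M] {W : Set M} {Ω : Set W}

/-- Similitudes are open maps, in a weak sense. -/
lemma exists_isOpen_subset_image (hE : HasEuclideanBalls n M)
    (hΩ : Ω.Nonempty) (hopen : IsOpen (Subtype.val '' Ω : Set M)) {T : W → W} {c : ℝ} (hc : 0 < c)
    (hT : ∀ x y, dist (T x) (T y) = c * dist x y) :
    ∃ V : Set M, IsOpen V ∧ V.Nonempty ∧ V ⊆ (fun x => (T x : M)) '' Ω := by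
  obtain ⟨z, hz⟩ := hΩ
  have hne : Nonempty M := ⟨z⟩
  obtain ⟨δ₁, f₁, hδ₁, hf₁, hb₁⟩ := hE z
  obtain ⟨δ₂, f₂, hδ₂, hf₂, hb₂⟩ := hE (T z)
  obtain ⟨ε₀, hε₀, hball⟩ := Metric.isOpen_iff.1 hopen z ⟨z, hz, rfl⟩
  set ε := min (min δ₁ ε₀) (δ₂ / c) with hε
  have hε0 : 0 < ε := lt_min (lt_min hδ₁ hε₀) (by positivity)
  have hε1 : ε ≤ δ₁ := (min_le_left _ _).trans (min_le_left _ _)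
  have hε2 : ε ≤ ε₀ := (min_le_left _ _).trans (min_le_right _ _)
  have hε3 : c * ε ≤ δ₂ := by
    have : ε ≤ δ₂ / c := min_le_right _ _
    rw [le_div_iff₀ hc] at this
    linarith
  -- the inverse of the chart at `z`, with values in `Ω`
  have hinv : ∀ v, ∃ x : W, v ∈ Metric.ball (f₁ z) ε → x ∈ Ω ∧ (x : M) ∈ Metric.ball (z : M) ε ∧
      f₁ x = v := by
    intro v
    by_cases hv : v ∈ Metric.ball (f₁ z) ε
    · obtain ⟨m, hm, rfl⟩ : v ∈ f₁ '' Metric.ball (z : M) δ₁ := by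
        rw [hb₁]; exact Metric.ball_subset_ball hε1 hv
      have hmz : m ∈ Metric.ball (z : M) ε := by
        rwa [Metric.mem_ball, hf₁ m hm z (Metric.mem_ball_self hδ₁)] at hv
      obtain ⟨x, hx, rfl⟩ := hball (Metric.ball_subset_ball hε2 hmz)
      exact ⟨x, fun _ => ⟨hx, hmz, rfl⟩⟩
    · exact ⟨z, fun h => absurd h hv⟩
  choose h hh using hinv
  have hT₂ : ∀ x : W, (x : M) ∈ Metric.ball (z : M) ε →
      (T x : M) ∈ Metric.ball (T z : M) (c * ε) := by
    intro x hx
    rw [Metric.mem_ball] at hx ⊢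
    have := hT x z
    rw [Subtype.dist_eq, Subtype.dist_eq] at this
    rw [this]
    exact mul_lt_mul_of_pos_left hx hc
  have hsub₂ : Metric.ball (T z : M) (c * ε) ⊆ Metric.ball (T z : M) δ₂ :=
    Metric.ball_subset_ball hε3
  have hgdist : ∀ u ∈ Metric.ball (f₁ z) ε, ∀ v ∈ Metric.ball (f₁ z) ε,
      dist (f₂ (T (h u))) (f₂ (T (h v))) = c * dist u v := by
    intro u hu v hv
    obtain ⟨-, h1, h2⟩ := hh u hu
    obtain ⟨-, h3, h4⟩ := hh v hv
    rw [hf₂ _ (hsub₂ (hT₂ _ h1)) _ (hsub₂ (hT₂ _ h3)), ← Subtype.dist_eq, hT, Subtype.dist_eq,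
      ← hf₁ _ (Metric.ball_subset_ball hε1 h1) _ (Metric.ball_subset_ball hε1 h3), h2, h4]
  have hsurj := ball_subset_image_of_dist_eq (g := fun v => f₂ (T (h v))) hε0 hc hgdist
  have hz' : h (f₁ z) = z := by
    obtain ⟨-, h1, h2⟩ := hh (f₁ z) (Metric.mem_ball_self hε0)
    have h3 := hf₁ _ (Metric.ball_subset_ball hε1 h1) z (Metric.mem_ball_self hδ₁)
    rw [h2, dist_self] at h3
    exact Subtype.ext (dist_eq_zero.1 h3.symm)
  simp only [hz'] at hsurj
  refine ⟨Metric.ball (T z : M) (c * ε), Metric.isOpen_ball,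
    ⟨_, Metric.mem_ball_self (by positivity)⟩, fun m hm => ?_⟩
  have hm2 : f₂ m ∈ Metric.ball (f₂ (T z)) (c * ε) := by
    rw [Metric.mem_ball, hf₂ m (hsub₂ hm) _ (Metric.mem_ball_self hδ₂)]
    exact hm
  obtain ⟨v, hv, hvm⟩ := hsurj hm2
  obtain ⟨h1, h2, -⟩ := hh v hv
  refine ⟨h v, h1, ?_⟩
  have h3 := hf₂ _ (hsub₂ (hT₂ _ h2)) m (hsub₂ hm)
  simp only at hvm
  rw [hvm, dist_self] at h3
  exact dist_eq_zero.1 h3.symm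

/-- S_u and S_u' have equal ratios and agree on the image of S_w, so S_u x and S_u' x are equally
far from every point of S_{uw}(Ω), which contains a nonempty open set. -/
lemma isRightCancellative_of_hasEuclideanBalls [CompleteSpace M] [Nontrivial W]
    (hE : HasEuclideanBalls n M)
    (hI : HasIntermediatePoints M) (hΩ : Ω.Nonempty) (hopen : IsOpen (Subtype.val '' Ω : Set M))
    {N : ℕ} {S : Fin N → W → W} {ρ : Fin N → ℝ} (hS : IsContractiveSimilitudes S ρ) :
    IsRightCancellative S := by
  intro u u' w h
  have hρ : wordRatio ρ u = wordRatio ρ u' := by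
    have h1 := wordRatio_eq_of_wordMap_eq hS (u := u ++ w) (v := u' ++ w)
      (by rw [wordMap_append, wordMap_append, h])
    rw [wordRatio_append, wordRatio_append] at h1
    exact mul_right_cancel₀ (wordRatio_pos hS w).ne' h1
  obtain ⟨V, hV, hVne, hVsub⟩ := exists_isOpen_subset_image hE hΩ hopen (wordRatio_pos hS (u ++ w))
    (dist_wordMap hS (u ++ w))
  funext x
  refine Subtype.ext (eq_of_dist_eq_on_open hE hI hV hVne fun m hm => ?_)
  obtain ⟨y, -, rfl⟩ := hVsub hm
  have h1 : wordMap S (u ++ w) y = wordMap S u (wordMap S w y) := by rw [wordMap_append]; rfl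
  have h2 : wordMap S (u ++ w) y = wordMap S u' (wordMap S w y) := by
    rw [wordMap_append, h]; rfl
  simp only [← Subtype.dist_eq]
  calc dist (wordMap S (u ++ w) y) (wordMap S u x)
      = wordRatio ρ u * dist (wordMap S w y) x := by rw [h1, dist_wordMap hS]
    _ = dist (wordMap S (u ++ w) y) (wordMap S u' x) := by rw [h2, dist_wordMap hS, hρ]

end Similitudes

/-! ### Regularity of the Hausdorff measure on W -/

section Measure

open MeasureTheory Measure

lemma hausdorffMeasure_image_of_dist_eq {X Y : Type*} [MetricSpace X] [MeasurableSpace X]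
    [BorelSpace X] [MetricSpace Y] [MeasurableSpace Y] [BorelSpace Y] {f : X → Y} {s : Set X}
    (hf : ∀ x ∈ s, ∀ y ∈ s, dist (f x) (f y) = dist x y) {d : ℝ} (hd : 0 ≤ d) :
    μH[d] (f '' s) = μH[d] s := by
  have h1 : Isometry fun x : s => f x := Isometry.of_dist_eq fun x y => hf x x.2 y y.2
  have h2 : Isometry fun x : s => (x : X) := isometry_subtype_coe
  have h3 := h1.hausdorffMeasure_image (Or.inl hd) univ
  have h4 := h2.hausdorffMeasure_image (Or.inl hd) univ
  rw [image_univ] at h3 h4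
  rw [Subtype.range_coe] at h4
  rw [h4, ← h3, image_eq_range]

instance isAddHaarMeasure_hausdorffMeasure_euclideanSpace (n : ℕ) :
    IsAddHaarMeasure (μH[n] : Measure (EuclideanSpace ℝ (Fin n))) := by
  simpa using isAddHaarMeasure_hausdorffMeasure (E := EuclideanSpace ℝ (Fin n))

variable {n : ℕ} {M : Type*} [MetricSpace M] {W : Set M} [MeasurableSpace W] [BorelSpace W]

lemma exists_hausdorffMeasure_closedBall_le (hE : HasEuclideanBalls n M) (hW : IsCompact W) :
    ∃ C R₀ : ℝ, 0 < R₀ ∧ ∀ (x : W) (R : ℝ), 0 < R → R ≤ R₀ →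
      μH[n] (Metric.closedBall x R) ≤ ENNReal.ofReal (C * R ^ n) := by
  choose δ f hδ hf hb using hE
  have : CompactSpace W := isCompact_iff_compactSpace.1 hW
  -- A Lebesgue number makes the radius uniform: every small ball of W lies in one Euclidean chart.
  obtain ⟨r, hr, hleb⟩ := lebesgue_number_lemma_of_metric (isCompact_univ (X := W))
    (c := fun y : W => Metric.ball y (δ y)) (fun y => Metric.isOpen_ball)
    fun x _ => mem_iUnion.2 ⟨x, Metric.mem_ball_self (hδ x)⟩
  set c₁ := (μH[n] : Measure (EuclideanSpace ℝ (Fin n))) (Metric.ball 0 1) with hc₁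
  have hc₁t : c₁ ≠ ⊤ := measure_ball_lt_top.ne
  refine ⟨c₁.toReal, r / 2, by linarith, fun x R hR hRr => ?_⟩
  obtain ⟨y, hy⟩ := hleb x (mem_univ x)
  have hsub : Metric.closedBall x R ⊆ Metric.ball y (δ y) :=
    (Metric.closedBall_subset_ball (by linarith)).trans hy
  have hiso : ∀ a ∈ Metric.closedBall x R, ∀ b ∈ Metric.closedBall x R,
      dist (f y (a : M)) (f y (b : M)) = dist a b := fun a ha b hb' =>
    hf y _ (hsub ha) _ (hsub hb')
  rw [← hausdorffMeasure_image_of_dist_eq (f := fun a : W => f y (a : M)) hiso (by positivity)]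
  calc μH[n] ((fun a : W => f y (a : M)) '' Metric.closedBall x R)
      ≤ μH[n] (Metric.closedBall (f y x) R) := by
        refine measure_mono ?_
        rintro _ ⟨a, ha, rfl⟩
        rw [Metric.mem_closedBall, hiso a ha x (Metric.mem_closedBall_self hR.le)]
        exact ha
    _ = ENNReal.ofReal (c₁.toReal * R ^ n) := by
        rw [addHaar_closedBall _ _ hR.le, finrank_euclideanSpace_fin,
          mul_comm c₁.toReal, ENNReal.ofReal_mul (by positivity), ENNReal.ofReal_toReal hc₁t]

lemma exists_isCompact_hausdorffMeasure_ne_zero (hE : HasEuclideanBalls n M) (hW : IsCompact W)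
    {Ω : Set W} (hΩ : Ω.Nonempty) (hopen : IsOpen (Subtype.val '' Ω : Set M)) :
    ∃ B ⊆ Ω, IsCompact B ∧ μH[n] B ≠ 0 := by
  have : CompactSpace W := isCompact_iff_compactSpace.1 hW
  obtain ⟨z, hz⟩ := hΩ
  obtain ⟨δ, f, hδ, hf, hb⟩ := hE z
  obtain ⟨ε, hε, hball⟩ := Metric.isOpen_iff.1 hopen z ⟨z, hz, rfl⟩
  set r := min δ ε / 2 with hr
  have hm : 0 < min δ ε := lt_min hδ hε
  have hr0 : 0 < r := by positivity
  have hrδ : r < δ := by have := min_le_left δ ε; linarith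
  have hrε : r < ε := by have := min_le_right δ ε; linarith
  refine ⟨Metric.closedBall z r, fun x hx => ?_, Metric.isClosed_closedBall.isCompact, ?_⟩
  · obtain ⟨y, hy, hyx⟩ := hball (Metric.closedBall_subset_ball hrε
      (show (x : M) ∈ Metric.closedBall (z : M) r from hx))
    rwa [← Subtype.ext hyx]
  · have hiso : ∀ a ∈ Metric.closedBall z r, ∀ b ∈ Metric.closedBall z r,
        dist (f (a : M)) (f (b : M)) = dist a b := fun a ha b hb' =>
      hf _ (Metric.closedBall_subset_ball hrδ
        (show (a : M) ∈ Metric.closedBall (z : M) r from ha)) _ (Metric.closedBall_subset_ball hrδ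
        (show (b : M) ∈ Metric.closedBall (z : M) r from hb'))
    rw [← hausdorffMeasure_image_of_dist_eq (f := fun a : W => f (a : M)) hiso (by positivity)]
    refine (lt_of_lt_of_le (Metric.measure_ball_pos μH[n] (f z) hr0) (measure_mono ?_)).ne'
    intro v hv
    obtain ⟨m, hm, rfl⟩ : v ∈ f '' Metric.ball (z : M) δ := by
      rw [hb]; exact Metric.ball_subset_ball hrδ.le hv
    rw [Metric.mem_ball, hf m hm z (Metric.mem_ball_self hδ)] at hv
    obtain ⟨x, -, rfl⟩ := hball (show m ∈ Metric.ball (z : M) ε from hv.trans hrε)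
    exact ⟨x, le_of_lt hv, rfl⟩

lemma nontrivial_of_hausdorffMeasure_ne_zero {X : Type*} [MetricSpace X] [MeasurableSpace X]
    [BorelSpace X] {d : ℝ} (hd : 0 < d) {B : Set X} (hB : μH[d] B ≠ 0) : Nontrivial X := by
  by_contra h
  rw [not_nontrivial_iff_subsingleton] at h
  have := nullSingletonClass_hausdorff X hd
  exact hB (subsingleton_of_subsingleton.measure_zero _)

end Measure

end FiniteTypeIFS

theorem theorem1p5 {n : ℕ} (hn : 1 ≤ n) {M : Type*} [MetricSpace M] [CompleteSpace M]
    [ChartedSpace (EuclideanSpace ℝ (Fin n)) M] [IsManifold (𝓡 n) ∞ M]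
    [RiemannianBundle (fun x : M => TangentSpace (𝓡 n) x)]
    [IsContMDiffRiemannianBundle (𝓡 n) ∞ (EuclideanSpace ℝ (Fin n))
      (fun x : M => TangentSpace (𝓡 n) x)]
    [IsRiemannianManifold (𝓡 n) M]
    (horient : IsOrientable n M) (hflat : IsLocallyEuclidean n M)
    {W : Set M} (hW : IsCompact W)
    {N : ℕ} (hN : 2 ≤ N) (S : Fin N → W → W) (ρ : Fin N → ℝ)
    (hS : IsContractiveSimilitudes S ρ)
    (K : Set W) (hK : IsAttractor S K)
    (ℳ : ℕ → Finset (List (Fin N))) (Ω : Set W) (hΩ : Ω.Nonempty)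
    (hFTC : IsFiniteType S ℳ Ω hΩ)
    (rep : NbhdType S ℳ Ω hΩ → Vertex S ℳ) (hrep : IsRepresentatives rep) :
    haveI := hFTC.finite
    ∃ α : ℝ, 0 ≤ α ∧
      matrixSpectralRadius (weightedIncidenceMatrix ρ Ω hΩ rep α) = 1 ∧
      (∀ β : ℝ, matrixSpectralRadius (weightedIncidenceMatrix ρ Ω hΩ rep β) = 1 → β = α) ∧
      dimH (Subtype.val '' K : Set M) = ENNReal.ofReal α := by
  have hfin := hFTC.finite
  have : CompactSpace W := isCompact_iff_compactSpace.1 hW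
  borelize ↥W
  have hE := hasEuclideanBalls_of_isLocallyEuclidean hflat
  have hI := hasIntermediatePoints_of_isRiemannianManifold n (M := M)
  obtain ⟨C, R₀, hR₀, hreg⟩ := exists_hausdorffMeasure_closedBall_le hE hW
  obtain ⟨B, hBΩ, hB, hB0⟩ := exists_isCompact_hausdorffMeasure_ne_zero hE hW hΩ hFTC.isOpen
  -- In positive dimension a one-point space has measure zero; this is where n ≥ 1 enters.
  have : Nontrivial W := nontrivial_of_hausdorffMeasure_ne_zero (by exact_mod_cast hn) hB0
  rw [isometry_subtype_coe.dimH_image]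
  exact exists_dimH_eq_of_upperRegular
    (isRightCancellative_of_hasEuclideanBalls hE hI hΩ hFTC.isOpen hS) hS hFTC.invariant
    hFTC.nested hK hrep hBΩ hB hB0 hR₀ hreg
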